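/- Let $d\ge 1$, $\mathcal H=[-\tfrac12,\tfrac12)^d$, and let $f_x$ be a probability density on $\mathcal H$. For $n,m\ge1$ let ${\bf x}_1,\dots,{\bf x}_m$ be i.i.d. with density $f_x$, and let ${\bf V}$ be the $n^d\times m$ $d$-fold Vandermonde matrix with entries ${\bf V}_{\boldsymbol\ell,q}=m^{-1/2}e^{-2\pi \mathrm i\,\boldsymbol\ell^{\mathsf T}{\bf x}_q}$, $\boldsymbol\ell\in\{0,\dots,n-1\}^d$, $1\le q\le m$. For $\gamma\ge0$ put $$\eta^{(n,m)}_x(d,\gamma)=\mathbb E\Big[\tfrac1{n^d}\operatorname{Tr}\big((\gamma{\bf V}{\bf V}^{\mathsf H}+{\bf I})^{-1}\big)\Big],\qquad \eta_x(d,\beta,\gamma)=\lim\eta^{(n,m)}_x(d,\gamma),$$ the limit being over $n,m\to\infty$ with $\beta_{n,m}=n^d/m\to\beta$, where $0<\beta<\infty$; write $\eta_u$ for $\eta_x$ when $f_x\equiv1$ (uniformly distributed points). Let $\mathcal A=\{{\bf z}\in\mathcal H: f_x({\bf z})>0\}$, let $|\cdot|$ be Lebesgue measure, and let $g_x(y)\,dy$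 denote the probability distribution on $(0,\infty)$ (not necessarily having a density) with distribution function $G_x(y)=|\{{\bf z}\in\mathcal A: f_x({\bf z})\le y\}|/|\mathcal A|$. For every $\beta>0$ and $\gamma\ge0$ the limits $\eta_u(d,\beta,\gamma)$ and $\eta_x(d,\beta,\gamma)$ exist, the integral below is that of an integrable function, and $$\eta_x(d,\beta,\gamma)=1-|\mathcal A|+|\mathcal A|\int_0^\infty g_x(y)\,\eta_u\Big(d,\frac{\beta}{y},\gamma y\Big)\,dy .$$ Hence the following holds for the asymptotic MSE of LMMSE field reconstruction. Let $\sigma_a,\sigma_n>0$ and $\gamma=\sigma_a^2/\sigma_n^2$. For each $n,m$ let the field spectrum ${\bf a}\in\mathbb C^{n^d}$ and the noise ${\bf n}\in\mathbb C^m$ be square-integrable random vectors, independent of ${\bf V}$, with $\mathbb E[{\bf a}{\bf a}^{\mathsf H}]=\sigma_a^2{\bf I}$, $\mathbb E[{\bf n}]=0$, $\mathbb E[{\bf n}{\bf n}^{\mathsf H}]=\sigma_n^2{\bf I}$, $\mathbb E[{\bf a}{\bf n}^{\mathsf H}]=0$, let ${\bf p}=\beta_{n,m}^{-1/2}{\bf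 V}^{\mathsf H}{\bf a}+{\bf n}$, and let $\hat{\bf a}=\mathbb E[{\bf a}{\bf p}^{\mathsf H}]\,\mathbb E[{\bf p}{\bf p}^{\mathsf H}]^{-1}{\bf p}$, where these two expectations are taken for given ${\bf V}$. Then $\mathrm{MSE}^{(n,m)}=\frac{1}{n^d\sigma_a^2}\mathbb E\|{\bf a}-\hat{\bf a}\|^2$ converges as $n,m\to\infty$, $n^d/m\to\beta$, and its limit is $$\mathrm{MSE}_\infty=\eta_x\Big(d,\beta,\frac{\gamma}{\beta}\Big)=1-|\mathcal A|+|\mathcal A|\int_0^\infty g_x(y)\,\eta_u\Big(d,\frac{\beta}{y},\frac{\gamma}{\beta}y\Big)\,dy .$$ -/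

import Mathlib

open MeasureTheory Filter Topology Set
open scoped Matrix ComplexConjugate

noncomputable section

namespace VandermondeField

/-- The hypercube `[-1/2, 1/2)^d`. -/
def cube (d : ℕ) : Set (Fin d → ℝ) := Set.univ.pi fun _ => Set.Ico (-1 / 2 : ℝ) (1 / 2)

/-- The law on `ℝ^d` with density `f` on the cube (and no mass outside it). -/
def pointLaw (d : ℕ) (f : (Fin d → ℝ) → ℝ) : Measure (Fin d → ℝ) :=
  (volume.restrict (cube d)).withDensity fun z => ENNReal.ofReal (f z)

/-- The joint law of `m` i.i.d. sampling points with density `f`. -/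
def samplingLaw (d m : ℕ) (f : (Fin d → ℝ) → ℝ) : Measure (Fin m → Fin d → ℝ) :=
  Measure.pi fun _ => pointLaw d f

/-- The `d`-fold `n^d × m` Vandermonde matrix with sampling points `x`. Rows are indexed by the
multi-indices `ℓ ∈ {0, …, n-1}^d`. -/
def vandermonde (d n m : ℕ) (x : Fin m → Fin d → ℝ) : Matrix (Fin d → Fin n) (Fin m) ℂ :=
  Matrix.of fun l q => (((m : ℝ) ^ (-1 / 2 : ℝ) : ℝ) : ℂ) *
    Complex.exp (-(2 * Real.pi * Complex.I) * ((∑ j, ((l j : ℕ) : ℝ) * x q j : ℝ) : ℂ))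

/-- The aspect ratio `n^d / m`. -/
def aspect (d n m : ℕ) : ℝ := (n : ℝ) ^ d / (m : ℝ)

/-- The asymptotic regime `n → ∞`, `m → ∞`, `n^d / m → β`. -/
def regime (d : ℕ) (β : ℝ) : Filter (ℕ × ℕ) :=
  (atTop ×ˢ atTop) ⊓ comap (fun p => aspect d p.1 p.2) (𝓝 β)

/-- The `η`-transform of `V Vᴴ` at finite size: the expectation of the normalized trace
of `(γ V Vᴴ + I)⁻¹`. -/
def etaFinite (d : ℕ) (f : (Fin d → ℝ) → ℝ) (γ : ℝ) (n m : ℕ) : ℝ :=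
  ∫ x, (Matrix.trace (((γ : ℂ) • (vandermonde d n m x * (vandermonde d n m x)ᴴ) + 1)⁻¹)).re
      / (n : ℝ) ^ d ∂(samplingLaw d m f)

/-- The asymptotic `η`-transform `η_x(d, β, γ)` of `V Vᴴ` for sampling points of density `f`. -/
def eta (d : ℕ) (f : (Fin d → ℝ) → ℝ) (β γ : ℝ) : ℝ :=
  limUnder (regime d β) fun p => etaFinite d f γ p.1 p.2

/-- The asymptotic `η`-transform `η_u(d, β, γ)` for uniformly distributed sampling points. -/
def etaU (d : ℕ) (β γ : ℝ) : ℝ := eta d (fun _ => 1) β γ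

/-- The part `𝒜` of the cube where the density `f` is positive. -/
def posSet (d : ℕ) (f : (Fin d → ℝ) → ℝ) : Set (Fin d → ℝ) := {z | z ∈ cube d ∧ 0 < f z}

/-- The distribution function `G_x` of the values of the density `f` on `𝒜`. -/
def levelCDF (d : ℕ) (f : (Fin d → ℝ) → ℝ) (y : ℝ) : ℝ :=
  volume.real {z | z ∈ posSet d f ∧ f z ≤ y} / volume.real (posSet d f)

/-- The probability distribution `g_x(y) dy` whose distribution function is `G_x`: the
image under `f` of normalized Lebesgue measure on `𝒜`. It is a measure and need not
have a density (for a piecewise constant `f` it is a sum of point masses). -/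
def levelLaw (d : ℕ) (f : (Fin d → ℝ) → ℝ) : Measure ℝ :=
  (volume (posSet d f))⁻¹ • (volume.restrict (posSet d f)).map f

theorem levelLaw_Iic (d : ℕ) (f : (Fin d → ℝ) → ℝ) (hf : Measurable f) (y : ℝ) :
    (levelLaw d f).real (Set.Iic y) = levelCDF d f y := by
  have h : MeasurableSet (f ⁻¹' Set.Iic y) := hf measurableSet_Iic
  have e : f ⁻¹' Set.Iic y ∩ posSet d f = {z | z ∈ posSet d f ∧ f z ≤ y} := by
    ext z; simp [and_comm]
  simp only [levelLaw, levelCDF, Measure.real, Measure.smul_apply, smul_eq_mul,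
    Measure.map_apply hf measurableSet_Iic, Measure.restrict_apply h, e, ENNReal.toReal_mul,
    ENNReal.toReal_inv]
  rw [div_eq_inv_mul]

theorem regime_neBot (d : ℕ) (hd : 1 ≤ d) (β : ℝ) (hβ : 0 < β) : (regime d β).NeBot := by
  have h1 : Tendsto (fun n : ℕ => (n : ℝ) ^ d / β) atTop atTop :=
    ((tendsto_pow_atTop (by omega)).comp tendsto_natCast_atTop_atTop).atTop_div_const hβ
  have h2 : Tendsto (fun n : ℕ => ⌈(n : ℝ) ^ d / β⌉₊) atTop atTop :=
    tendsto_nat_ceil_atTop.comp h1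
  have h3 : Tendsto (fun n : ℕ => aspect d n ⌈(n : ℝ) ^ d / β⌉₊) atTop (𝓝 β) := by
    have h4 := ((tendsto_nat_ceil_div_atTop (R := ℝ)).comp h1).inv₀ one_ne_zero
    have h5 := h4.mul_const β
    rw [inv_one, one_mul] at h5
    refine h5.congr fun n => ?_
    simp only [Function.comp, aspect, inv_div]
    field_simp
  have : Tendsto (fun n : ℕ => (n, ⌈(n : ℝ) ^ d / β⌉₊)) atTop (regime d β) :=
    tendsto_inf.2 ⟨tendsto_id.prodMk h2, tendsto_comap_iff.2 h3⟩
  exact this.neBot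

variable {Ω : Type*} [MeasurableSpace Ω]

/-- The correlation matrix `E[u wᴴ]` of two random vectors. -/
def corr {ι κ : Type*} (P : Measure Ω) (u : Ω → ι → ℂ) (w : Ω → κ → ℂ) : Matrix ι κ ℂ :=
  Matrix.of fun i j => ∫ ω, u ω i * conj (w ω j) ∂P

/-- The second-order assumptions on the field spectrum `a` and the measurement noise `e`:
`E[a aᴴ] = σa² I`, `E[e] = 0`, `E[e eᴴ] = σe² I`, and `a`, `e` are uncorrelated. -/
structure IsWhiteModel {ι κ : Type*} [DecidableEq ι] [DecidableEq κ] (P : Measure Ω)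
    (σa σe : ℝ) (a : Ω → ι → ℂ) (e : Ω → κ → ℂ) : Prop where
  memLp_field : ∀ i, MemLp (fun ω => a ω i) 2 P
  memLp_noise : ∀ q, MemLp (fun ω => e ω q) 2 P
  corr_field : corr P a a = ((σa ^ 2 : ℝ) : ℂ) • (1 : Matrix ι ι ℂ)
  mean_noise : ∀ q, ∫ ω, e ω q ∂P = 0
  corr_noise : corr P e e = ((σe ^ 2 : ℝ) : ℂ) • (1 : Matrix κ κ ℂ)
  corr_field_noise : corr P a e = 0

/-- The noisy samples `p = β_{n,m}^{-1/2} Vᴴ a + e` taken at the points `x`. -/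
def samples (d n m : ℕ) (a : Ω → (Fin d → Fin n) → ℂ) (e : Ω → Fin m → ℂ)
    (x : Fin m → Fin d → ℝ) (ω : Ω) : Fin m → ℂ :=
  ((aspect d n m ^ (-1 / 2 : ℝ) : ℝ) : ℂ) • ((vandermonde d n m x)ᴴ *ᵥ a ω) + e ω

/-- The LMMSE estimate `E[a pᴴ] E[p pᴴ]⁻¹ p` of the field spectrum, given the points `x`. -/
def lmmse (P : Measure Ω) (d n m : ℕ) (a : Ω → (Fin d → Fin n) → ℂ) (e : Ω → Fin m → ℂ)
    (x : Fin m → Fin d → ℝ) (ω : Ω) : (Fin d → Fin n) → ℂ :=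
  (corr P a (samples d n m a e x) *
    (corr P (samples d n m a e x) (samples d n m a e x))⁻¹) *ᵥ samples d n m a e x ω

/-- The mean square error of LMMSE reconstruction at finite size, per coefficient and relative to
the power `σa²` of a coefficient, averaged over the field, the noise and the
sampling points (the latter being independent of the former). -/
def mseFinite (P : Measure Ω) (σa : ℝ) (d : ℕ) (f : (Fin d → ℝ) → ℝ) (n m : ℕ)
    (a : Ω → (Fin d → Fin n) → ℂ) (e : Ω → Fin m → ℂ) : ℝ :=
  ∫ x, (∫ ω, ∑ l, ‖a ω l - lmmse P d n m a e x ω l‖ ^ 2 ∂P) / (σa ^ 2 * (n : ℝ) ^ d)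
    ∂(samplingLaw d m f)

end VandermondeField

end

open VandermondeField

/-! The transform is one minus the normalized expected loss, where the loss of a positive
semidefinite matrix `S` is `Tr (1 - (1 + S)⁻¹)`. The loss has three useful properties. A rank one
term, that is one more sampling point, raises it by an amount in [0, 1] (`resLoss_add_rank_one`). It
is the same for `W * Wᴴ` and `Wᴴ * W` (`resLoss_mul_conjTranspose`). It is stable under
perturbations small in Frobenius norm (`abs_resLoss_sub_le`). By the second property only the Gram
matrix of the points matters, and its entries are products of Dirichlet kernels of the coordinate
differences.

The squared Dirichlet kernel concentrates at distance of order 1 / n. If the cube is cut into p^d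
cells with p / n small, Gram entries between different cells are therefore negligible in mean
square, and the loss is nearly the sum of the losses of the single cells
(`abs_meanLoss_sub_sum_indicator_le`). For a density constant on cells, the number of points in a
cell is binomial and the points are conditionally uniform there. Since the loss is 1-Lipschitz in
the number of points, that number may be replaced by its mean up to rounding. By translation
invariance of the Gram matrix the outcome depends on the cell only through this number
(`abs_meanLoss_stepFun_sub_le`).

For uniform points, cells of side about L / n hold a bounded mean number of points, and the loss of
such a cell converges as n grows because the rescaled Dirichlet kernel does. Letting L grow shows
that the uniform sequence is Cauchy; its limit `uniLimit d τ u` is never computed. For a continuous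
density, cells of side about n^(-1/2) are small on the macroscopic scale and large on the scale 1 /
n, so each behaves like uniform points of the local density (`tendsto_meanLoss_of_continuous`).
Continuous densities are dense in L¹ and the normalized loss is continuous in the L¹ distance, which
gives every density (`tendsto_meanLoss`).

Hence the limit is 1 minus the integral over the cube of `uniLimit d (γ * β) (β⁻¹ * f z)`. The
substitution β / y, γ y keeps the product γ β fixed, the integrand vanishes where f = 0, and the
push-forward under f gives the formula. The LMMSE error is the same resolvent trace with γ / β in
place of γ, by the orthogonality principle. -/

noncomputable section

namespace VandermondeField

open scoped ComplexOrder

/-! ### Trace inequalities for resolvents of positive semidefinite matrices -/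

section ResolventTrace

variable {ι κ : Type*} [Fintype ι] [DecidableEq ι] [Fintype κ] [DecidableEq κ]

/-- `Tr (1 - (1 + S)⁻¹)`, the deficit of the resolvent trace of `S`. -/
def resLoss (S : Matrix ι ι ℂ) : ℝ := Fintype.card ι - (Matrix.trace (1 + S)⁻¹).re

theorem isUnit_one_add {S : Matrix ι ι ℂ} (hS : S.PosSemidef) : IsUnit (1 + S).det :=
  (Matrix.isUnit_iff_isUnit_det _).1 ((Matrix.PosDef.one.add_posSemidef hS).isUnit)

theorem posSemidef_resolvent {S : Matrix ι ι ℂ} (hS : S.PosSemidef) :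
    ((1 + S)⁻¹).PosSemidef :=
  (Matrix.PosSemidef.one.add hS).inv

/-- With u the image of v one has v = u + S u, and the cross term in the expansion of ‖v‖² is 2 Re
⟨u, S u⟩ ≥ 0. -/
theorem resolvent_mulVec_norm_le {S : Matrix ι ι ℂ} (hS : S.PosSemidef) (v : ι → ℂ) :
    ∑ i, ‖((1 + S)⁻¹ *ᵥ v) i‖ ^ 2 ≤ ∑ i, ‖v i‖ ^ 2 := by
  set u := (1 + S)⁻¹ *ᵥ v with hu
  have hv : v = u + S *ᵥ u := by
    have : (1 + S) *ᵥ u = v := by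
      rw [hu, Matrix.mulVec_mulVec, Matrix.mul_nonsing_inv _ (isUnit_one_add hS),
        Matrix.one_mulVec]
    rw [← this, Matrix.add_mulVec, Matrix.one_mulVec]
  have h0 : 0 ≤ ∑ i, (conj (u i) * (S *ᵥ u) i).re := by
    have := (Complex.le_def.1 (hS.dotProduct_mulVec_nonneg u)).1
    simpa [dotProduct, Complex.re_sum] using this
  have h1 : ∀ i, ‖v i‖ ^ 2 =
      ‖u i‖ ^ 2 + 2 * (conj (u i) * (S *ᵥ u) i).re + ‖(S *ᵥ u) i‖ ^ 2 := by
    intro i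
    conv_lhs => rw [hv]
    simp only [Pi.add_apply, ← Complex.normSq_eq_norm_sq, Complex.normSq_apply, Complex.add_re,
      Complex.add_im, Complex.mul_re, Complex.conj_re, Complex.conj_im]
    ring
  simp only [h1, Finset.sum_add_distrib, ← Finset.mul_sum]
  have : 0 ≤ ∑ i, ‖(S *ᵥ u) i‖ ^ 2 := Finset.sum_nonneg fun _ _ => sq_nonneg _
  linarith

theorem resolvent_col_norm_le {S : Matrix ι ι ℂ} (hS : S.PosSemidef) (j : ι) :
    ∑ i, ‖(1 + S)⁻¹ i j‖ ^ 2 ≤ 1 := by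
  have := resolvent_mulVec_norm_le hS (Pi.single j 1)
  simpa [Matrix.mulVec_single, Pi.single_apply, apply_ite, ite_pow] using this

theorem resLoss_le_card {S : Matrix ι ι ℂ} (hS : S.PosSemidef) :
    resLoss S ≤ Fintype.card ι := by
  have := (Complex.le_def.1 (posSemidef_resolvent hS).trace_nonneg).1
  simp only [Complex.zero_re] at this
  unfold resLoss; linarith

theorem resLoss_nonneg {S : Matrix ι ι ℂ} (hS : S.PosSemidef) : 0 ≤ resLoss S := by
  have h1 : ∀ j, ((1 + S)⁻¹ j j).re ≤ 1 := by
    intro j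
    have h2 : ‖(1 + S)⁻¹ j j‖ ^ 2 ≤ 1 :=
      (Finset.single_le_sum (f := fun i => ‖(1 + S)⁻¹ i j‖ ^ 2) (fun _ _ => sq_nonneg _)
        (Finset.mem_univ j)).trans (resolvent_col_norm_le hS j)
    have h3 : ‖(1 + S)⁻¹ j j‖ ≤ 1 := by
      nlinarith [norm_nonneg ((1 + S)⁻¹ j j)]
    exact (Complex.re_le_norm _).trans h3
  have : (Matrix.trace (1 + S)⁻¹).re ≤ (Fintype.card ι : ℝ) := by
    simp only [Matrix.trace, Matrix.diag_apply, Complex.re_sum]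
    refine (Finset.sum_le_sum fun j _ => h1 j).trans ?_
    simp
  unfold resLoss; linarith

theorem resLoss_zero : resLoss (0 : Matrix ι ι ℂ) = 0 := by
  simp [resLoss]

theorem resolvent_sub {S T : Matrix ι ι ℂ} (hS : S.PosSemidef) (hT : T.PosSemidef) :
    (1 + T)⁻¹ - (1 + S)⁻¹ = (1 + T)⁻¹ * (S - T) * (1 + S)⁻¹ := by
  have : S - T = (1 + S) - (1 + T) := by abel
  rw [this, mul_sub, sub_mul, Matrix.nonsing_inv_mul _ (isUnit_one_add hT), one_mul, mul_assoc,
    Matrix.mul_nonsing_inv _ (isUnit_one_add hS), mul_one]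

theorem resLoss_sub {S T : Matrix ι ι ℂ} (hS : S.PosSemidef) (hT : T.PosSemidef) :
    resLoss S - resLoss T = (Matrix.trace ((1 + T)⁻¹ * (S - T) * (1 + S)⁻¹)).re := by
  rw [← resolvent_sub hS hT, Matrix.trace_sub, Complex.sub_re]
  unfold resLoss; ring

/-- Adding a rank one matrix changes the resolvent trace by at most one. -/
theorem resLoss_add_rank_one {S : Matrix ι ι ℂ} (hS : S.PosSemidef) (v : ι → ℂ) :
    0 ≤ resLoss (S + Matrix.vecMulVec v (star v)) - resLoss S ∧
      resLoss (S + Matrix.vecMulVec v (star v)) - resLoss S ≤ 1 := by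
  have hR : (Matrix.vecMulVec v (star v)).PosSemidef := Matrix.posSemidef_vecMulVec_self_star v
  set R := Matrix.vecMulVec v (star v) with hRdef
  have hSR := hS.add hR
  set u := (1 + S)⁻¹ *ᵥ v with hu
  have hv : v = u + S *ᵥ u := by
    have : (1 + S) *ᵥ u = v := by
      rw [hu, Matrix.mulVec_mulVec, Matrix.mul_nonsing_inv _ (isUnit_one_add hS),
        Matrix.one_mulVec]
    rw [← this, Matrix.add_mulVec, Matrix.one_mulVec]
  set s := star v ⬝ᵥ u with hs
  obtain ⟨q, hq⟩ : ∃ q : ℝ, star u ⬝ᵥ u = (q : ℂ) ∧ 0 ≤ q := by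
    refine ⟨∑ i, ‖u i‖ ^ 2, ?_, Finset.sum_nonneg fun _ _ => sq_nonneg _⟩
    simp only [dotProduct, Pi.star_apply, RCLike.star_def, Complex.conj_mul']
    push_cast; rfl
  obtain ⟨b, hb⟩ : ∃ b : ℝ, star u ⬝ᵥ (S *ᵥ u) = (b : ℂ) ∧ 0 ≤ b := by
    have h := hS.dotProduct_mulVec_nonneg u
    have h' := Complex.le_def.1 h
    refine ⟨(star u ⬝ᵥ (S *ᵥ u)).re, Complex.ext rfl ?_, by simpa using h'.1⟩
    simpa using h'.2.symm
  have hsq : s = ((q + b : ℝ) : ℂ) := by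
    have h1 : star u ⬝ᵥ v = ((q + b : ℝ) : ℂ) := by
      rw [hv, dotProduct_add, hq.1, hb.1]; push_cast; rfl
    have h2 : s = star (star u ⬝ᵥ v) := by
      rw [hs, Matrix.star_dotProduct]
    rw [h2, h1]; simp
  have hpos : (1 + s) ≠ 0 := by
    rw [hsq]; norm_cast; linarith [hq.2, hb.2]
  -- The Sherman–Morrison formula applied to v.
  have hw : (1 + (S + R))⁻¹ *ᵥ v = (1 + s)⁻¹ • u := by
    have h1 : (1 + (S + R)) *ᵥ ((1 + s)⁻¹ • u) = v := by
      rw [Matrix.mulVec_smul, ← add_assoc, Matrix.add_mulVec, Matrix.add_mulVec,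
        Matrix.one_mulVec, ← hv, hRdef, Matrix.vecMulVec_mulVec, ← hs]
      rw [inv_smul_eq_iff₀ hpos]
      ext i; simp; ring
    conv_lhs => rw [← h1]
    rw [Matrix.mulVec_mulVec, Matrix.nonsing_inv_mul _ (isUnit_one_add hSR), Matrix.one_mulVec]
  -- The increment is computed exactly, with q = ‖u‖² and b = ⟨u, S u⟩; both are nonnegative, so the
  -- quotient lies in [0, 1].
  have key : resLoss (S + R) - resLoss S = q / (1 + (q + b)) := by
    rw [resLoss_sub hSR hS, add_sub_cancel_left, hRdef, Matrix.mul_vecMulVec,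
      Matrix.vecMulVec_mul, Matrix.trace_vecMulVec, ← hRdef, ← hu]
    have h3 : star v ᵥ* (1 + (S + R))⁻¹ = star ((1 + s)⁻¹ • u) := by
      rw [← hw, Matrix.star_mulVec, (posSemidef_resolvent hSR).1]
    rw [h3, dotProduct_comm, star_smul, smul_dotProduct, hq.1, hsq]
    have : (star (1 + ((q + b : ℝ) : ℂ))⁻¹ • (q : ℂ)) = ((q / (1 + (q + b)) : ℝ) : ℂ) := by
      simp [div_eq_inv_mul]
    rw [this, Complex.ofReal_re]
  rw [key]
  constructor
  · have := hq.2; have := hb.2; positivity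
  · rw [div_le_one (by linarith [hq.2, hb.2])]; linarith [hb.2]

/-- Sylvester's identity for the resolvent trace. -/
theorem resLoss_mul_conjTranspose (W : Matrix ι κ ℂ) : resLoss (W * Wᴴ) = resLoss (Wᴴ * W) := by
  have hP := isUnit_one_add (Matrix.posSemidef_self_mul_conjTranspose W)
  have hQ := isUnit_one_add (Matrix.posSemidef_conjTranspose_mul_self W)
  -- The push-through identity; the two losses then differ by a cyclic permutation under the trace.
  have h1 : (1 + W * Wᴴ)⁻¹ * W = W * (1 + Wᴴ * W)⁻¹ := by
    have h2 : W * (1 + Wᴴ * W) = (1 + W * Wᴴ) * W := by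
      simp [Matrix.mul_add, Matrix.add_mul, Matrix.mul_assoc]
    calc (1 + W * Wᴴ)⁻¹ * W = (1 + W * Wᴴ)⁻¹ * (W * (1 + Wᴴ * W)) * (1 + Wᴴ * W)⁻¹ := by
          rw [Matrix.mul_assoc, Matrix.mul_assoc, Matrix.mul_nonsing_inv _ hQ, Matrix.mul_one]
      _ = W * (1 + Wᴴ * W)⁻¹ := by
          rw [h2, ← Matrix.mul_assoc, Matrix.nonsing_inv_mul _ hP, Matrix.one_mul]
  have h3 : (1 + W * Wᴴ)⁻¹ = 1 - (1 + W * Wᴴ)⁻¹ * W * Wᴴ := by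
    have := Matrix.nonsing_inv_mul _ hP
    rw [Matrix.mul_add, Matrix.mul_one] at this
    rw [Matrix.mul_assoc, eq_sub_iff_add_eq, this]
  have h4 : (1 + Wᴴ * W)⁻¹ = 1 - Wᴴ * W * (1 + Wᴴ * W)⁻¹ := by
    have := Matrix.mul_nonsing_inv _ hQ
    rw [Matrix.add_mul, Matrix.one_mul] at this
    rw [eq_sub_iff_add_eq, this]
  unfold resLoss
  rw [h3, h4, h1, Matrix.trace_sub, Matrix.trace_sub, Matrix.mul_assoc Wᴴ, Matrix.trace_mul_comm Wᴴ]
  simp [Matrix.trace_one]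

/-- Young's inequality with a free weight. It keeps squared norms on the right, so that expectations
of squares can be inserted later and δ chosen last. -/
theorem norm_mul_le_half (a b : ℂ) {δ : ℝ} (hδ : 0 < δ) :
    ‖a * b‖ ≤ (δ * ‖a‖ ^ 2 + ‖b‖ ^ 2 / δ) / 2 := by
  rw [norm_mul]
  have : δ * ‖a‖ ^ 2 + ‖b‖ ^ 2 / δ - 2 * (‖a‖ * ‖b‖) = (δ * ‖a‖ - ‖b‖) ^ 2 / δ := by
    field_simp; ring
  have h2 : 0 ≤ (δ * ‖a‖ - ‖b‖) ^ 2 / δ := by positivity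
  linarith

/-- The resolvent trace is Lipschitz in the Frobenius norm. -/
theorem abs_resLoss_sub_le {S T : Matrix ι ι ℂ} (hS : S.PosSemidef) (hT : T.PosSemidef)
    {δ : ℝ} (hδ : 0 < δ) :
    |resLoss S - resLoss T| ≤
      (δ * Fintype.card ι + (∑ i, ∑ j, ‖S i j - T i j‖ ^ 2) / δ) / 2 := by
  have h0 : Matrix.trace ((1 + T)⁻¹ * (S - T) * (1 + S)⁻¹) =
      ∑ i, ∑ j, ((1 + S)⁻¹ * (1 + T)⁻¹) j i * (S - T) i j := by
    rw [Matrix.mul_assoc, Matrix.trace_mul_comm, Matrix.mul_assoc, Matrix.trace]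
    simp only [Matrix.diag_apply, Matrix.mul_apply (M := S - T)]
    exact Finset.sum_congr rfl fun i _ => Finset.sum_congr rfl fun j _ => mul_comm _ _
  -- Both resolvents are contractions, so every column of their product has norm at most one.
  have hc : ∑ i, ∑ j, ‖((1 + S)⁻¹ * (1 + T)⁻¹) j i‖ ^ 2 ≤ Fintype.card ι := by
    have : ∀ i, ∑ j, ‖((1 + S)⁻¹ * (1 + T)⁻¹) j i‖ ^ 2 ≤ 1 := fun i =>
      (resolvent_mulVec_norm_le hS (fun j => (1 + T)⁻¹ j i)).trans (resolvent_col_norm_le hT i)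
    refine (Finset.sum_le_sum fun i _ => this i).trans ?_
    simp
  rw [resLoss_sub hS hT, h0]
  refine (Complex.abs_re_le_norm _).trans ((norm_sum_le _ _).trans
    ((Finset.sum_le_sum fun i _ => (norm_sum_le _ _).trans (Finset.sum_le_sum fun j _ =>
      norm_mul_le_half _ _ hδ)).trans ?_))
  simp only [← Finset.sum_div, Finset.sum_add_distrib, ← Finset.mul_sum, Matrix.sub_apply]
  have := mul_le_mul_of_nonneg_left hc hδ.le
  linarith

/-- The difference of losses is (s - t) times the trace of (Q W)(P W)ᴴ with contractions P and Q,
which Young's inequality bounds by the squared Frobenius norm of W. -/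
theorem abs_resLoss_smul_sub_le {κ : Type*} [Fintype κ] (W : Matrix ι κ ℂ) {s t : ℝ}
    (hs : 0 ≤ s) (ht : 0 ≤ t) :
    |resLoss ((s : ℂ) • (W * Wᴴ)) - resLoss ((t : ℂ) • (W * Wᴴ))| ≤
      |s - t| * ∑ i, ∑ j, ‖W i j‖ ^ 2 := by
  have hA := Matrix.posSemidef_self_mul_conjTranspose W
  have hS : ((s : ℂ) • (W * Wᴴ)).PosSemidef := hA.smul (by exact_mod_cast hs)
  have hT : ((t : ℂ) • (W * Wᴴ)).PosSemidef := hA.smul (by exact_mod_cast ht)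
  rw [resLoss_sub hS hT]
  set P := (1 + (s : ℂ) • (W * Wᴴ))⁻¹ with hP
  set Q := (1 + (t : ℂ) • (W * Wᴴ))⁻¹ with hQ
  have hPh : Pᴴ = P := (posSemidef_resolvent hS).1
  have h0 : Matrix.trace (Q * ((s : ℂ) • (W * Wᴴ) - (t : ℂ) • (W * Wᴴ)) * P) =
      ((s - t : ℝ) : ℂ) * ∑ j, ∑ i, conj ((P * W) i j) * (Q * W) i j := by
    rw [← sub_smul, Matrix.mul_smul, Matrix.smul_mul, Matrix.trace_smul, smul_eq_mul]
    congr 1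
    · push_cast; rfl
    · have : Q * (W * Wᴴ) * P = (Q * W) * (P * W)ᴴ := by
        rw [Matrix.conjTranspose_mul, hPh]; simp only [Matrix.mul_assoc]
      rw [this, Matrix.trace_mul_comm, Matrix.trace]
      refine Finset.sum_congr rfl fun j _ => ?_
      rw [Matrix.diag_apply, Matrix.mul_apply]
      rfl
  have h1 : ∀ j, ∑ i, ‖(P * W) i j‖ ^ 2 ≤ ∑ i, ‖W i j‖ ^ 2 := fun j =>
    resolvent_mulVec_norm_le hS (fun i => W i j)
  have h2 : ∀ j, ∑ i, ‖(Q * W) i j‖ ^ 2 ≤ ∑ i, ‖W i j‖ ^ 2 := fun j =>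
    resolvent_mulVec_norm_le hT (fun i => W i j)
  rw [h0]
  refine (Complex.abs_re_le_norm _).trans ?_
  rw [norm_mul, Complex.norm_real, Real.norm_eq_abs, Finset.sum_comm (γ := ι)]
  refine mul_le_mul_of_nonneg_left ?_ (abs_nonneg _)
  refine (norm_sum_le _ _).trans (Finset.sum_le_sum fun j _ => ?_)
  refine (norm_sum_le _ _).trans ((Finset.sum_le_sum fun i _ =>
    norm_mul_le_half _ _ one_pos).trans ?_)
  simp only [← Finset.sum_div, Finset.sum_add_distrib, one_mul, div_one, RCLike.norm_conj]
  linarith [h1 j, h2 j]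

/-- Since A B = 0, 1 + A + B factors as (1 + A)(1 + B), and the product of the two inverses
collapses to their sum minus the identity. -/
theorem resLoss_add_of_mul_eq_zero {A B : Matrix ι ι ℂ} (hA : A.PosSemidef) (hB : B.PosSemidef)
    (hAB : A * B = 0) : resLoss (A + B) = resLoss A + resLoss B := by
  have hBA : B * A = 0 := by
    have := congrArg Matrix.conjTranspose hAB
    rwa [Matrix.conjTranspose_mul, hA.1, hB.1, Matrix.conjTranspose_zero] at this
  have h1 : (1 + (A + B)) = (1 + A) * (1 + B) := by
    rw [mul_add, mul_one, add_mul, one_mul, hAB, add_zero, add_assoc]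
  have hX : (1 + A)⁻¹ = 1 - A * (1 + A)⁻¹ := by
    have := Matrix.mul_nonsing_inv _ (isUnit_one_add hA)
    rw [add_mul, one_mul] at this
    rw [eq_sub_iff_add_eq, this]
  have hY : (1 + B)⁻¹ = 1 - (1 + B)⁻¹ * B := by
    have := Matrix.nonsing_inv_mul _ (isUnit_one_add hB)
    rw [mul_add, mul_one] at this
    rw [eq_sub_iff_add_eq, this]
  have h2 : (1 + B)⁻¹ * (1 + A)⁻¹ = (1 + A)⁻¹ + (1 + B)⁻¹ - 1 := by
    have h3 : ((1 + B)⁻¹ * B) * (A * (1 + A)⁻¹) = 0 := by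
      rw [mul_assoc, ← mul_assoc B, hBA, zero_mul, mul_zero]
    have h4 : (1 + B)⁻¹ * (1 + A)⁻¹ = (1 - (1 + B)⁻¹ * B) * (1 - A * (1 + A)⁻¹) := by
      rw [← hX, ← hY]
    rw [h4, mul_sub, sub_mul, sub_mul, h3]
    simp only [mul_one, one_mul, sub_zero]
    rw [← hY]
    nth_rw 2 [hX]
    abel
  unfold resLoss
  rw [h1, Matrix.mul_inv_rev, h2]
  simp [Matrix.trace_one]
  ring

theorem resLoss_sum_of_mul_eq_zero {C : Type*} (s : Finset C)
    (A : C → Matrix ι ι ℂ) (hA : ∀ c, (A c).PosSemidef)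
    (h : ∀ c c', c ≠ c' → A c * A c' = 0) :
    resLoss (∑ c ∈ s, A c) = ∑ c ∈ s, resLoss (A c) := by
  classical
  induction s using Finset.induction_on with
  | empty => simp [resLoss_zero]
  | insert c s hc ih =>
    rw [Finset.sum_insert hc, Finset.sum_insert hc, resLoss_add_of_mul_eq_zero (hA c)
      (Matrix.posSemidef_sum s fun i _ => hA i), ih]
    rw [Finset.mul_sum]
    exact Finset.sum_eq_zero fun c' hc' => h _ _ fun e => hc (e ▸ hc')

/-- The matrix `W` with the columns outside of the class `c` replaced by zero. -/
def colMask {C : Type*} [DecidableEq C] (σ : κ → C) (W : Matrix ι κ ℂ) (c : C) :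
    Matrix ι κ ℂ :=
  Matrix.of fun i q => if σ q = c then W i q else 0

theorem colMask_gram {ι κ : Type*} [Fintype ι] {C : Type*} [DecidableEq C] (σ : κ → C)
    (W : Matrix ι κ ℂ) (c : C)
    (i j : κ) : ((colMask σ W c)ᴴ * colMask σ W c) i j =
      if σ i = c ∧ σ j = c then (Wᴴ * W) i j else 0 := by
  simp only [Matrix.mul_apply, Matrix.conjTranspose_apply, colMask, Matrix.of_apply]
  by_cases h1 : σ i = c <;> by_cases h2 : σ j = c <;> simp [h1, h2]

/-- The resolvent trace of `W Wᴴ` is nearly additive over a partition of the columns when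
columns of different classes are nearly orthogonal. -/
theorem abs_resLoss_sub_sum_colMask_le {C : Type*} [Fintype C] [DecidableEq C] (σ : κ → C)
    (W : Matrix ι κ ℂ) {δ : ℝ} (hδ : 0 < δ) :
    |resLoss (W * Wᴴ) - ∑ c, resLoss (colMask σ W c * (colMask σ W c)ᴴ)| ≤
      (δ * Fintype.card κ +
        (∑ i, ∑ j, if σ i = σ j then 0 else ‖(Wᴴ * W) i j‖ ^ 2) / δ) / 2 := by
  simp only [resLoss_mul_conjTranspose]
  have hp := fun c => Matrix.posSemidef_conjTranspose_mul_self (colMask σ W c)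
  -- On the Gram side the masked matrices are the diagonal blocks of `Wᴴ * W`. They annihilate each
  -- other, so their losses add up to the loss of the block diagonal part, and only off-diagonal
  -- blocks enter the error.
  rw [← resLoss_sum_of_mul_eq_zero Finset.univ _ hp]
  · refine (abs_resLoss_sub_le (Matrix.posSemidef_conjTranspose_mul_self W)
      (Matrix.posSemidef_sum _ fun c _ => hp c) hδ).trans (le_of_eq ?_)
    congr 3
    refine Finset.sum_congr rfl fun i _ => Finset.sum_congr rfl fun j _ => ?_
    rw [Matrix.sum_apply]
    simp only [colMask_gram]
    split_ifs with h
    · simp [h]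
    · rw [Finset.sum_eq_zero, sub_zero]
      intro c _
      rw [if_neg]
      rintro ⟨h1, h2⟩
      exact h (h1.trans h2.symm)
  · intro c c' hcc
    ext i j
    rw [Matrix.mul_apply, Matrix.zero_apply]
    refine Finset.sum_eq_zero fun k _ => ?_
    rw [colMask_gram, colMask_gram]
    by_cases h : σ k = c
    · have : σ k ≠ c' := fun h' => hcc (h.symm.trans h')
      simp [this]
    · simp [h]

end ResolventTrace

/-! ### Averages over independent points, added one at a time -/

section IteratedAverage

variable {M X : Type*} [AddCommMonoid M] [MeasurableSpace M] [MeasurableAdd₂ M]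
  [MeasurableSpace X]

/-- The mean of `Ψ (S + V x₁ + ⋯ + V xₘ)` over independent `x₁, …, xₘ` of law `μ`. -/
def iterAvg (μ : Measure X) (V : X → M) (Ψ : M → ℝ) : ℕ → M → ℝ
  | 0 => Ψ
  | m + 1 => fun S => ∫ x, iterAvg μ V Ψ m (S + V x) ∂μ

variable {μ ν : Measure X} {V : X → M} {Ψ : M → ℝ} {C : ℝ}

theorem measurable_iterAvg [SFinite μ] (hV : Measurable V) (hΨ : Measurable Ψ) (m : ℕ) :
    Measurable (iterAvg μ V Ψ m) := by
  induction m with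
  | zero => exact hΨ
  | succ m ih =>
    have : StronglyMeasurable fun p : M × X => iterAvg μ V Ψ m (p.1 + V p.2) :=
      (ih.comp (measurable_fst.add (hV.comp measurable_snd))).stronglyMeasurable
    exact this.integral_prod_right.measurable

theorem abs_iterAvg_le {M : Type*} [AddCommMonoid M] {V : X → M} {Ψ : M → ℝ} [IsProbabilityMeasure μ]
    (hC : ∀ S, |Ψ S| ≤ C) (m : ℕ) (S : M) :
    |iterAvg μ V Ψ m S| ≤ C := by
  induction m generalizing S with
  | zero => exact hC S
  | succ m ih =>
    have := norm_integral_le_of_norm_le_const (μ := μ) (f := fun x => iterAvg μ V Ψ m (S + V x))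
      (Eventually.of_forall fun x => ih (S + V x))
    rw [probReal_univ, mul_one] at this
    exact this

theorem integrable_iterAvg [IsProbabilityMeasure μ] [IsFiniteMeasure ν] (hV : Measurable V)
    (hΨ : Measurable Ψ) (hC : ∀ S, |Ψ S| ≤ C) (m : ℕ) {u : X → M} (hu : Measurable u) :
    Integrable (fun x => iterAvg μ V Ψ m (u x)) ν :=
  .of_bound ((measurable_iterAvg hV hΨ m).comp hu).aestronglyMeasurable C
    (Eventually.of_forall fun x => abs_iterAvg_le hC m (u x))

theorem iterAvg_eq_integral_pi [IsProbabilityMeasure μ] (hV : Measurable V) (hΨ : Measurable Ψ)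
    (hC : ∀ S, |Ψ S| ≤ C) (m : ℕ) (S : M) :
    iterAvg μ V Ψ m S = ∫ x, Ψ (S + ∑ i, V (x i)) ∂(Measure.pi fun _ : Fin m => μ) := by
  induction m generalizing S with
  | zero => simp [iterAvg]
  | succ m ih =>
    have hmp := measurePreserving_piFinSuccAbove (fun _ : Fin (m + 1) => μ) 0
    have hint : Integrable (fun p : X × (Fin m → X) => Ψ (S + V p.1 + ∑ i, V (p.2 i)))
        (μ.prod (Measure.pi fun _ : Fin m => μ)) := by
      refine .of_bound (hΨ.comp ?_).aestronglyMeasurable C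
        (Eventually.of_forall fun p => hC _)
      fun_prop
    have h1 := hmp.integral_comp' (g := fun p : X × (Fin m → X) =>
      Ψ (S + V p.1 + ∑ i, V (p.2 i)))
    have h2 : ∀ x : Fin (m + 1) → X, Ψ (S + ∑ i, V (x i)) = Ψ (S +
        V ((MeasurableEquiv.piFinSuccAbove (fun _ => X) 0) x).1 +
          ∑ i, V (((MeasurableEquiv.piFinSuccAbove (fun _ => X) 0) x).2 i)) := by
      intro x
      rw [Fin.sum_univ_succ, ← add_assoc]
      rfl
    simp_rw [h2]
    rw [h1, integral_prod _ hint]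
    exact integral_congr_ae (Eventually.of_forall fun x => ih _)

theorem iterAvg_map {Y : Type*} [MeasurableSpace Y] {κ : Measure Y} {g : Y → X}
    [IsProbabilityMeasure κ] (hg : Measurable g) (hV : Measurable V) (hΨ : Measurable Ψ)
    (m : ℕ) (S : M) :
    iterAvg (κ.map g) V Ψ m S = iterAvg κ (fun y => V (g y)) Ψ m S := by
  have : IsProbabilityMeasure (κ.map g) := Measure.isProbabilityMeasure_map hg.aemeasurable
  induction m generalizing S with
  | zero => rfl
  | succ m ih =>
    change ∫ x, iterAvg (κ.map g) V Ψ m (S + V x) ∂(κ.map g) = _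
    rw [integral_map hg.aemeasurable]
    · exact integral_congr_ae (Eventually.of_forall fun x => ih _)
    · exact ((measurable_iterAvg hV hΨ m).comp (measurable_const.add hV)).aestronglyMeasurable

theorem iterAvg_add_sub_mem [IsProbabilityMeasure μ] (hV : Measurable V) (hΨ : Measurable Ψ)
    (hC : ∀ S, |Ψ S| ≤ C) {T : M} (hinc : ∀ S, Ψ (S + T) - Ψ S ∈ Icc (0 : ℝ) 1) (m : ℕ) (S : M) :
    iterAvg μ V Ψ m (S + T) - iterAvg μ V Ψ m S ∈ Icc (0 : ℝ) 1 := by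
  induction m generalizing S with
  | zero => exact hinc S
  | succ m ih =>
    have h1 : iterAvg μ V Ψ (m + 1) (S + T) - iterAvg μ V Ψ (m + 1) S =
        ∫ x, (iterAvg μ V Ψ m (S + V x + T) - iterAvg μ V Ψ m (S + V x)) ∂μ := by
      rw [integral_sub]
      · simp only [iterAvg, add_right_comm]
      · exact integrable_iterAvg hV hΨ hC m (by fun_prop)
      · exact integrable_iterAvg hV hΨ hC m (by fun_prop)
    rw [h1]
    constructor
    · exact integral_nonneg fun x => (ih _).1
    · have := integral_mono_of_nonneg (μ := μ) (Eventually.of_forall fun x => (ih (S + V x)).1)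
        (integrable_const (1 : ℝ)) (Eventually.of_forall fun x => (ih (S + V x)).2)
      simpa using this

/-- The additional point is the outermost one: for each of its positions the mean over the other
points moves by an amount in [0, 1]. -/
theorem abs_iterAvg_succ_sub_le [IsProbabilityMeasure μ] (hV : Measurable V)
    (hΨ : Measurable Ψ) (hC : ∀ S, |Ψ S| ≤ C) (hinc : ∀ S x, Ψ (S + V x) - Ψ S ∈ Icc (0 : ℝ) 1)
    (m : ℕ) (S : M) : |iterAvg μ V Ψ (m + 1) S - iterAvg μ V Ψ m S| ≤ 1 := by
  have h1 : iterAvg μ V Ψ (m + 1) S - iterAvg μ V Ψ m S =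
      ∫ x, (iterAvg μ V Ψ m (S + V x) - iterAvg μ V Ψ m S) ∂μ := by
    rw [integral_sub]
    · simp [iterAvg]
    · exact integrable_iterAvg hV hΨ hC m (by fun_prop)
    · exact integrable_const _
  rw [h1]
  have := norm_integral_le_of_norm_le_const (μ := μ) (C := 1)
    (f := fun x => iterAvg μ V Ψ m (S + V x) - iterAvg μ V Ψ m S) (Eventually.of_forall fun x => by
      have := iterAvg_add_sub_mem (μ := μ) hV hΨ hC (fun S => hinc S x) m S
      rw [Real.norm_eq_abs, abs_le]
      exact ⟨by linarith [this.1], this.2⟩)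
  simpa using this

theorem abs_iterAvg_sub_le [IsProbabilityMeasure μ] (hV : Measurable V)
    (hΨ : Measurable Ψ) (hC : ∀ S, |Ψ S| ≤ C) (hinc : ∀ S x, Ψ (S + V x) - Ψ S ∈ Icc (0 : ℝ) 1)
    (j k : ℕ) (S : M) : |iterAvg μ V Ψ j S - iterAvg μ V Ψ k S| ≤ |(j : ℝ) - k| := by
  have key : ∀ j i : ℕ, |iterAvg μ V Ψ (j + i) S - iterAvg μ V Ψ j S| ≤ i := by
    intro j i
    induction i with
    | zero => simp
    | succ i ih =>
      have := abs_iterAvg_succ_sub_le (μ := μ) hV hΨ hC hinc (j + i) S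
      have h2 := abs_sub_le (iterAvg μ V Ψ (j + (i + 1)) S) (iterAvg μ V Ψ (j + i) S)
        (iterAvg μ V Ψ j S)
      rw [← add_assoc] at h2 ⊢
      push_cast
      linarith
  rcases le_total j k with h | h
  · obtain ⟨i, rfl⟩ := Nat.exists_eq_add_of_le h
    rw [abs_sub_comm]
    refine (key j i).trans (le_of_eq ?_)
    push_cast
    rw [sub_add_cancel_left, abs_neg, abs_of_nonneg (Nat.cast_nonneg i)]
  · obtain ⟨i, rfl⟩ := Nat.exists_eq_add_of_le h
    refine (key k i).trans (le_of_eq ?_)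
    push_cast
    rw [add_sub_cancel_left, abs_of_nonneg (Nat.cast_nonneg i)]

/-- Replacing the law of `m` independent points by a law at a distance `ε` in total variation
changes the mean by at most `m ε`. -/
theorem abs_iterAvg_sub_iterAvg_le [IsProbabilityMeasure μ] [IsProbabilityMeasure ν]
    (hV : Measurable V) (hΨ : Measurable Ψ) (hC : ∀ S, |Ψ S| ≤ C)
    (hinc : ∀ S x, Ψ (S + V x) - Ψ S ∈ Icc (0 : ℝ) 1) {ε : ℝ}
    (hε : ∀ h : X → ℝ, Measurable h → ∀ a : ℝ, (∀ x, h x ∈ Icc a (a + 1)) →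
      |∫ x, h x ∂μ - ∫ x, h x ∂ν| ≤ ε) (m : ℕ) (S : M) :
    |iterAvg μ V Ψ m S - iterAvg ν V Ψ m S| ≤ m * ε := by
  induction m generalizing S with
  | zero => simp [iterAvg]
  | succ m ih =>
    -- The law is exchanged one point at a time: first for the inner m points, by induction, then
    -- for the outer point.
    have h1 : iterAvg μ V Ψ (m + 1) S - iterAvg ν V Ψ (m + 1) S =
        ∫ x, (iterAvg μ V Ψ m (S + V x) - iterAvg ν V Ψ m (S + V x)) ∂μ +
        (∫ x, iterAvg ν V Ψ m (S + V x) ∂μ - ∫ x, iterAvg ν V Ψ m (S + V x) ∂ν) := by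
      rw [integral_sub]
      · simp only [iterAvg]; ring
      · exact integrable_iterAvg hV hΨ hC m (by fun_prop)
      · exact integrable_iterAvg hV hΨ hC m (by fun_prop)
    rw [h1]
    refine (abs_add_le _ _).trans ?_
    push_cast
    rw [add_mul, one_mul]
    refine add_le_add ?_ ?_
    · have := norm_integral_le_of_norm_le_const (μ := μ)
        (f := fun x => iterAvg μ V Ψ m (S + V x) - iterAvg ν V Ψ m (S + V x))
        (Eventually.of_forall fun x => ih (S + V x))
      simpa using this
    -- One point moves the mean by at most one, so the integrand ranges over an interval of length
    -- one that starts at `iterAvg ν V Ψ m S`.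
    · refine hε _ ((measurable_iterAvg hV hΨ m).comp (measurable_const.add hV))
        (iterAvg ν V Ψ m S) fun x => ?_
      have := iterAvg_add_sub_mem (μ := ν) hV hΨ hC (fun S => hinc S x) m S
      exact ⟨by linarith [this.1], by linarith [this.2]⟩

/-- The mean of `h` under the binomial distribution with `m` trials of probability `w`. -/
def binAvg (w : ℝ) : ℕ → (ℕ → ℝ) → ℝ
  | 0, h => h 0
  | m + 1, h => (1 - w) * binAvg w m h + w * binAvg w m fun j => h (j + 1)

theorem abs_binAvg_sub_le {w : ℝ} (h0 : 0 ≤ w) (h1 : w ≤ 1) (m : ℕ) {h q : ℕ → ℝ} {c : ℝ}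
    (hq : ∀ j, |h j - c| ≤ q j) : |binAvg w m h - c| ≤ binAvg w m q := by
  induction m generalizing h q with
  | zero => exact hq 0
  | succ m ih =>
    have e : binAvg w (m + 1) h - c =
        (1 - w) * (binAvg w m h - c) + w * (binAvg w m (fun j => h (j + 1)) - c) := by
      simp only [binAvg]; ring
    rw [e]
    refine (abs_add_le _ _).trans ?_
    rw [abs_mul, abs_mul, abs_of_nonneg h0, abs_of_nonneg (sub_nonneg.2 h1)]
    exact add_le_add (mul_le_mul_of_nonneg_left (ih hq) (sub_nonneg.2 h1))
      (mul_le_mul_of_nonneg_left (ih fun j => hq (j + 1)) h0)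

/-- Variance m w (1 - w) plus squared bias (m w - a)², by conditioning on the first trial, which
replaces a by a - 1. -/
theorem binAvg_quadratic (w δ : ℝ) (m : ℕ) (a : ℝ) :
    binAvg w m (fun j => (δ + ((j : ℝ) - a) ^ 2 / δ) / 2) =
      (δ + (m * (w * (1 - w)) + (m * w - a) ^ 2) / δ) / 2 := by
  induction m generalizing a with
  | zero => simp [binAvg]
  | succ m ih =>
    have e : (fun j : ℕ => (δ + (((j + 1 : ℕ) : ℝ) - a) ^ 2 / δ) / 2) =
        fun j : ℕ => (δ + ((j : ℝ) - (a - 1)) ^ 2 / δ) / 2 := by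
      ext j; push_cast; ring
    simp only [binAvg]
    rw [e, ih, ih]
    push_cast
    ring

theorem integrable_binAvg (w : ℝ) (m : ℕ) {F : ℕ → X → ℝ} (hF : ∀ j, Integrable (F j) μ) :
    Integrable (fun x => binAvg w m fun j => F j x) μ := by
  induction m generalizing F with
  | zero => exact hF 0
  | succ m ih => exact ((ih hF).const_mul _).add ((ih fun j => hF (j + 1)).const_mul _)

theorem integral_binAvg (w : ℝ) (m : ℕ) {F : ℕ → X → ℝ} (hF : ∀ j, Integrable (F j) μ) :
    ∫ x, binAvg w m (fun j => F j x) ∂μ = binAvg w m fun j => ∫ x, F j x ∂μ := by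
  induction m generalizing F with
  | zero => rfl
  | succ m ih =>
    simp only [binAvg]
    rw [integral_add ((integrable_binAvg w m hF).const_mul _)
      ((integrable_binAvg w m fun j => hF (j + 1)).const_mul _), integral_const_mul,
      integral_const_mul, ih hF, ih fun j => hF (j + 1)]

/-- Only the points in `A` contribute: their number is binomial, and given their number they are
independent with the conditional law. -/
theorem iterAvg_indicator_eq [IsProbabilityMeasure μ] [IsProbabilityMeasure ν]
    (hV : Measurable V) (hΨ : Measurable Ψ) (hC : ∀ S, |Ψ S| ≤ C) {A : Set X}
    (hA : MeasurableSet A) {w : ℝ} (hw : 0 ≤ w) (hμ : μ.restrict A = ENNReal.ofReal w • ν)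
    (m : ℕ) (S : M) :
    iterAvg μ (A.indicator V) Ψ m S = binAvg w m fun j => iterAvg ν V Ψ j S := by
  have hwA : μ.real A = w := by
    have := congrArg (fun κ : Measure X => κ.real univ) hμ
    simpa [Measure.real, hw] using this
  induction m generalizing S with
  | zero => rfl
  | succ m ih =>
    have hi : Integrable (fun x => iterAvg μ (A.indicator V) Ψ m (S + A.indicator V x)) μ :=
      integrable_iterAvg (hV.indicator hA) hΨ hC m
        (measurable_const.add (hV.indicator hA))
    have e1 : ∫ x in A, iterAvg μ (A.indicator V) Ψ m (S + A.indicator V x) ∂μ =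
        w * ∫ x, iterAvg μ (A.indicator V) Ψ m (S + V x) ∂ν := by
      rw [setIntegral_congr_fun (g := fun x => iterAvg μ (A.indicator V) Ψ m (S + V x)) hA
        fun x hx => by simp [indicator_of_mem hx], hμ, integral_smul_measure,
        ENNReal.toReal_ofReal hw, smul_eq_mul]
    have e2 : ∫ x in Aᶜ, iterAvg μ (A.indicator V) Ψ m (S + A.indicator V x) ∂μ =
        (1 - w) * iterAvg μ (A.indicator V) Ψ m S := by
      rw [setIntegral_congr_fun (g := fun x => iterAvg μ (A.indicator V) Ψ m S) hA.compl
        fun x hx => by simp [indicator_of_notMem hx], setIntegral_const,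
        probReal_compl_eq_one_sub hA,
        hwA, smul_eq_mul]
    change ∫ x, iterAvg μ (A.indicator V) Ψ m (S + A.indicator V x) ∂μ = _
    rw [← integral_add_compl hA hi, e1, e2, ih]
    simp_rw [ih]
    rw [integral_binAvg w m fun j => integrable_iterAvg hV hΨ hC j (by fun_prop), add_comm]
    rfl

/-- The mean is 1-Lipschitz in the number of points, that number is binomial with variance at most m
w, and |j - k| ≤ (δ + (j - k)² / δ) / 2 turns the mean deviation into variance and bias. -/
theorem abs_iterAvg_indicator_sub_le [IsProbabilityMeasure μ] [IsProbabilityMeasure ν]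
    (hV : Measurable V) (hΨ : Measurable Ψ) (hC : ∀ S, |Ψ S| ≤ C)
    (hinc : ∀ S x, Ψ (S + V x) - Ψ S ∈ Icc (0 : ℝ) 1) {A : Set X}
    (hA : MeasurableSet A) {w : ℝ} (hw : 0 ≤ w) (hμ : μ.restrict A = ENNReal.ofReal w • ν)
    (m k : ℕ) (S : M) {δ : ℝ} (hδ : 0 < δ) :
    |iterAvg μ (A.indicator V) Ψ m S - iterAvg ν V Ψ k S| ≤
      (δ + (m * w + (m * w - k) ^ 2) / δ) / 2 := by
  have hwA : μ.real A = w := by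
    have := congrArg (fun κ : Measure X => κ.real univ) hμ
    simpa [Measure.real, hw] using this
  have hw1 : w ≤ 1 := hwA ▸ measureReal_le_one
  rw [iterAvg_indicator_eq hV hΨ hC hA hw hμ]
  refine (abs_binAvg_sub_le hw hw1 m (q := fun j => (δ + ((j : ℝ) - k) ^ 2 / δ) / 2)
    fun j => (abs_iterAvg_sub_le hV hΨ hC hinc j k S).trans ?_).trans ?_
  · have e : δ + ((j : ℝ) - k) ^ 2 / δ - 2 * |(j : ℝ) - k| = (δ - |(j : ℝ) - k|) ^ 2 / δ := by
      rw [← sq_abs ((j : ℝ) - k)]; field_simp; ring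
    have : 0 ≤ (δ - |(j : ℝ) - k|) ^ 2 / δ := by positivity
    linarith
  · rw [binAvg_quadratic]
    gcongr
    nlinarith

end IteratedAverage

/-! ### Concentration of the squared Dirichlet kernel -/

section DirichletKernel

/-- The Dirichlet kernel `∑_{l < n} exp (2 π i l t)`. -/
def dirichlet (n : ℕ) (t : ℝ) : ℂ :=
  ∑ l ∈ Finset.range n, Complex.exp (Complex.I * ((2 * Real.pi * l * t : ℝ) : ℂ))

theorem continuous_dirichlet (n : ℕ) : Continuous (dirichlet n) := by
  unfold dirichlet; fun_prop

theorem dirichlet_zero (n : ℕ) : dirichlet n 0 = n := by simp [dirichlet]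

theorem continuous_norm_sq_dirichlet (n : ℕ) : Continuous fun t => ‖dirichlet n t‖ ^ 2 :=
  (continuous_dirichlet n).norm.pow 2

theorem norm_dirichlet_le (n : ℕ) (t : ℝ) : ‖dirichlet n t‖ ≤ n := by
  refine (norm_sum_le _ _).trans ?_
  simp only [mul_comm Complex.I, Complex.norm_exp_ofReal_mul_I]
  simp

theorem norm_dirichlet_neg (n : ℕ) (t : ℝ) : ‖dirichlet n (-t)‖ = ‖dirichlet n t‖ := by
  rw [← RCLike.norm_conj (dirichlet n t)]
  congr 1
  simp only [dirichlet, map_sum, ← Complex.exp_conj, map_mul, Complex.conj_I, Complex.conj_ofReal]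
  refine Finset.sum_congr rfl fun l _ => ?_
  congr 1
  push_cast
  ring

/-- The geometric sum is (zⁿ - 1) / (z - 1); its numerator is at most 2, and its denominator at
least 4 t by Jordan's inequality for the sine. -/
theorem norm_sq_dirichlet_le (n : ℕ) {t : ℝ} (h0 : 0 < t) (h1 : t ≤ 1 / 2) :
    ‖dirichlet n t‖ ^ 2 ≤ 1 / (4 * t ^ 2) := by
  set z := Complex.exp (Complex.I * ((2 * Real.pi * t : ℝ) : ℂ)) with hz
  have e1 : dirichlet n t = ∑ l ∈ Finset.range n, z ^ l := by
    refine Finset.sum_congr rfl fun l _ => ?_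
    rw [hz, ← Complex.exp_nat_mul]
    congr 1
    push_cast
    ring
  have e2 : ‖dirichlet n t‖ * ‖z - 1‖ = ‖z ^ n - 1‖ := by
    rw [e1, ← norm_mul, geom_sum_mul]
  have hz1 : ‖z‖ = 1 := by rw [hz, mul_comm, Complex.norm_exp_ofReal_mul_I]
  have e3 : ‖z ^ n - 1‖ ≤ 2 := by
    refine (norm_sub_le _ _).trans ?_
    rw [norm_pow, hz1]; norm_num
  have e4 : 4 * t ≤ ‖z - 1‖ := by
    rw [hz, Complex.norm_exp_I_mul_ofReal_sub_one, Real.norm_eq_abs, abs_mul]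
    have hp := Real.pi_pos
    have : 2 / Real.pi * (Real.pi * t) ≤ Real.sin (Real.pi * t) :=
      Real.mul_le_sin (by positivity) (by nlinarith)
    have h2 : 2 / Real.pi * (Real.pi * t) = 2 * t := by field_simp
    have h3 : (2 * Real.pi * t) / 2 = Real.pi * t := by ring
    rw [h3]
    have := le_abs_self (Real.sin (Real.pi * t))
    rw [abs_two]
    linarith
  have e5 : ‖dirichlet n t‖ * (2 * t) ≤ 1 := by
    nlinarith [norm_nonneg (dirichlet n t)]
  rw [le_div_iff₀ (by positivity)]
  have : 0 ≤ ‖dirichlet n t‖ * (2 * t) := by positivity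
  nlinarith

theorem integral_exp_int_mul (k : ℤ) (a : ℝ) :
    ∫ t in a..a + 1, Complex.exp (Complex.I * ((2 * Real.pi * k * t : ℝ) : ℂ)) =
      if k = 0 then 1 else 0 := by
  split_ifs with h
  · simp [h]
  · have hc : (2 * Real.pi * k * Complex.I : ℂ) ≠ 0 := by
      simp [h, Real.pi_ne_zero]
    have e : ∀ t : ℝ, Complex.I * ((2 * Real.pi * k * t : ℝ) : ℂ) =
        (2 * Real.pi * k * Complex.I : ℂ) * t := by
      intro t; push_cast; ring
    simp_rw [e]
    rw [integral_exp_mul_complex hc]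
    have : (2 * Real.pi * k * Complex.I : ℂ) * ((a + 1 : ℝ) : ℂ) =
        (2 * Real.pi * k * Complex.I : ℂ) * a + k * (2 * Real.pi * Complex.I) := by
      push_cast; ring
    rw [this, Complex.exp_add, Complex.exp_int_mul_two_pi_mul_I, mul_one, sub_self, zero_div]

theorem integral_norm_sq_dirichlet (n : ℕ) (a : ℝ) :
    ∫ t in a..a + 1, ‖dirichlet n t‖ ^ 2 = n := by
  have e : ∀ t, ((‖dirichlet n t‖ ^ 2 : ℝ) : ℂ) = ∑ l ∈ Finset.range n, ∑ k ∈ Finset.range n,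
      Complex.exp (Complex.I * ((2 * Real.pi * ((k - l : ℤ) : ℝ) * t : ℝ) : ℂ)) := by
    intro t
    rw [Complex.ofReal_pow, ← Complex.conj_mul']
    simp only [dirichlet, map_sum, Finset.sum_mul_sum, ← Complex.exp_conj, map_mul,
      Complex.conj_I, Complex.conj_ofReal, ← Complex.exp_add]
    refine Finset.sum_congr rfl fun l _ => Finset.sum_congr rfl fun k _ => ?_
    congr 1
    push_cast
    ring
  have h : ((∫ t in a..a + 1, ‖dirichlet n t‖ ^ 2 : ℝ) : ℂ) = n := by
    rw [← intervalIntegral.integral_ofReal]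
    simp_rw [e]
    rw [intervalIntegral.integral_finsetSum fun l _ =>
      Continuous.intervalIntegrable (by fun_prop) _ _]
    have : ∀ l ∈ Finset.range n, ∫ t in a..a + 1, ∑ k ∈ Finset.range n,
        Complex.exp (Complex.I * ((2 * Real.pi * ((k - l : ℤ) : ℝ) * t : ℝ) : ℂ)) = 1 := by
      intro l hl
      rw [intervalIntegral.integral_finsetSum fun k _ =>
        Continuous.intervalIntegrable (by fun_prop) _ _]
      simp_rw [integral_exp_int_mul]
      simp only [sub_eq_zero, Nat.cast_inj]
      rw [Finset.sum_ite_eq', if_pos hl]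
    rw [Finset.sum_congr rfl this]
    simp
  exact_mod_cast h

/-- The mass over a period is n, and each of the two tails is at most the integral of 1 / (4 t²)
over [δ, 1/2], hence at most 1 / (4 δ). -/
theorem le_integral_norm_sq_dirichlet (n : ℕ) {δ : ℝ} (h0 : 0 < δ) (h1 : δ ≤ 1 / 2) :
    (n : ℝ) - 1 / (2 * δ) ≤ ∫ t in -δ..δ, ‖dirichlet n t‖ ^ 2 := by
  have hi : ∀ a b : ℝ, IntervalIntegrable (fun t => ‖dirichlet n t‖ ^ 2) volume a b := fun a b =>
    (continuous_norm_sq_dirichlet n).intervalIntegrable a b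
  have e1 := integral_norm_sq_dirichlet n (-(1 / 2))
  have e2 : ∫ t in -(1 / 2 : ℝ)..-δ, ‖dirichlet n t‖ ^ 2 =
      ∫ t in δ..1 / 2, ‖dirichlet n t‖ ^ 2 := by
    rw [← intervalIntegral.integral_comp_neg (a := δ) (b := 1 / 2)]
    simp only [norm_dirichlet_neg]
  have e3 : ∫ t in δ..1 / 2, ‖dirichlet n t‖ ^ 2 ≤ 1 / (4 * δ) := by
    have hpos : ∀ t ∈ Set.uIcc δ (1 / 2), t ≠ 0 := by
      intro t ht
      rw [Set.uIcc_of_le h1] at ht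
      exact (h0.trans_le ht.1).ne'
    have hd : ∀ t ∈ Set.uIcc δ (1 / 2),
        HasDerivAt (fun t : ℝ => -(4 * t)⁻¹) (1 / (4 * t ^ 2)) t := by
      intro t ht
      have h := ((((hasDerivAt_id t).const_mul 4).inv (by simpa using hpos t ht)).neg)
      have e : 1 / (4 * t ^ 2) = -(-(4 * 1) / (4 * id t) ^ 2) := by
        have := hpos t ht
        rw [id]
        field_simp
      rw [e]
      exact h
    have hc : IntervalIntegrable (fun t : ℝ => 1 / (4 * t ^ 2)) volume δ (1 / 2) := by
      refine ContinuousOn.intervalIntegrable ?_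
      refine continuousOn_const.div (by fun_prop) fun t ht => ?_
      have := hpos t ht
      positivity
    calc ∫ t in δ..1 / 2, ‖dirichlet n t‖ ^ 2 ≤ ∫ t in δ..1 / 2, 1 / (4 * t ^ 2) :=
          intervalIntegral.integral_mono_on h1 (hi _ _) hc fun t ht =>
            norm_sq_dirichlet_le n (h0.trans_le ht.1) ht.2
      _ = -(4 * (1 / 2 : ℝ))⁻¹ - -(4 * δ)⁻¹ :=
          intervalIntegral.integral_eq_sub_of_hasDerivAt hd hc
      _ ≤ 1 / (4 * δ) := by rw [one_div]; norm_num
  have e4 : -(1 / 2 : ℝ) + 1 = 1 / 2 := by norm_num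
  rw [e4, ← intervalIntegral.integral_add_adjacent_intervals (hi _ (-δ)) (hi _ _),
    ← intervalIntegral.integral_add_adjacent_intervals (hi (-δ) δ) (hi _ _), e2] at e1
  have : 1 / (2 * δ) = 1 / (4 * δ) + 1 / (4 * δ) := by field_simp; norm_num
  linarith

/-- The mass of the squared Dirichlet kernel `‖D (x - y)‖²` on the square `[a, b)²`. -/
def dirichletSquare (n : ℕ) (a b : ℝ) : ℝ :=
  ∫ x in Ico a b, ∫ y in Ico a b, ‖dirichlet n (x - y)‖ ^ 2

theorem inner_dirichletSquare (n : ℕ) {a b : ℝ} (hab : a ≤ b) (x : ℝ) :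
    ∫ y in Ico a b, ‖dirichlet n (x - y)‖ ^ 2 = ∫ t in x - b..x - a, ‖dirichlet n t‖ ^ 2 := by
  rw [integral_Ico_eq_integral_Ioc, ← intervalIntegral.integral_of_le hab,
    intervalIntegral.integral_comp_sub_left (fun t => ‖dirichlet n t‖ ^ 2) x]

theorem dirichletSquare_unit (n : ℕ) (a : ℝ) : dirichletSquare n a (a + 1) = n := by
  unfold dirichletSquare
  simp_rw [inner_dirichletSquare n (by linarith : a ≤ a + 1)]
  have : ∀ x : ℝ, ∫ t in x - (a + 1)..x - a, ‖dirichlet n t‖ ^ 2 = n := by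
    intro x
    rw [← integral_norm_sq_dirichlet n (x - (a + 1))]
    congr 1
    ring
  simp_rw [this]
  simp

/-- For x at distance at least δ from both ends of [a, b), the interval of y contains the central
window |x - y| < δ, which carries almost all of the mass n. -/
theorem le_dirichletSquare (n : ℕ) {a b δ : ℝ} (h0 : 0 < δ) (h1 : 2 * δ ≤ b - a)
    (hb : b - a ≤ 1) :
    (b - a - 2 * δ) * (n - 1 / (2 * δ)) ≤ dirichletSquare n a b := by
  have hab : a ≤ b := by linarith
  have hi : ∀ a b : ℝ, IntervalIntegrable (fun t => ‖dirichlet n t‖ ^ 2) volume a b := fun a b =>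
    (continuous_norm_sq_dirichlet n).intervalIntegrable a b
  have hnn : ∀ x, 0 ≤ ∫ y in Ico a b, ‖dirichlet n (x - y)‖ ^ 2 := fun x =>
    integral_nonneg fun y => sq_nonneg _
  have hcont : Continuous fun x => ∫ y in Ico a b, ‖dirichlet n (x - y)‖ ^ 2 := by
    simp_rw [inner_dirichletSquare n hab]
    have hc := intervalIntegral.continuous_primitive (hi) 0
    have : (fun x => ∫ t in x - b..x - a, ‖dirichlet n t‖ ^ 2) = fun x =>
        (∫ t in 0..x - a, ‖dirichlet n t‖ ^ 2) - ∫ t in 0..x - b, ‖dirichlet n t‖ ^ 2 := by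
      ext x
      rw [intervalIntegral.integral_interval_sub_left (hi _ _) (hi _ _)]
    rw [this]
    exact (hc.comp (by fun_prop : Continuous fun x => x - a)).sub
      (hc.comp (by fun_prop : Continuous fun x => x - b))
  have hin : ∀ x ∈ Ico (a + δ) (b - δ), (n : ℝ) - 1 / (2 * δ) ≤
      ∫ y in Ico a b, ‖dirichlet n (x - y)‖ ^ 2 := by
    intro x hx
    rw [inner_dirichletSquare n hab]
    refine (le_integral_norm_sq_dirichlet n h0 (by linarith)).trans ?_
    refine intervalIntegral.integral_mono_interval (by linarith [hx.2]) (by linarith)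
      (by linarith [hx.1]) (Eventually.of_forall fun t => sq_nonneg _) (hi _ _)
  calc (b - a - 2 * δ) * (n - 1 / (2 * δ))
      = ∫ x in Ico (a + δ) (b - δ), ((n : ℝ) - 1 / (2 * δ)) := by
        rw [setIntegral_const, Real.volume_real_Ico_of_le (by linarith), smul_eq_mul]; ring
    _ ≤ ∫ x in Ico (a + δ) (b - δ), ∫ y in Ico a b, ‖dirichlet n (x - y)‖ ^ 2 :=
        setIntegral_mono_on (integrableOn_const (by simp))
          (hcont.integrableOn_Icc.mono_set Ico_subset_Icc_self)
          measurableSet_Ico hin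
    _ ≤ dirichletSquare n a b :=
        setIntegral_mono_set (hcont.integrableOn_Icc.mono_set Ico_subset_Icc_self)
          (Eventually.of_forall hnn)
          (Eventually.of_forall (Ico_subset_Ico (by linarith) (by linarith)))

end DirichletKernel

/-! ### The partition of the cube into cells and the kernel mass between different cells -/

section Cells

variable {d : ℕ}

theorem measurableSet_cube : MeasurableSet (cube d) :=
  MeasurableSet.univ_pi fun _ => measurableSet_Ico

theorem volume_cube : volume (cube d) = 1 := by
  rw [cube, Real.volume_pi_Ico]
  norm_num

/-- The cell with index `c` of the partition of the cube into `p^d` congruent cells. -/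
def cell (p : ℕ) (c : Fin d → Fin p) : Set (Fin d → ℝ) :=
  univ.pi fun j => Ico (-1 / 2 + (c j : ℝ) / p) (-1 / 2 + ((c j : ℝ) + 1) / p)

/-- The index of the cell that contains a point of the cube. -/
def cellOf (p : ℕ) [NeZero p] (x : Fin d → ℝ) : Fin d → Fin p :=
  fun j => Fin.ofNat p ⌊p * (x j + 1 / 2)⌋₊

theorem measurable_cellOf (p : ℕ) [NeZero p] : Measurable (cellOf (d := d) p) := by
  refine measurable_pi_iff.2 fun j => ?_
  exact (measurable_from_nat (f := fun k : ℕ => Fin.ofNat p k)).comp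
    (Nat.measurable_floor.comp (by fun_prop))

theorem measurableSet_cell (p : ℕ) (c : Fin d → Fin p) : MeasurableSet (cell p c) :=
  MeasurableSet.univ_pi fun _ => measurableSet_Ico

theorem cell_subset_cube (p : ℕ) [NeZero p] (c : Fin d → Fin p) : cell p c ⊆ cube d := by
  intro x hx j _
  have hp : (0 : ℝ) < p := by exact_mod_cast Nat.pos_of_ne_zero (NeZero.ne p)
  have h := hx j (mem_univ j)
  have h1 : ((c j : ℕ) : ℝ) + 1 ≤ p := by exact_mod_cast (c j).2
  have h2 : (((c j : ℕ) : ℝ) + 1) / p ≤ 1 := (div_le_one hp).2 h1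
  have h3 : 0 ≤ ((c j : ℕ) : ℝ) / p := by positivity
  exact ⟨by linarith [h.1], by linarith [h.2]⟩

/-- On the cube the floor in `cellOf` is below p, so the reduction modulo p in `Fin.ofNat` is
inactive. Outside the cube the index has no meaning. -/
theorem mem_cell_iff {p : ℕ} [NeZero p] {x : Fin d → ℝ} (hx : x ∈ cube d) (c : Fin d → Fin p) :
    x ∈ cell p c ↔ cellOf p x = c := by
  have hp : (0 : ℝ) < p := by exact_mod_cast Nat.pos_of_ne_zero (NeZero.ne p)
  rw [funext_iff, cell, mem_univ_pi]
  refine forall_congr' fun j => ?_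
  have h := hx j (mem_univ j)
  have h0 : 0 ≤ (p : ℝ) * (x j + 1 / 2) := mul_nonneg hp.le (by linarith [h.1])
  have h1 : (p : ℝ) * (x j + 1 / 2) < p := by nlinarith [h.2]
  have h2 : ⌊(p : ℝ) * (x j + 1 / 2)⌋₊ < p := (Nat.floor_lt h0).2 h1
  have e : (cellOf p x j = c j) ↔ ⌊(p : ℝ) * (x j + 1 / 2)⌋₊ = (c j : ℕ) := by
    rw [Fin.ext_iff]
    simp only [cellOf, Fin.ofNat]
    rw [Nat.mod_eq_of_lt h2]
  rw [e, Nat.floor_eq_iff h0, mem_Ico]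
  have e1 : -1 / 2 + ((c j : ℕ) : ℝ) / p ≤ x j ↔ ((c j : ℕ) : ℝ) ≤ p * (x j + 1 / 2) := by
    rw [mul_comm, ← div_le_iff₀ hp]
    constructor <;> intro h <;> linarith
  have e2 : x j < -1 / 2 + (((c j : ℕ) : ℝ) + 1) / p ↔ p * (x j + 1 / 2) < ((c j : ℕ) : ℝ) + 1 := by
    rw [mul_comm, ← lt_div_iff₀ hp]
    constructor <;> intro h <;> linarith
  rw [e1, e2]

theorem volume_cell (p : ℕ) [NeZero p] (c : Fin d → Fin p) :
    volume (cell p c) = ENNReal.ofReal (1 / (p : ℝ) ^ d) := by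
  rw [cell, Real.volume_pi_Ico]
  have : ∀ j, (-1 / 2 + ((c j : ℝ) + 1) / p) - (-1 / 2 + (c j : ℝ) / p) = 1 / p := by
    intro j; ring
  simp only [this, Finset.prod_const, Finset.card_univ, Fintype.card_fin]
  rw [← ENNReal.ofReal_pow (by positivity), div_pow, one_pow]

instance isFiniteMeasure_cell (p : ℕ) [NeZero p] (c : Fin d → Fin p) :
    IsFiniteMeasure ((volume : Measure (Fin d → ℝ)).restrict (cell p c)) :=
  ⟨by rw [Measure.restrict_apply_univ, volume_cell]; exact ENNReal.ofReal_lt_top⟩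

/-- The cube `[0, 1)^d`. -/
def unitCube (d : ℕ) : Set (Fin d → ℝ) := univ.pi fun _ => Ico (0 : ℝ) 1

instance isProbabilityMeasure_unitCube (d : ℕ) :
    IsProbabilityMeasure ((volume : Measure (Fin d → ℝ)).restrict (unitCube d)) :=
  ⟨by rw [Measure.restrict_apply_univ, unitCube, Real.volume_pi_Ico]; simp⟩

instance isProbabilityMeasure_cube (d : ℕ) :
    IsProbabilityMeasure ((volume : Measure (Fin d → ℝ)).restrict (cube d)) :=
  ⟨by rw [Measure.restrict_apply_univ, volume_cube]⟩

/-- The similarity from the unit cube onto a cell. -/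
def cellMap (p : ℕ) (c : Fin d → Fin p) (s : Fin d → ℝ) : Fin d → ℝ :=
  (fun j => -1 / 2 + (c j : ℝ) / p) + (p : ℝ)⁻¹ • s

theorem measurable_cellMap (p : ℕ) (c : Fin d → Fin p) : Measurable (cellMap p c) := by
  unfold cellMap; fun_prop

/-- The uniform probability distribution on a cell. -/
def cellLaw (p : ℕ) (c : Fin d → Fin p) : Measure (Fin d → ℝ) :=
  (volume.restrict (unitCube d)).map (cellMap p c)

instance isProbabilityMeasure_cellLaw (p : ℕ) (c : Fin d → Fin p) :
    IsProbabilityMeasure (cellLaw p c) :=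
  Measure.isProbabilityMeasure_map (measurable_cellMap p c).aemeasurable

theorem restrict_cell (p : ℕ) [NeZero p] (c : Fin d → Fin p) :
    volume.restrict (cell p c) = ENNReal.ofReal (1 / (p : ℝ) ^ d) • cellLaw p c := by
  have hp : (0 : ℝ) < p := by exact_mod_cast Nat.pos_of_ne_zero (NeZero.ne p)
  have hmap : (volume : Measure (Fin d → ℝ)).map (cellMap p c) =
      ENNReal.ofReal ((p : ℝ) ^ d) • volume := by
    have e : cellMap p c = (fun s => (fun j => -1 / 2 + (c j : ℝ) / p) + s) ∘
        fun s : Fin d → ℝ => (p : ℝ)⁻¹ • s := rfl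
    rw [e, ← Measure.map_map (by fun_prop) (by fun_prop),
      Measure.map_addHaar_smul _ (inv_ne_zero hp.ne'), Measure.map_smul, map_add_left_eq_self]
    simp [abs_of_pos hp]
  have hpre : cellMap p c ⁻¹' cell p c = unitCube d := by
    ext s
    simp only [mem_preimage, cell, unitCube, mem_univ_pi, cellMap, Pi.add_apply, Pi.smul_apply,
      smul_eq_mul, mem_Ico]
    refine forall_congr' fun j => ?_
    rw [add_div, inv_mul_eq_div]
    have h1 : 0 ≤ s j / p ↔ 0 ≤ s j := by
      rw [le_div_iff₀ hp, zero_mul]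
    have h2 : s j / p < 1 / p ↔ s j < 1 := div_lt_div_iff_of_pos_right hp
    rw [← h1, ← h2]
    constructor
    · rintro ⟨h, h'⟩; exact ⟨by linarith, by linarith⟩
    · rintro ⟨h, h'⟩; exact ⟨by linarith, by linarith⟩
  rw [cellLaw, ← hpre, ← Measure.restrict_map (measurable_cellMap p c) (measurableSet_cell p c),
    hmap, Measure.restrict_smul, smul_smul, ← ENNReal.ofReal_mul (by positivity)]
  have : 1 / (p : ℝ) ^ d * (p : ℝ) ^ d = 1 := by field_simp
  rw [this, ENNReal.ofReal_one, one_smul]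

/-- The squared modulus of the `d`-fold Dirichlet kernel. -/
def kernelSq (n : ℕ) (x y : Fin d → ℝ) : ℝ := ∏ j, ‖dirichlet n (x j - y j)‖ ^ 2

theorem continuous_kernelSq (n : ℕ) :
    Continuous fun z : (Fin d → ℝ) × (Fin d → ℝ) => kernelSq n z.1 z.2 := by
  unfold kernelSq
  refine continuous_finsetProd _ fun j _ => ?_
  exact (continuous_norm_sq_dirichlet n).comp (by fun_prop)

theorem kernelSq_nonneg (n : ℕ) (x y : Fin d → ℝ) : 0 ≤ kernelSq n x y :=
  Finset.prod_nonneg fun _ _ => sq_nonneg _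

theorem kernelSq_le (n : ℕ) (x y : Fin d → ℝ) : kernelSq n x y ≤ ((n : ℝ) ^ 2) ^ d := by
  calc kernelSq n x y ≤ ∏ _j : Fin d, (n : ℝ) ^ 2 :=
        Finset.prod_le_prod (fun _ _ => sq_nonneg _) fun j _ =>
          pow_le_pow_left₀ (norm_nonneg _) (norm_dirichlet_le n _) 2
    _ = _ := by simp

theorem integral_kernelSq_box (n : ℕ) (a b : Fin d → ℝ) :
    ∫ x in univ.pi fun j => Ico (a j) (b j), ∫ y in univ.pi fun j => Ico (a j) (b j),
      kernelSq n x y = ∏ j, dirichletSquare n (a j) (b j) := by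
  rw [volume_pi, Measure.restrict_pi_pi]
  have h1 : ∀ x : Fin d → ℝ, ∫ y, kernelSq n x y
      ∂(Measure.pi fun j => volume.restrict (Ico (a j) (b j))) =
        ∏ j, ∫ y in Ico (a j) (b j), ‖dirichlet n (x j - y)‖ ^ 2 := fun x =>
    integral_fintype_prod_eq_prod (μ := fun j => volume.restrict (Ico (a j) (b j)))
      fun j y => ‖dirichlet n (x j - y)‖ ^ 2
  simp_rw [h1]
  exact integral_fintype_prod_eq_prod (μ := fun j => volume.restrict (Ico (a j) (b j)))
      fun j x => ∫ y in Ico (a j) (b j), ‖dirichlet n (x - y)‖ ^ 2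

/-- The squared kernel between points of different cells. -/
def crossKernel (n p : ℕ) [NeZero p] (x y : Fin d → ℝ) : ℝ :=
  if cellOf p x = cellOf p y then 0 else kernelSq n x y

theorem crossKernel_nonneg (n p : ℕ) [NeZero p] (x y : Fin d → ℝ) : 0 ≤ crossKernel n p x y := by
  unfold crossKernel
  split_ifs
  exacts [le_rfl, kernelSq_nonneg n x y]

theorem crossKernel_le (n p : ℕ) [NeZero p] (x y : Fin d → ℝ) :
    crossKernel n p x y ≤ ((n : ℝ) ^ 2) ^ d := by
  unfold crossKernel
  split_ifs
  exacts [by positivity, kernelSq_le n x y]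

theorem measurable_crossKernel (n p : ℕ) [NeZero p] :
    Measurable fun z : (Fin d → ℝ) × (Fin d → ℝ) => crossKernel n p z.1 z.2 :=
  Measurable.ite
    (measurableSet_eq_fun ((measurable_cellOf p).comp measurable_fst)
      ((measurable_cellOf p).comp measurable_snd))
    measurable_const (continuous_kernelSq n).measurable

theorem integrable_crossKernel (n p : ℕ) [NeZero p] {μ : Measure ((Fin d → ℝ) × (Fin d → ℝ))}
    [IsFiniteMeasure μ] : Integrable (fun z => crossKernel n p z.1 z.2) μ :=
  .of_bound (measurable_crossKernel n p).aestronglyMeasurable (((n : ℝ) ^ 2) ^ d)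
    (Eventually.of_forall fun z => by
      rw [Real.norm_eq_abs, abs_of_nonneg (crossKernel_nonneg n p _ _)]
      exact crossKernel_le n p _ _)

theorem integrable_kernelSq (n : ℕ) {μ : Measure ((Fin d → ℝ) × (Fin d → ℝ))}
    [IsFiniteMeasure μ] : Integrable (fun z => kernelSq n z.1 z.2) μ :=
  .of_bound (continuous_kernelSq n).aestronglyMeasurable (((n : ℝ) ^ 2) ^ d)
    (Eventually.of_forall fun z => by
      rw [Real.norm_eq_abs, abs_of_nonneg (kernelSq_nonneg n _ _)]
      exact kernelSq_le n _ _)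

/-- The total mass is n^d, because each coordinate integrates over a full period; the blocks of
pairs inside a common cell are subtracted. -/
theorem integral_crossKernel_eq (n p : ℕ) [NeZero p] :
    ∫ x in cube d, ∫ y in cube d, crossKernel n p x y =
      (n : ℝ) ^ d - ∑ c : Fin d → Fin p, ∏ j,
        dirichletSquare n (-1 / 2 + (c j : ℝ) / p) (-1 / 2 + ((c j : ℝ) + 1) / p) := by
  set Λ := (volume : Measure (Fin d → ℝ)).restrict (cube d) with hΛ
  have hcc : ∀ c : Fin d → Fin p, ∫ x in cell p c, ∫ y in cell p c, kernelSq n x y =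
      ∫ z, (cell p c ×ˢ cell p c).indicator (fun z => kernelSq n z.1 z.2) z ∂(Λ.prod Λ) := by
    intro c
    rw [integral_indicator ((measurableSet_cell p c).prod (measurableSet_cell p c)),
      ← Measure.prod_restrict, hΛ, Measure.restrict_restrict (measurableSet_cell p c),
      inter_eq_self_of_subset_left (cell_subset_cube p c), integral_prod _ (integrable_kernelSq n)]
  have hall : ∫ z, kernelSq n z.1 z.2 ∂(Λ.prod Λ) = (n : ℝ) ^ d := by
    rw [integral_prod _ (integrable_kernelSq n), hΛ, cube, integral_kernelSq_box]
    have : (1 / 2 : ℝ) = -1 / 2 + 1 := by norm_num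
    rw [this]
    simp [dirichletSquare_unit]
  have hae : ∀ᵐ z ∂(Λ.prod Λ), crossKernel n p z.1 z.2 = kernelSq n z.1 z.2 -
      ∑ c, (cell p c ×ˢ cell p c).indicator (fun z => kernelSq n z.1 z.2) z := by
    rw [hΛ, Measure.prod_restrict]
    refine (ae_restrict_mem (measurableSet_cube.prod measurableSet_cube)).mono fun z hz => ?_
    have h1 : ∀ c : Fin d → Fin p, (cell p c ×ˢ cell p c).indicator
        (fun z => kernelSq n z.1 z.2) z =
          if cellOf p z.1 = c then (if cellOf p z.2 = c then kernelSq n z.1 z.2 else 0) else 0 := by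
      intro c
      classical
      simp only [indicator_apply, mem_prod, mem_cell_iff hz.1, mem_cell_iff hz.2, ite_and]
    simp only [h1, Finset.sum_ite_eq, Finset.mem_univ, if_true]
    unfold crossKernel
    by_cases h : cellOf p z.1 = cellOf p z.2
    · simp [h]
    · rw [if_neg h, if_neg (Ne.symm h), sub_zero]
  rw [← integral_prod _ (integrable_crossKernel n p), integral_congr_ae hae, integral_sub, hall,
    integral_finsetSum]
  · simp only [← hcc]
    congr 1
    exact Finset.sum_congr rfl fun c _ => integral_kernelSq_box n _ _
  · exact fun c _ => (integrable_kernelSq n).indicator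
      ((measurableSet_cell p c).prod (measurableSet_cell p c))
  · exact integrable_kernelSq n
  · exact integrable_finsetSum _ fun c _ => (integrable_kernelSq n).indicator
      ((measurableSet_cell p c).prod (measurableSet_cell p c))

/-- Most of the mass of the squared Dirichlet kernel lies between points of the same cell. -/
theorem integral_crossKernel_le (n p : ℕ) [NeZero p] (hpn : p ≤ n) :
    ∫ x in cube d, ∫ y in cube d, crossKernel n p x y ≤
      (n : ℝ) ^ d * (2 * d * √((p : ℝ) / n)) := by
  have hp : (0 : ℝ) < p := by exact_mod_cast Nat.pos_of_ne_zero (NeZero.ne p)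
  have hpn' : (p : ℝ) ≤ n := by exact_mod_cast hpn
  have hn : (0 : ℝ) < n := hp.trans_le hpn'
  set s := √((p : ℝ) / n) with hs
  have hs0 : 0 < s := Real.sqrt_pos.2 (by positivity)
  have hss : s ^ 2 = p / n := Real.sq_sqrt (by positivity)
  have hs1 : s ≤ 1 := by
    rw [← sq_le_one_iff₀ hs0.le, hss]; exact (div_le_one hn).2 hpn'
  have hsn : s ^ 2 * n = p := by rw [hss]; field_simp
  have hsq : ∀ k : Fin p, (n : ℝ) / p * (1 - s) ^ 2 ≤
      dirichletSquare n (-1 / 2 + (k : ℝ) / p) (-1 / 2 + ((k : ℝ) + 1) / p) := by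
    intro k
    have hlen : (-1 / 2 + ((k : ℝ) + 1) / p) - (-1 / 2 + (k : ℝ) / p) = 1 / p := by ring
    -- This window balances the loss at the boundary of the cell against the tail of the kernel:
    -- with s² = p / n both cost a factor 1 - s.
    have hδ : 2 * (s / (2 * p)) = s / p := by field_simp
    have h := le_dirichletSquare n (a := -1 / 2 + (k : ℝ) / p)
      (b := -1 / 2 + ((k : ℝ) + 1) / p) (δ := s / (2 * p)) (by positivity)
      (by rw [hlen, hδ]; gcongr)
      (by rw [hlen]; exact (div_le_one hp).2 (by exact_mod_cast Nat.pos_of_ne_zero (NeZero.ne p)))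
    rw [hlen, hδ] at h
    refine le_of_eq_of_le ?_ h
    have e1 : 1 / (s / p) = s * n := by
      field_simp; linarith
    rw [e1]
    field_simp
  have hsum : (n : ℝ) ^ d * (1 - 2 * d * s) ≤ ∑ c : Fin d → Fin p, ∏ j,
        dirichletSquare n (-1 / 2 + (c j : ℝ) / p) (-1 / 2 + ((c j : ℝ) + 1) / p) := by
    calc (n : ℝ) ^ d * (1 - 2 * d * s) ≤ (n : ℝ) ^ d * ((1 - s) ^ 2) ^ d := by
          gcongr
          -- Bernoulli's inequality with exponent 2 d.
          have := one_add_mul_le_pow (a := -s) (by linarith) (2 * d)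
          rw [← pow_mul]
          push_cast at this
          rw [← sub_eq_add_neg] at this
          linarith
      _ = ∑ _c : Fin d → Fin p, ∏ _j : Fin d, ((n : ℝ) / p * (1 - s) ^ 2) := by
          simp only [Finset.prod_const, Finset.card_univ, Fintype.card_fin, Finset.sum_const,
            Fintype.card_pi, nsmul_eq_mul, Nat.cast_pow, mul_pow, div_pow]
          field_simp
      _ ≤ _ := Finset.sum_le_sum fun c _ => Finset.prod_le_prod (fun _ _ => by positivity)
          fun j _ => hsq (c j)
  rw [integral_crossKernel_eq]
  linarith

end Cells

/-! ### The expected loss of random points and its decoupling over cells -/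

section Model

/-- The additive monoid of positive semidefinite matrices. -/
def psdCone (ι : Type*) : AddSubmonoid (ι → ι → ℂ) where
  carrier := {S | (Matrix.of S).PosSemidef}
  zero_mem' := Matrix.PosSemidef.zero
  add_mem' := fun hS hT => Matrix.PosSemidef.add hS hT

instance measurableAdd_psdCone {ι : Type*} [Fintype ι] : MeasurableAdd₂ (psdCone ι) :=
  ⟨Measurable.subtype_mk
    ((measurable_subtype_coe.comp measurable_fst).add
      (measurable_subtype_coe.comp measurable_snd))⟩

variable {ι : Type*} [Fintype ι] [DecidableEq ι]

/-- The deficit of the resolvent trace as a function on the cone. -/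
def coneLoss (S : psdCone ι) : ℝ := resLoss (Matrix.of (S : ι → ι → ℂ))

/-- Up to the inverse of a determinant the loss is built from polynomials in the entries. This gives
measurability everywhere and continuity wherever 1 + S is invertible. -/
theorem resLoss_eq_adjugate (S : Matrix ι ι ℂ) : resLoss S =
    (Fintype.card ι : ℝ) - (((1 + S).det)⁻¹ * Matrix.trace ((1 + S).adjugate)).re := by
  rw [resLoss, Matrix.inv_def, Ring.inverse_eq_inv', Matrix.trace_smul, smul_eq_mul]

theorem measurable_resLoss : Measurable fun S : ι → ι → ℂ => resLoss (Matrix.of S) := by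
  have h1 : Continuous fun S : ι → ι → ℂ => (1 + Matrix.of S : Matrix ι ι ℂ) :=
    continuous_const.add continuous_id
  simp only [resLoss_eq_adjugate]
  exact measurable_const.sub (Complex.measurable_re.comp
    (h1.matrix_det.measurable.inv.mul h1.matrix_adjugate.matrix_trace.measurable))

theorem tendsto_resLoss {α : Type*} {F : Filter α} {S : α → Matrix ι ι ℂ} {T : Matrix ι ι ℂ}
    (hT : T.PosSemidef) (h : Tendsto S F (𝓝 T)) :
    Tendsto (fun a => resLoss (S a)) F (𝓝 (resLoss T)) := by
  have h1 : Continuous fun S : Matrix ι ι ℂ => 1 + S := continuous_const.add continuous_id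
  have hc : ContinuousAt (fun S : Matrix ι ι ℂ => resLoss S) T := by
    simp only [resLoss_eq_adjugate]
    exact continuousAt_const.sub (Complex.continuous_re.continuousAt.comp
      ((h1.matrix_det.continuousAt.inv₀ (isUnit_one_add hT).ne_zero).mul
        h1.matrix_adjugate.matrix_trace.continuousAt))
  exact hc.tendsto.comp h

theorem measurable_coneLoss : Measurable (coneLoss (ι := ι)) :=
  measurable_resLoss.comp measurable_subtype_coe

/-- The bound needs positivity; on the cone it holds for every argument, as the lemmas on `iterAvg`
require of Ψ. -/
theorem abs_coneLoss_le (S : psdCone ι) : |coneLoss S| ≤ Fintype.card ι := by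
  rw [coneLoss, abs_of_nonneg (resLoss_nonneg S.2)]
  exact resLoss_le_card S.2

variable {d : ℕ}

/-- The column of the Vandermonde matrix that belongs to the point `x`, scaled by `√t`. -/
def pointCol (n : ℕ) (t : ℝ) (x : Fin d → ℝ) (l : Fin d → Fin n) : ℂ :=
  ((√t : ℝ) : ℂ) *
    Complex.exp (-(2 * Real.pi * Complex.I) * ((∑ j, ((l j : ℕ) : ℝ) * x j : ℝ) : ℂ))

/-- The rank one matrix contributed by the point `x`. -/
def pointMat (n : ℕ) (t : ℝ) (x : Fin d → ℝ) : psdCone (Fin d → Fin n) :=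
  ⟨Matrix.vecMulVec (pointCol n t x) (star (pointCol n t x)),
    Matrix.posSemidef_vecMulVec_self_star _⟩

theorem measurable_pointMat (n : ℕ) (t : ℝ) : Measurable (pointMat (d := d) n t) := by
  refine Measurable.subtype_mk ?_
  refine measurable_pi_iff.2 fun k => measurable_pi_iff.2 fun l => ?_
  have h : ∀ l, Continuous fun x : Fin d → ℝ => pointCol n t x l := fun l => by
    unfold pointCol; fun_prop
  exact ((h k).mul (continuous_star.comp (h l))).measurable

theorem coneLoss_add_pointMat (n : ℕ) (t : ℝ) (S : psdCone (Fin d → Fin n)) (x : Fin d → ℝ) :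
    coneLoss (S + pointMat n t x) - coneLoss S ∈ Icc (0 : ℝ) 1 :=
  resLoss_add_rank_one S.2 (pointCol n t x)

/-- The scaled Vandermonde matrix of a family of points. -/
def pointsMat (n : ℕ) (t : ℝ) {m : ℕ} (x : Fin m → Fin d → ℝ) :
    Matrix (Fin d → Fin n) (Fin m) ℂ :=
  Matrix.of fun l q => pointCol n t (x q) l

theorem coneLoss_sum_pointMat (n : ℕ) (t : ℝ) {m : ℕ} (x : Fin m → Fin d → ℝ) :
    coneLoss (0 + ∑ q, pointMat n t (x q)) =
      resLoss (pointsMat n t x * (pointsMat n t x)ᴴ) := by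
  rw [coneLoss, zero_add]
  congr 1
  ext k l
  rw [Matrix.of_apply, AddSubmonoid.coe_finsetSum, Finset.sum_apply, Finset.sum_apply,
    Matrix.mul_apply]
  rfl

/-- The Gram matrix of the scaled columns that belong to a family of points. -/
def gramMat (n : ℕ) (t : ℝ) {m : ℕ} (x : Fin m → Fin d → ℝ) : Matrix (Fin m) (Fin m) ℂ :=
  Matrix.of fun i j => (t : ℂ) * ∏ a, dirichlet n (x i a - x j a)

/-- The sum over multi-indices of a product of phases factors over the coordinates. Only differences
of points survive, whence the translation invariance used for the cells. -/
theorem pointsMat_gram (n : ℕ) {t : ℝ} (ht : 0 ≤ t) {m : ℕ} (x : Fin m → Fin d → ℝ) :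
    (pointsMat n t x)ᴴ * pointsMat n t x = gramMat n t x := by
  ext i j
  simp only [Matrix.mul_apply, Matrix.conjTranspose_apply, pointsMat, Matrix.of_apply, gramMat,
    dirichlet, Finset.sum_range]
  rw [Finset.prod_univ_sum, Fintype.piFinset_univ, Finset.mul_sum]
  refine Finset.sum_congr rfl fun l _ => ?_
  have ht' : ((√t : ℝ) : ℂ) * ((√t : ℝ) : ℂ) = t := by
    rw [← Complex.ofReal_mul, Real.mul_self_sqrt ht]
  rw [← Complex.exp_sum]
  simp only [pointCol, RCLike.star_def, map_mul, Complex.conj_ofReal, ← Complex.exp_conj]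
  rw [mul_mul_mul_comm, ht', ← Complex.exp_add]
  congr 2
  simp only [map_neg, map_mul, map_ofNat, Complex.conj_ofReal, Complex.conj_I]
  push_cast
  rw [Finset.mul_sum, Finset.mul_sum, ← Finset.sum_add_distrib]
  refine Finset.sum_congr rfl fun a _ => ?_
  ring

theorem resLoss_pointsMat (n : ℕ) {t : ℝ} (ht : 0 ≤ t) {m : ℕ} (x : Fin m → Fin d → ℝ) :
    resLoss (pointsMat n t x * (pointsMat n t x)ᴴ) = resLoss (gramMat n t x) := by
  rw [resLoss_mul_conjTranspose, pointsMat_gram n ht]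

theorem posSemidef_gramMat (n : ℕ) {t : ℝ} (ht : 0 ≤ t) {m : ℕ} (x : Fin m → Fin d → ℝ) :
    (gramMat n t x).PosSemidef := by
  rw [← pointsMat_gram n ht]
  exact Matrix.posSemidef_conjTranspose_mul_self _

theorem norm_sq_gramMat (n : ℕ) (t : ℝ) {m : ℕ} (x : Fin m → Fin d → ℝ) (i j : Fin m) :
    ‖gramMat n t x i j‖ ^ 2 = t ^ 2 * kernelSq n (x i) (x j) := by
  simp only [gramMat, Matrix.of_apply, norm_mul, norm_prod, kernelSq, mul_pow, Finset.prod_pow,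
    Complex.norm_real, Real.norm_eq_abs, sq_abs]

/-- The expected deficit of the resolvent trace for `m` independent points of law `μ`. -/
def meanLoss (n : ℕ) (t : ℝ) (μ : Measure (Fin d → ℝ)) (m : ℕ) : ℝ :=
  iterAvg μ (pointMat n t) coneLoss m 0

variable {μ : Measure (Fin d → ℝ)} [IsProbabilityMeasure μ]

theorem meanLoss_eq_integral (n : ℕ) (t : ℝ) (m : ℕ) :
    meanLoss n t μ m = ∫ x, resLoss (pointsMat n t x * (pointsMat n t x)ᴴ)
      ∂(Measure.pi fun _ : Fin m => μ) := by
  rw [meanLoss, iterAvg_eq_integral_pi (measurable_pointMat n t) measurable_coneLoss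
    abs_coneLoss_le]
  simp only [coneLoss_sum_pointMat]

theorem abs_meanLoss_sub_le (n : ℕ) (t : ℝ) (j k : ℕ) :
    |meanLoss n t μ j - meanLoss n t μ k| ≤ |(j : ℝ) - k| :=
  abs_iterAvg_sub_le (measurable_pointMat n t) measurable_coneLoss abs_coneLoss_le
    (coneLoss_add_pointMat n t) j k 0

theorem meanLoss_zero (n : ℕ) (t : ℝ) (μ : Measure (Fin d → ℝ)) : meanLoss n t μ 0 = 0 :=
  resLoss_zero

theorem abs_meanLoss_le (n : ℕ) (t : ℝ) (m : ℕ) : |meanLoss n t μ m| ≤ (n : ℝ) ^ d := by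
  refine (abs_iterAvg_le abs_coneLoss_le m 0).trans (le_of_eq ?_)
  simp

theorem integrable_resLoss_pointsMat (n : ℕ) (t : ℝ) (m : ℕ) :
    Integrable (fun x => resLoss (pointsMat n t x * (pointsMat n t x)ᴴ))
      (Measure.pi fun _ : Fin m => μ) := by
  simp only [← coneLoss_sum_pointMat]
  refine .of_bound (measurable_coneLoss.comp (measurable_const.add (Finset.measurable_sum _
    fun i _ => (measurable_pointMat n t).comp (measurable_pi_apply i)))).aestronglyMeasurable _
      (Eventually.of_forall fun x => abs_coneLoss_le _)

theorem sum_norm_sq_pointsMat (n : ℕ) {t : ℝ} (ht : 0 ≤ t) {m : ℕ} (x : Fin m → Fin d → ℝ) :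
    ∑ l, ∑ q, ‖pointsMat n t x l q‖ ^ 2 = t * (m * (n : ℝ) ^ d) := by
  have : ∀ l q, ‖pointsMat n t x l q‖ ^ 2 = t := by
    intro l q
    simp only [pointsMat, Matrix.of_apply, pointCol, norm_mul, mul_pow]
    have e : -(2 * Real.pi * Complex.I) * ((∑ j, ((l j : ℕ) : ℝ) * x q j : ℝ) : ℂ) =
        ((-(2 * Real.pi * (∑ j, ((l j : ℕ) : ℝ) * x q j)) : ℝ) : ℂ) * Complex.I := by
      push_cast; ring
    rw [e, Complex.norm_exp_ofReal_mul_I, Complex.norm_real, Real.norm_eq_abs, sq_abs,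
      Real.sq_sqrt ht]
    ring
  simp only [this]
  simp
  ring

theorem pointsMat_eq_smul (n : ℕ) (t : ℝ) {m : ℕ} (x : Fin m → Fin d → ℝ) :
    pointsMat n t x = ((√t : ℝ) : ℂ) • pointsMat n 1 x := by
  ext l q
  simp [pointsMat, pointCol]

theorem pointsMat_mul_conjTranspose (n : ℕ) {t : ℝ} (ht : 0 ≤ t) {m : ℕ}
    (x : Fin m → Fin d → ℝ) : pointsMat n t x * (pointsMat n t x)ᴴ =
      (t : ℂ) • (pointsMat n 1 x * (pointsMat n 1 x)ᴴ) := by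
  rw [pointsMat_eq_smul, Matrix.conjTranspose_smul, Matrix.smul_mul, Matrix.mul_smul, smul_smul]
  congr 1
  rw [RCLike.star_def, Complex.conj_ofReal, ← Complex.ofReal_mul, Real.mul_self_sqrt ht]

theorem abs_meanLoss_sub_coeff_le (n : ℕ) {s t : ℝ} (hs : 0 ≤ s) (ht : 0 ≤ t) (m : ℕ) :
    |meanLoss n s μ m - meanLoss n t μ m| ≤ |s - t| * (m * (n : ℝ) ^ d) := by
  rw [meanLoss_eq_integral, meanLoss_eq_integral, ← integral_sub
    (integrable_resLoss_pointsMat n s m) (integrable_resLoss_pointsMat n t m)]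
  have := norm_integral_le_of_norm_le_const (μ := Measure.pi fun _ : Fin m => μ)
    (f := fun x => resLoss (pointsMat n s x * (pointsMat n s x)ᴴ) -
      resLoss (pointsMat n t x * (pointsMat n t x)ᴴ)) (C := |s - t| * (m * (n : ℝ) ^ d))
    (Eventually.of_forall fun x => by
      rw [pointsMat_mul_conjTranspose n hs, pointsMat_mul_conjTranspose n ht, Real.norm_eq_abs]
      refine (abs_resLoss_smul_sub_le _ hs ht).trans (le_of_eq ?_)
      rw [sum_norm_sq_pointsMat n zero_le_one, one_mul])
  simpa using this

/-- The expected loss of `k` uniform points in a cell does not depend on the cell. -/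
theorem meanLoss_cellLaw (n : ℕ) {t : ℝ} (ht : 0 ≤ t) (p : ℕ) (c : Fin d → Fin p) (k : ℕ) :
    meanLoss n t (cellLaw p c) k = ∫ s, resLoss (gramMat n t fun q => (p : ℝ)⁻¹ • s q)
      ∂(Measure.pi fun _ : Fin k => volume.restrict (unitCube d)) := by
  rw [meanLoss, cellLaw, iterAvg_map (measurable_cellMap p c) (measurable_pointMat n t)
    measurable_coneLoss, iterAvg_eq_integral_pi
    (V := fun y => pointMat n t (cellMap p c y))
    ((measurable_pointMat n t).comp (measurable_cellMap p c)) measurable_coneLoss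
    abs_coneLoss_le]
  refine integral_congr_ae (Eventually.of_forall fun s => ?_)
  change coneLoss (0 + ∑ q, pointMat n t (cellMap p c (s q))) = _
  rw [coneLoss_sum_pointMat n t fun q => cellMap p c (s q), resLoss_pointsMat n ht]
  -- The offset of the cell cancels in all differences of points.
  congr 1
  ext i j
  simp [gramMat, cellMap]

theorem map_pi_pair {X : Type*} [MeasurableSpace X] {μ : Measure X} [IsProbabilityMeasure μ]
    {m : ℕ} {i j : Fin m} (hij : i ≠ j) :
    (Measure.pi fun _ : Fin m => μ).map (fun x => (x i, x j)) = μ.prod μ := by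
  have h := (ProbabilityTheory.iIndepFun_pi (μ := fun _ : Fin m => μ)
    (X := fun _ x => x) fun _ => aemeasurable_id).indepFun hij
  rw [ProbabilityTheory.indepFun_iff_map_prod_eq_prod_map_map
    (measurable_pi_apply i).aemeasurable (measurable_pi_apply j).aemeasurable] at h
  rw [h]
  exact congrArg₂ _ (measurePreserving_eval (fun _ : Fin m => μ) i).map_eq
    (measurePreserving_eval (fun _ : Fin m => μ) j).map_eq

/-- Columns are classified by the cell of their point; killing the points outside a cell is the same
as masking the columns outside the class. -/
theorem abs_resLoss_pointsMat_sub_sum_cells_le (n p : ℕ) [NeZero p] {t : ℝ} (ht : 0 ≤ t) {m : ℕ}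
    {x : Fin m → Fin d → ℝ} (hx : ∀ i, x i ∈ cube d) {δ : ℝ} (hδ : 0 < δ) :
    |resLoss (pointsMat n t x * (pointsMat n t x)ᴴ) -
      ∑ c : Fin d → Fin p, coneLoss (0 + ∑ i, (cell p c).indicator (pointMat n t) (x i))| ≤
        (δ * m + (∑ i, ∑ j, t ^ 2 * crossKernel n p (x i) (x j)) / δ) / 2 := by
  have h1 : ∀ c : Fin d → Fin p,
      coneLoss (0 + ∑ i, (cell p c).indicator (pointMat n t) (x i)) =
        resLoss (colMask (fun i => cellOf p (x i)) (pointsMat n t x) c *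
          (colMask (fun i => cellOf p (x i)) (pointsMat n t x) c)ᴴ) := by
    intro c
    rw [coneLoss, zero_add]
    congr 1
    ext k l
    rw [Matrix.of_apply, AddSubmonoid.coe_finsetSum, Finset.sum_apply, Finset.sum_apply,
      Matrix.mul_apply]
    refine Finset.sum_congr rfl fun i _ => ?_
    rw [Matrix.conjTranspose_apply, colMask, Matrix.of_apply, Matrix.of_apply]
    by_cases h : cellOf p (x i) = c
    · rw [indicator_of_mem ((mem_cell_iff (hx i) c).2 h), if_pos h, if_pos h]
      rfl
    · rw [indicator_of_notMem fun h' => h ((mem_cell_iff (hx i) c).1 h'), if_neg h, zero_mul]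
      rfl
  simp only [h1]
  refine (abs_resLoss_sub_sum_colMask_le (fun i => cellOf p (x i)) (pointsMat n t x) hδ).trans
    (le_of_eq ?_)
  rw [Fintype.card_fin]
  congr 3
  refine Finset.sum_congr rfl fun i _ => Finset.sum_congr rfl fun j _ => ?_
  rw [pointsMat_gram n ht, norm_sq_gramMat, crossKernel]
  split_ifs <;> simp

theorem integrable_crossKernel_pi (n p : ℕ) [NeZero p] {m : ℕ} (i j : Fin m) :
    Integrable (fun x : Fin m → Fin d → ℝ => crossKernel n p (x i) (x j))
      (Measure.pi fun _ : Fin m => μ) := by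
  have hpair : Measurable fun x : Fin m → Fin d → ℝ => (x i, x j) :=
    (measurable_pi_apply i).prodMk (measurable_pi_apply j)
  have : IsFiniteMeasure ((Measure.pi fun _ : Fin m => μ).map fun x => (x i, x j)) :=
    inferInstance
  have h := (integrable_crossKernel n p
    (μ := (Measure.pi fun _ : Fin m => μ).map fun x => (x i, x j))).comp_measurable hpair
  simp only [Function.comp_def] at h
  exact h

/-- For i ≠ j the two points are independent, with equality; for i = j the kernel vanishes, since a
point lies in its own cell. -/
theorem integral_crossKernel_pi_le (n p : ℕ) [NeZero p] {m : ℕ} (i j : Fin m) :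
    ∫ x, crossKernel n p (x i) (x j) ∂(Measure.pi fun _ : Fin m => μ) ≤
      ∫ x, ∫ y, crossKernel n p x y ∂μ ∂μ := by
  by_cases hij : i = j
  · subst hij
    have : 0 ≤ ∫ x, ∫ y, crossKernel n p x y ∂μ ∂μ :=
      integral_nonneg fun x => integral_nonneg fun y => crossKernel_nonneg n p x y
    simpa [crossKernel] using this
  · rw [← integral_prod _ (integrable_crossKernel n p), ← map_pi_pair hij, integral_map]
    · exact ((measurable_pi_apply i).prodMk (measurable_pi_apply j)).aemeasurable
    · exact (measurable_crossKernel n p).aestronglyMeasurable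

theorem integrable_coneLoss_sum_indicator (n p : ℕ) (t : ℝ) (m : ℕ) (c : Fin d → Fin p) :
    Integrable (fun x : Fin m → Fin d → ℝ =>
      coneLoss (0 + ∑ i, (cell p c).indicator (pointMat n t) (x i)))
        (Measure.pi fun _ : Fin m => μ) := by
  refine .of_bound (measurable_coneLoss.comp (measurable_const.add (Finset.measurable_sum _
    fun i _ => ((measurable_pointMat n t).indicator (measurableSet_cell p c)).comp
      (measurable_pi_apply i)))).aestronglyMeasurable _
        (Eventually.of_forall fun x => abs_coneLoss_le _)

/-- Decoupling of the cells: the expected loss is nearly the sum over the cells of the loss of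
the points inside of the cell. -/
theorem abs_meanLoss_sub_sum_indicator_le (n p : ℕ) [NeZero p] {t : ℝ} (ht : 0 ≤ t) (m : ℕ)
    (hμ : ∀ᵐ x ∂μ, x ∈ cube d) {K : ℝ} (hK : ∫ x, ∫ y, crossKernel n p x y ∂μ ∂μ ≤ K)
    {δ : ℝ} (hδ : 0 < δ) :
    |meanLoss n t μ m -
      ∑ c : Fin d → Fin p, iterAvg μ ((cell p c).indicator (pointMat n t)) coneLoss m 0| ≤
        (δ * m + t ^ 2 * m ^ 2 * K / δ) / 2 := by
  have hcell : ∀ᵐ x ∂(Measure.pi fun _ : Fin m => μ), ∀ i, x i ∈ cube d := by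
    rw [ae_all_iff]
    intro i
    exact (measurePreserving_eval (fun _ : Fin m => μ) i).quasiMeasurePreserving.ae hμ
  have hsumint : Integrable (fun x : Fin m → Fin d → ℝ =>
      ∑ i, ∑ j, t ^ 2 * crossKernel n p (x i) (x j)) (Measure.pi fun _ : Fin m => μ) :=
    integrable_finsetSum _ fun i _ => integrable_finsetSum _ fun j _ =>
      (integrable_crossKernel_pi n p i j).const_mul _
  have e1 : ∀ c : Fin d → Fin p,
      iterAvg μ ((cell p c).indicator (pointMat n t)) coneLoss m 0 =
        ∫ x : Fin m → Fin d → ℝ, coneLoss (0 + ∑ i, (cell p c).indicator (pointMat n t) (x i))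
          ∂(Measure.pi fun _ : Fin m => μ) := fun c =>
    iterAvg_eq_integral_pi ((measurable_pointMat n t).indicator (measurableSet_cell p c))
      measurable_coneLoss abs_coneLoss_le m 0
  have e2 : ∫ x : Fin m → Fin d → ℝ, (∑ i, ∑ j, t ^ 2 * crossKernel n p (x i) (x j))
      ∂(Measure.pi fun _ : Fin m => μ) ≤ t ^ 2 * m ^ 2 * K := by
    rw [integral_finsetSum _ fun i _ => integrable_finsetSum _ fun j _ =>
      (integrable_crossKernel_pi n p i j).const_mul _]
    calc _ ≤ ∑ _i : Fin m, ∑ _j : Fin m, t ^ 2 * K := by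
          refine Finset.sum_le_sum fun i _ => ?_
          rw [integral_finsetSum _ fun j _ => (integrable_crossKernel_pi n p i j).const_mul _]
          refine Finset.sum_le_sum fun j _ => ?_
          rw [integral_const_mul]
          exact mul_le_mul_of_nonneg_left ((integral_crossKernel_pi_le n p i j).trans hK)
            (sq_nonneg t)
      _ = t ^ 2 * m ^ 2 * K := by
          simp only [Finset.sum_const, Finset.card_univ, Fintype.card_fin, nsmul_eq_mul]
          ring
  rw [meanLoss_eq_integral, Finset.sum_congr rfl fun c _ => e1 c,
    ← integral_finsetSum _ fun c _ => integrable_coneLoss_sum_indicator n p t m c, ← integral_sub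
    (integrable_resLoss_pointsMat n t m)
    (integrable_finsetSum _ fun c _ => integrable_coneLoss_sum_indicator n p t m c)]
  refine (norm_integral_le_of_norm_le (f := fun x : Fin m → Fin d → ℝ =>
    resLoss (pointsMat n t x * (pointsMat n t x)ᴴ) - ∑ c : Fin d → Fin p,
      coneLoss (0 + ∑ i, (cell p c).indicator (pointMat n t) (x i)))
    (g := fun x : Fin m → Fin d → ℝ =>
    (δ * m + (∑ i, ∑ j, t ^ 2 * crossKernel n p (x i) (x j)) / δ) / 2)
    (((integrable_const (δ * m)).add (hsumint.div_const δ)).div_const 2)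
    (hcell.mono fun x hx => abs_resLoss_pointsMat_sub_sum_cells_le n p ht hx hδ)).trans ?_
  rw [integral_div, integral_add (integrable_const _) (hsumint.div_const _), integral_div,
    integral_const, probReal_univ, one_smul]
  gcongr

end Model

/-! ### Densities that are constant on cells -/

section Density

variable {d : ℕ}

/-- A probability density on the cube. -/
structure IsDensity (d : ℕ) (g : (Fin d → ℝ) → ℝ) : Prop where
  measurable : Measurable g
  nonneg : ∀ z ∈ cube d, 0 ≤ g z
  lintegral_eq_one : ∫⁻ z in cube d, ENNReal.ofReal (g z) = 1

variable {g : (Fin d → ℝ) → ℝ}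

theorem IsDensity.isProbabilityMeasure (hg : IsDensity d g) :
    IsProbabilityMeasure (pointLaw d g) :=
  ⟨by rw [pointLaw, withDensity_apply _ MeasurableSet.univ, Measure.restrict_univ,
    hg.lintegral_eq_one]⟩

theorem IsDensity.integrableOn (hg : IsDensity d g) : IntegrableOn g (cube d) := by
  refine ⟨hg.measurable.aestronglyMeasurable, ?_⟩
  rw [hasFiniteIntegral_iff_ofReal ((ae_restrict_mem measurableSet_cube).mono hg.nonneg),
    hg.lintegral_eq_one]
  exact ENNReal.one_lt_top

theorem IsDensity.integral_eq_one (hg : IsDensity d g) : ∫ z in cube d, g z = 1 := by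
  rw [integral_eq_lintegral_of_nonneg_ae ((ae_restrict_mem measurableSet_cube).mono hg.nonneg)
    hg.measurable.aestronglyMeasurable, hg.lintegral_eq_one, ENNReal.toReal_one]

theorem isDensity_of_integral_eq_one (hm : Measurable g) (h0 : ∀ z ∈ cube d, 0 ≤ g z)
    (hi : IntegrableOn g (cube d)) (h1 : ∫ z in cube d, g z = 1) : IsDensity d g :=
  ⟨hm, h0, by
    rw [← ofReal_integral_eq_lintegral_ofReal hi ((ae_restrict_mem measurableSet_cube).mono h0),
      h1, ENNReal.ofReal_one]⟩

theorem isDensity_one (d : ℕ) : IsDensity d fun _ => 1 :=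
  ⟨measurable_const, fun _ _ => zero_le_one, by simp⟩

theorem ae_pointLaw_mem_cube (d : ℕ) (g : (Fin d → ℝ) → ℝ) : ∀ᵐ x ∂(pointLaw d g), x ∈ cube d :=
  (withDensity_absolutelyContinuous _ _).ae_le (ae_restrict_mem measurableSet_cube)

theorem IsDensity.integral_pointLaw (hg : IsDensity d g) (h : (Fin d → ℝ) → ℝ) :
    ∫ x, h x ∂(pointLaw d g) = ∫ x in cube d, g x * h x := by
  rw [pointLaw, integral_withDensity_eq_integral_toReal_smul hg.measurable.ennreal_ofReal
    (Eventually.of_forall fun _ => ENNReal.ofReal_lt_top)]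
  refine setIntegral_congr_fun measurableSet_cube fun x hx => ?_
  simp only [smul_eq_mul, ENNReal.toReal_ofReal (hg.nonneg x hx)]

theorem IsDensity.integral_crossKernel_le (hg : IsDensity d g) {B : ℝ}
    (hB : ∀ z ∈ cube d, g z ≤ B) (n p : ℕ) [NeZero p] (hpn : p ≤ n) :
    ∫ x, ∫ y, crossKernel n p x y ∂(pointLaw d g) ∂(pointLaw d g) ≤
      B ^ 2 * ((n : ℝ) ^ d * (2 * d * √((p : ℝ) / n))) := by
  have hcross : ∀ x, Integrable (fun y => crossKernel n p x y) (volume.restrict (cube d)) :=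
    fun x => .of_bound ((measurable_crossKernel n p).of_uncurry_left).aestronglyMeasurable
      (((n : ℝ) ^ 2) ^ d) (Eventually.of_forall fun y => by
        rw [Real.norm_eq_abs, abs_of_nonneg (crossKernel_nonneg n p _ _)]
        exact crossKernel_le n p _ _)
  have hB0 : 0 ≤ B := by
    have : (fun _ => -1 / 2 : Fin d → ℝ) ∈ cube d := fun _ _ => by norm_num
    exact (hg.nonneg _ this).trans (hB _ this)
  have h1 : ∀ x, ∫ y, crossKernel n p x y ∂(pointLaw d g) ≤
      B * ∫ y in cube d, crossKernel n p x y := by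
    intro x
    rw [hg.integral_pointLaw, ← integral_const_mul]
    refine integral_mono_of_nonneg ((ae_restrict_mem measurableSet_cube).mono fun y hy =>
      mul_nonneg (hg.nonneg y hy) (crossKernel_nonneg n p _ _)) ((hcross x).const_mul _)
      ((ae_restrict_mem measurableSet_cube).mono fun y hy => ?_)
    exact mul_le_mul_of_nonneg_right (hB y hy) (crossKernel_nonneg n p _ _)
  have h0 : ∀ x, 0 ≤ ∫ y, crossKernel n p x y ∂(pointLaw d g) := fun x =>
    integral_nonneg fun y => crossKernel_nonneg n p x y
  have h2 : Integrable (fun x => ∫ y in cube d, crossKernel n p x y) (volume.restrict (cube d)) :=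
    (integrable_crossKernel n p (μ := (volume.restrict (cube d)).prod
      (volume.restrict (cube d)))).integral_prod_left
  calc ∫ x, ∫ y, crossKernel n p x y ∂(pointLaw d g) ∂(pointLaw d g)
      ≤ ∫ x in cube d, B * (B * ∫ y in cube d, crossKernel n p x y) := by
        rw [hg.integral_pointLaw]
        refine integral_mono_of_nonneg ((ae_restrict_mem measurableSet_cube).mono fun x hx =>
          mul_nonneg (hg.nonneg x hx) (h0 x)) ((h2.const_mul _).const_mul _)
          ((ae_restrict_mem measurableSet_cube).mono fun x hx => ?_)
        exact mul_le_mul (hB x hx) (h1 x) (h0 x) hB0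
    _ = B ^ 2 * ∫ x in cube d, ∫ y in cube d, crossKernel n p x y := by
        rw [integral_const_mul, integral_const_mul]; ring
    _ ≤ _ := mul_le_mul_of_nonneg_left (VandermondeField.integral_crossKernel_le n p hpn)
        (sq_nonneg B)

/-- The function with the value `v c` on the cell with index `c`. -/
def stepFun (p : ℕ) [NeZero p] (v : (Fin d → Fin p) → ℝ) (z : Fin d → ℝ) : ℝ := v (cellOf p z)

theorem measurable_stepFun (p : ℕ) [NeZero p] (v : (Fin d → Fin p) → ℝ) :
    Measurable (stepFun p v) :=
  (measurable_of_countable v).comp (measurable_cellOf p)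

theorem stepFun_of_mem {p : ℕ} [NeZero p] (v : (Fin d → Fin p) → ℝ) {c : Fin d → Fin p}
    {z : Fin d → ℝ} (hz : z ∈ cell p c) : stepFun p v z = v c := by
  rw [stepFun, (mem_cell_iff (cell_subset_cube p c hz) c).1 hz]

theorem iUnion_cell (p : ℕ) [NeZero p] : ⋃ c : Fin d → Fin p, cell p c = cube d := by
  refine Subset.antisymm (iUnion_subset fun c => cell_subset_cube p c) fun x hx => ?_
  exact mem_iUnion.2 ⟨cellOf p x, (mem_cell_iff hx _).2 rfl⟩

theorem pairwise_disjoint_cell (p : ℕ) [NeZero p] :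
    Pairwise (Function.onFun Disjoint fun c : Fin d → Fin p => cell p c) := by
  intro c c' hcc
  refine disjoint_left.2 fun x hx hx' => hcc ?_
  rw [← (mem_cell_iff (cell_subset_cube p c hx) c).1 hx,
    (mem_cell_iff (cell_subset_cube p c' hx') c').1 hx']

theorem integral_cube_eq_sum (p : ℕ) [NeZero p] {h : (Fin d → ℝ) → ℝ}
    (hh : IntegrableOn h (cube d)) :
    ∫ z in cube d, h z = ∑ c : Fin d → Fin p, ∫ z in cell p c, h z := by
  rw [← iUnion_cell p, integral_iUnion_fintype (measurableSet_cell p) (pairwise_disjoint_cell p)]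
  exact fun c => hh.mono_set (cell_subset_cube p c)

theorem measureReal_cell (p : ℕ) [NeZero p] (c : Fin d → Fin p) :
    volume.real (cell p c) = 1 / (p : ℝ) ^ d := by
  rw [Measure.real, volume_cell, ENNReal.toReal_ofReal (by positivity)]

theorem integrableOn_stepFun (p : ℕ) [NeZero p] (v : (Fin d → Fin p) → ℝ) :
    IntegrableOn (stepFun p v) (cube d) :=
  .of_bound (by rw [volume_cube]; exact ENNReal.one_lt_top)
    (measurable_stepFun p v).aestronglyMeasurable
    (∑ c, |v c|) (Eventually.of_forall fun z =>
      Finset.single_le_sum (f := fun c => |v c|) (fun c _ => abs_nonneg _) (Finset.mem_univ _))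

theorem integral_stepFun (p : ℕ) [NeZero p] (v : (Fin d → Fin p) → ℝ) :
    ∫ z in cube d, stepFun p v z = ∑ c, v c / (p : ℝ) ^ d := by
  rw [integral_cube_eq_sum p (integrableOn_stepFun p v)]
  refine Finset.sum_congr rfl fun c _ => ?_
  rw [setIntegral_congr_fun (measurableSet_cell p c) fun z hz => stepFun_of_mem v hz,
    setIntegral_const, measureReal_cell, smul_eq_mul]
  ring

/-- This is the hypothesis of `abs_iterAvg_indicator_sub_le` for a cell: hitting probability v c /
p^d and uniform conditional law. -/
theorem pointLaw_stepFun_restrict (p : ℕ) [NeZero p] (v : (Fin d → Fin p) → ℝ)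
    (hv : ∀ c, 0 ≤ v c) (c : Fin d → Fin p) :
    (pointLaw d (stepFun p v)).restrict (cell p c) =
      ENNReal.ofReal (v c / (p : ℝ) ^ d) • cellLaw p c := by
  rw [pointLaw, restrict_withDensity (measurableSet_cell p c),
    Measure.restrict_restrict (measurableSet_cell p c),
    inter_eq_self_of_subset_left (cell_subset_cube p c)]
  have : (fun z => ENNReal.ofReal (stepFun p v z)) =ᵐ[volume.restrict (cell p c)]
      fun _ => ENNReal.ofReal (v c) :=
    (ae_restrict_mem (measurableSet_cell p c)).mono fun z hz => by
      simp only [stepFun_of_mem v hz]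
  rw [withDensity_congr_ae this, withDensity_const, restrict_cell, smul_smul,
    ← ENNReal.ofReal_mul (hv c), mul_one_div]

/-- The expected loss of `k` independent uniform points in a cell. -/
def cellLoss (d n : ℕ) (t : ℝ) (p k : ℕ) : ℝ :=
  ∫ s, resLoss (gramMat n t fun q => (p : ℝ)⁻¹ • s q)
    ∂(Measure.pi fun _ : Fin k => volume.restrict (unitCube d))

/-- Quantitative decoupling for a density that is constant on the cells. -/
theorem abs_meanLoss_stepFun_sub_le (hd : 1 ≤ d) {n p : ℕ} [NeZero p] (hpn : p ≤ n) {t : ℝ}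
    (ht : 0 ≤ t) {v : (Fin d → Fin p) → ℝ} (hv : ∀ c, 0 ≤ v c) {B : ℝ} (hB : ∀ c, v c ≤ B)
    (hdens : IsDensity d (stepFun p v)) (m : ℕ) (k : (Fin d → Fin p) → ℕ)
    (hk : ∀ c, |m * (v c / (p : ℝ) ^ d) - k c| ≤ 2) :
    |meanLoss n t (pointLaw d (stepFun p v)) m - ∑ c, cellLoss d n t p (k c)| ≤
      (n : ℝ) ^ d * ((m / (n : ℝ) ^ d + d * (t * (n : ℝ) ^ d) ^ 2 * (m / (n : ℝ) ^ d) ^ 2 * B ^ 2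
        + 3) * √√((p : ℝ) / n)) := by
  have hp : (0 : ℝ) < p := by exact_mod_cast Nat.pos_of_ne_zero (NeZero.ne p)
  have hpn' : (p : ℝ) ≤ n := by exact_mod_cast hpn
  have hn : (0 : ℝ) < n := hp.trans_le hpn'
  have := hdens.isProbabilityMeasure
  set N := (n : ℝ) ^ d with hN
  have hN0 : 0 < N := by positivity
  -- The weight is ρ = (p / n)^(1/4). Decoupling with δ = ρ costs O(N ρ), as the kernel mass across
  -- cells is O(N ρ²). Counting with δ = 1 / ρ in every cell costs p^d / ρ plus O(m ρ), up to
  -- constants, and p^d ≤ N ρ⁴.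
  set ρ := √√((p : ℝ) / n) with hρ
  have hρ0 : 0 < ρ := Real.sqrt_pos.2 (Real.sqrt_pos.2 (by positivity))
  have hρ2 : ρ ^ 2 = √((p : ℝ) / n) := Real.sq_sqrt (Real.sqrt_nonneg _)
  have hρ4 : ρ ^ 4 = p / n := by
    rw [show ρ ^ 4 = (ρ ^ 2) ^ 2 by ring, hρ2, Real.sq_sqrt (by positivity)]
  have hρ1 : ρ ≤ 1 := by
    rw [← pow_le_one_iff_of_nonneg hρ0.le (n := 4) (by norm_num), hρ4]
    exact (div_le_one hn).2 hpn'
  -- Here d ≥ 1 is needed: (p / n)^d ≤ p / n.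
  have hpd : (p : ℝ) ^ d ≤ N * ρ ^ 4 := by
    rw [hρ4]
    have h1 : ((p : ℝ) / n) ^ d ≤ p / n := by
      have := pow_le_pow_of_le_one (by positivity : (0 : ℝ) ≤ p / n) ((div_le_one hn).2 hpn') hd
      simpa using this
    have h2 : (p : ℝ) ^ d = N * ((p : ℝ) / n) ^ d := by rw [hN, div_pow]; field_simp
    rw [h2]
    exact mul_le_mul_of_nonneg_left h1 hN0.le
  have hsum : ∑ c, v c / (p : ℝ) ^ d = 1 := by
    rw [← integral_stepFun, hdens.integral_eq_one]
  have h1 := abs_meanLoss_sub_sum_indicator_le n p ht m (ae_pointLaw_mem_cube d (stepFun p v))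
    (hdens.integral_crossKernel_le (fun z _ => hB _) n p hpn) hρ0
  have h2 : ∀ c, |iterAvg (pointLaw d (stepFun p v)) ((cell p c).indicator (pointMat n t))
      coneLoss m 0 - cellLoss d n t p (k c)| ≤
        (1 / ρ + (m * (v c / (p : ℝ) ^ d) + 4) / (1 / ρ)) / 2 := by
    intro c
    have h3 := abs_iterAvg_indicator_sub_le (μ := pointLaw d (stepFun p v)) (ν := cellLaw p c)
      (measurable_pointMat n t) measurable_coneLoss abs_coneLoss_le (coneLoss_add_pointMat n t)
      (measurableSet_cell p c) (div_nonneg (hv c) (by positivity))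
      (pointLaw_stepFun_restrict p v hv c) m (k c) 0 (one_div_pos.2 hρ0)
    have h4 : iterAvg (cellLaw p c) (pointMat n t) coneLoss (k c) 0 = cellLoss d n t p (k c) :=
      meanLoss_cellLaw n ht p c (k c)
    rw [h4] at h3
    refine h3.trans ?_
    have h5 : (m * (v c / (p : ℝ) ^ d) - k c) ^ 2 ≤ 4 := by
      rw [← sq_abs]
      nlinarith [hk c, abs_nonneg (m * (v c / (p : ℝ) ^ d) - k c)]
    gcongr
  have h6 : |∑ c, iterAvg (pointLaw d (stepFun p v)) ((cell p c).indicator (pointMat n t))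
      coneLoss m 0 - ∑ c, cellLoss d n t p (k c)| ≤
        ((p : ℝ) ^ d * (1 / ρ + 4 * ρ) + m * ρ) / 2 := by
    rw [← Finset.sum_sub_distrib]
    refine (Finset.abs_sum_le_sum_abs _ _).trans ((Finset.sum_le_sum fun c _ => h2 c).trans
      (le_of_eq ?_))
    have e : ∀ c, (1 / ρ + (m * (v c / (p : ℝ) ^ d) + 4) / (1 / ρ)) / 2 =
        (1 / ρ + 4 * ρ) / 2 + m * ρ / 2 * (v c / (p : ℝ) ^ d) := by
      intro c; field_simp; ring
    simp only [e]
    rw [Finset.sum_add_distrib, ← Finset.mul_sum, hsum]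
    simp
    ring
  refine (abs_sub_le _ _ _).trans ((add_le_add h1 h6).trans ?_)
  rw [← hρ2]
  have e1 : (ρ * m + t ^ 2 * m ^ 2 * (B ^ 2 * (N * (2 * d * ρ ^ 2))) / ρ) / 2 =
      N * ((m / N / 2 + d * (t * N) ^ 2 * (m / N) ^ 2 * B ^ 2) * ρ) := by
    field_simp
  have e2 : (p : ℝ) ^ d * (1 / ρ + 4 * ρ) ≤ N * (5 * ρ) := by
    have h7 : (p : ℝ) ^ d * (1 / ρ + 4 * ρ) ≤ N * ρ ^ 4 * (1 / ρ + 4 * ρ) := by gcongr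
    have h8 : N * ρ ^ 4 * (1 / ρ + 4 * ρ) = N * (ρ * (ρ ^ 2 + 4 * ρ ^ 4)) := by field_simp
    have h9 : ρ ^ 2 ≤ 1 := pow_le_one₀ hρ0.le hρ1
    have h10 : ρ ^ 4 ≤ 1 := pow_le_one₀ hρ0.le hρ1
    rw [h8] at h7
    refine h7.trans (mul_le_mul_of_nonneg_left ?_ hN0.le)
    nlinarith
  have e3 : m * ρ = N * (m / N * ρ) := by field_simp
  rw [e1]
  have e4 : 0 ≤ N * ρ := by positivity
  linarith

theorem abs_meanLoss_uniform_sub_le (hd : 1 ≤ d) {n p : ℕ} [NeZero p] (hpn : p ≤ n) {t : ℝ}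
    (ht : 0 ≤ t) (m k : ℕ) (hk : |m / (p : ℝ) ^ d - k| ≤ 2) :
    |meanLoss n t (pointLaw d fun _ => 1) m - (p : ℝ) ^ d * cellLoss d n t p k| ≤
      (n : ℝ) ^ d * ((m / (n : ℝ) ^ d + d * (t * (n : ℝ) ^ d) ^ 2 * (m / (n : ℝ) ^ d) ^ 2 + 3) *
        √√((p : ℝ) / n)) := by
  have h := abs_meanLoss_stepFun_sub_le hd hpn ht (v := fun _ => 1) (fun _ => zero_le_one)
    (B := 1) (fun _ => le_rfl) (isDensity_one d) m (fun _ => k)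
    (fun c => by rw [mul_one_div]; exact hk)
  have e : ∑ _c : Fin d → Fin p, cellLoss d n t p k = (p : ℝ) ^ d * cellLoss d n t p k := by
    simp
  rw [e, one_pow, mul_one] at h
  exact h

end Density

/-! ### The limit of the loss of a cell at the scale 1 / n -/

section CellLimit

/-- All frequencies are below n, so the normalized kernel is Lipschitz in the rescaled variable n x,
uniformly in n. -/
theorem norm_dirichlet_sub_le (n : ℕ) (x y : ℝ) :
    ‖dirichlet n x - dirichlet n y‖ ≤ n * (2 * Real.pi * |n * x - n * y|) := by
  have hp := Real.pi_pos
  have h : ∀ l ∈ Finset.range n, ‖Complex.exp (Complex.I * ((2 * Real.pi * l * x : ℝ) : ℂ)) -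
      Complex.exp (Complex.I * ((2 * Real.pi * l * y : ℝ) : ℂ))‖ ≤
        2 * Real.pi * |n * x - n * y| := by
    intro l hl
    have e : Complex.exp (Complex.I * ((2 * Real.pi * l * x : ℝ) : ℂ)) -
        Complex.exp (Complex.I * ((2 * Real.pi * l * y : ℝ) : ℂ)) =
        Complex.exp (((2 * Real.pi * l * y : ℝ) : ℂ) * Complex.I) *
          (Complex.exp (Complex.I * ((2 * Real.pi * l * (x - y) : ℝ) : ℂ)) - 1) := by
      rw [mul_sub, mul_one, ← Complex.exp_add]
      congr 2 <;> · push_cast; ring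
    rw [e, norm_mul, Complex.norm_exp_ofReal_mul_I, one_mul]
    refine Real.norm_exp_I_mul_ofReal_sub_one_le.trans ?_
    have hl' : (l : ℝ) ≤ n := by exact_mod_cast (Finset.mem_range.1 hl).le
    rw [← mul_sub, Real.norm_eq_abs, abs_mul, abs_mul, abs_mul, abs_mul, abs_two,
      abs_of_pos hp, Nat.abs_cast, Nat.abs_cast, mul_assoc]
    gcongr
  rw [dirichlet, dirichlet, ← Finset.sum_sub_distrib]
  refine (norm_sum_le _ _).trans ((Finset.sum_le_sum h).trans ?_)
  simp

/-- With w = 2 π i θ ≠ 0 the geometric sum gives (exp w - 1) / (n (exp (w / n) - 1)), and the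
denominator tends to w, the derivative of exp (w h) at h = 0. -/
theorem exists_tendsto_dirichlet_div_fixed (θ : ℝ) :
    ∃ z : ℂ, Tendsto (fun n : ℕ => dirichlet n (θ / n) / n) atTop (𝓝 z) := by
  by_cases hθ : θ = 0
  · refine ⟨1, tendsto_const_nhds.congr' ?_⟩
    filter_upwards [eventually_gt_atTop 0] with n hn
    have : (n : ℂ) ≠ 0 := by exact_mod_cast hn.ne'
    rw [hθ, zero_div, dirichlet_zero, div_self this]
  · set w : ℂ := Complex.I * ((2 * Real.pi * θ : ℝ) : ℂ) with hw
    have hw0 : w ≠ 0 := by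
      simp [hw, hθ, Real.pi_ne_zero]
    have hder : HasDerivAt (fun h : ℝ => Complex.exp (w * h)) w 0 := by
      have := ((Complex.ofRealCLM.hasDerivAt (x := (0 : ℝ))).const_mul w).cexp
      simpa using this
    have hinv : Tendsto (fun n : ℕ => ((n : ℝ))⁻¹) atTop (𝓝[≠] 0) :=
      tendsto_nhdsWithin_iff.2 ⟨tendsto_inv_atTop_nhds_zero_nat, by
        filter_upwards [eventually_gt_atTop 0] with n hn
        have : (n : ℝ) ≠ 0 := by exact_mod_cast hn.ne'
        simpa using this⟩
    have h1 := hder.tendsto_slope_zero.comp hinv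
    have h2 : Tendsto (fun n : ℕ => (n : ℂ) * (Complex.exp (w / n) - 1)) atTop (𝓝 w) := by
      refine h1.congr fun n => ?_
      simp [div_eq_mul_inv]
    refine ⟨(Complex.exp w - 1) / w, (tendsto_const_nhds.div h2 hw0).congr' ?_⟩
    filter_upwards [eventually_gt_atTop 0, h2.eventually_ne hw0] with n hn hne
    have hn' : (n : ℂ) ≠ 0 := by exact_mod_cast hn.ne'
    have hz : Complex.exp (w / n) - 1 ≠ 0 := fun h => hne (by rw [h, mul_zero])
    have e1 : dirichlet n (θ / n) = ∑ l ∈ Finset.range n, Complex.exp (w / n) ^ l := by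
      refine Finset.sum_congr rfl fun l _ => ?_
      rw [← Complex.exp_nat_mul, hw]
      congr 1
      push_cast
      field_simp
    have e2 := geom_sum_mul (Complex.exp (w / n)) n
    rw [← e1, ← Complex.exp_nat_mul, mul_div_cancel₀ _ hn'] at e2
    rw [← e2, Pi.div_apply]
    field_simp

/-- At the scale `1 / n` the normalized Dirichlet kernel has a limit. -/
theorem exists_tendsto_dirichlet_div : ∃ E : ℝ → ℂ, ∀ (θ : ℝ) (x : ℕ → ℝ),
    Tendsto (fun n => n * x n) atTop (𝓝 θ) →
      Tendsto (fun n => dirichlet n (x n) / n) atTop (𝓝 (E θ)) := by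
  choose E hE using exists_tendsto_dirichlet_div_fixed
  refine ⟨E, fun θ x hx => ?_⟩
  have hd : Tendsto (fun n : ℕ => dirichlet n (x n) / n - dirichlet n (θ / n) / n) atTop (𝓝 0) := by
    have h0 : Tendsto (fun n : ℕ => 2 * Real.pi * |n * x n - θ|) atTop (𝓝 0) := by
      have := ((hx.sub_const θ).abs).const_mul (2 * Real.pi)
      simpa using this
    refine squeeze_zero_norm' ?_ h0
    filter_upwards [eventually_gt_atTop 0] with n hn
    have hn' : (0 : ℝ) < n := by exact_mod_cast hn
    rw [← sub_div, norm_div, Complex.norm_natCast, div_le_iff₀ hn']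
    have := norm_dirichlet_sub_le n (x n) (θ / n)
    rw [mul_div_cancel₀ _ hn'.ne'] at this
    linarith
  simpa using hd.add (hE θ)

theorem tendsto_natDiv_div (L : ℕ) :
    Tendsto (fun n : ℕ => ((n / L : ℕ) : ℝ) / n) atTop (𝓝 (1 / L)) := by
  have h := (tendsto_nat_floor_mul_div_atTop (R := ℝ) (a := 1 / L) (by positivity)).comp
    tendsto_natCast_atTop_atTop
  refine h.congr fun n => ?_
  simp only [Function.comp]
  rw [one_div_mul_eq_div, Nat.floor_div_eq_div]

variable {d : ℕ}

/-- The expected loss of `k` uniform points in a cell of `L^d` lattice volumes converges. -/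
theorem exists_tendsto_cellLoss {τ : ℝ} (hτ : 0 ≤ τ) {L : ℕ} (hL : 0 < L) (k : ℕ) :
    ∃ h : ℝ, Tendsto (fun n : ℕ => cellLoss d n (τ / (n : ℝ) ^ d) (n / L) k) atTop (𝓝 h) := by
  obtain ⟨E, hE⟩ := exists_tendsto_dirichlet_div
  have hL' : (0 : ℝ) < L := by exact_mod_cast hL
  have hx : ∀ s : ℝ, Tendsto (fun n : ℕ => (n : ℝ) * (((n / L : ℕ) : ℝ)⁻¹ * s)) atTop
      (𝓝 (L * s)) := by
    intro s
    have h := ((tendsto_natDiv_div L).inv₀ (by positivity)).mul_const s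
    rw [one_div, inv_inv] at h
    refine h.congr fun n => ?_
    rw [inv_div]; ring
  have hG : ∀ s : Fin k → Fin d → ℝ, Tendsto
      (fun n : ℕ => gramMat n (τ / (n : ℝ) ^ d) fun q => ((n / L : ℕ) : ℝ)⁻¹ • s q) atTop
        (𝓝 (Matrix.of fun i j => (τ : ℂ) * ∏ a, E (L * (s i a - s j a)))) := by
    intro s
    refine tendsto_pi_nhds.2 fun i => tendsto_pi_nhds.2 fun j => ?_
    have h1 : Tendsto (fun n : ℕ => (τ : ℂ) * ∏ a,
        (dirichlet n (((n / L : ℕ) : ℝ)⁻¹ * (s i a - s j a)) / n)) atTop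
          (𝓝 ((τ : ℂ) * ∏ a, E (L * (s i a - s j a)))) :=
      (tendsto_finsetProd _ fun a _ => hE _ _ (hx (s i a - s j a))).const_mul _
    refine h1.congr fun n => ?_
    simp only [gramMat, Matrix.of_apply, Finset.prod_div_distrib, Pi.smul_apply, smul_eq_mul,
      ← mul_sub]
    simp
    ring
  -- Positive semidefiniteness survives the limit and makes the loss continuous at the limiting Gram
  -- matrix.
  have hpsd : ∀ s : Fin k → Fin d → ℝ,
      (Matrix.of fun i j => (τ : ℂ) * ∏ a, E (L * (s i a - s j a))).PosSemidef := by
    intro s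
    have hn := fun n : ℕ => posSemidef_gramMat n (t := τ / (n : ℝ) ^ d) (by positivity)
      fun q => ((n / L : ℕ) : ℝ)⁻¹ • s q
    refine Matrix.PosSemidef.of_dotProduct_mulVec_nonneg ?_ fun v => ?_
    · refine tendsto_nhds_unique ?_ (hG s)
      have := (Continuous.matrix_conjTranspose continuous_id).tendsto _ |>.comp (hG s)
      refine this.congr fun n => ?_
      exact (hn n).1
    · have hc : Continuous fun S : Matrix (Fin k) (Fin k) ℂ => star v ⬝ᵥ S *ᵥ v := by fun_prop
      have := Complex.orderClosedTopology
      exact ge_of_tendsto' ((hc.tendsto _).comp (hG s)) fun n =>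
        (hn n).dotProduct_mulVec_nonneg v
  -- The Gram matrix has size k, so its loss is dominated by k whatever n is.
  refine ⟨_, tendsto_integral_of_dominated_convergence (fun _ => (k : ℝ)) (fun n => ?_)
    (integrable_const _) (fun n => Eventually.of_forall fun s => ?_)
    (Eventually.of_forall fun s => tendsto_resLoss (hpsd s) (hG s))⟩
  · have hc : Continuous fun s : Fin k → Fin d → ℝ =>
        (fun i j => gramMat n (τ / (n : ℝ) ^ d) (fun q => ((n / L : ℕ) : ℝ)⁻¹ • s q) i j :
          Fin k → Fin k → ℂ) := by
      refine continuous_pi fun i => continuous_pi fun j => ?_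
      simp only [gramMat, Matrix.of_apply]
      refine continuous_const.mul (continuous_finsetProd _ fun a _ => ?_)
      exact (continuous_dirichlet n).comp (by fun_prop)
    exact (measurable_resLoss.comp hc.measurable).aestronglyMeasurable
  · have hp := posSemidef_gramMat n (t := τ / (n : ℝ) ^ d) (by positivity)
      fun q => ((n / L : ℕ) : ℝ)⁻¹ • s q
    rw [Real.norm_eq_abs, abs_of_nonneg (resLoss_nonneg hp)]
    simpa using resLoss_le_card hp

end CellLimit

/-! ### Existence and regularity of the limit for uniform points -/

section UniformLimit

variable {d : ℕ}

/-- The expected loss per dimension of `m` uniform points, `m ∼ u n^d`, with the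
coefficient `τ / n^d`. -/
def uniSeq (d : ℕ) (τ u : ℝ) (n : ℕ) : ℝ :=
  meanLoss n (τ / (n : ℝ) ^ d) (pointLaw d fun _ => 1) ⌊u * (n : ℝ) ^ d⌋₊ / (n : ℝ) ^ d

theorem tendsto_floor_mul_pow_div (hd : 1 ≤ d) {u : ℝ} (hu : 0 ≤ u) :
    Tendsto (fun n : ℕ => (⌊u * (n : ℝ) ^ d⌋₊ : ℝ) / (n : ℝ) ^ d) atTop (𝓝 u) :=
  (tendsto_nat_floor_mul_div_atTop hu).comp
    ((tendsto_pow_atTop (by omega)).comp tendsto_natCast_atTop_atTop)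

/-- For fixed L, the n / L cells per axis hold about u L^d points each, a number independent of n,
so the sum over cells converges. The decoupling error is at most K L^(-1/4) for all large n. -/
theorem eventually_abs_uniSeq_sub_le (hd : 1 ≤ d) {τ u : ℝ} (hτ : 0 ≤ τ) (hu : 0 ≤ u) {ε : ℝ}
    (hε : 0 < ε) : ∃ b : ℝ, ∀ᶠ n in atTop, |uniSeq d τ u n - b| ≤ ε := by
  set K := u + d * τ ^ 2 * u ^ 2 + 3 with hK
  have hK0 : 0 < K := by positivity
  obtain ⟨L, hL0, hL⟩ : ∃ L : ℕ, 0 < L ∧ K * √√(1 / (L : ℝ)) ≤ ε / 2 := by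
    have h1 : Tendsto (fun L : ℕ => K * √√(1 / (L : ℝ))) atTop (𝓝 0) := by
      have h2 := (Real.continuous_sqrt.tendsto _).comp ((Real.continuous_sqrt.tendsto _).comp
        (tendsto_one_div_atTop_nhds_zero_nat (𝕜 := ℝ)))
      have h3 := h2.const_mul K
      simp only [Real.sqrt_zero, mul_zero] at h3
      exact h3
    obtain ⟨L, h⟩ := ((eventually_gt_atTop 0).and
      (h1.eventually_le_const (half_pos hε))).exists
    exact ⟨L, h⟩
  have hL' : (0 : ℝ) < L := by exact_mod_cast hL0
  set k := ⌊u * (L : ℝ) ^ d⌋₊ with hk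
  obtain ⟨h, hh⟩ := exists_tendsto_cellLoss (d := d) hτ hL0 k
  have hp := tendsto_natDiv_div L
  have hb := (hp.pow d).mul hh
  refine ⟨(1 / (L : ℝ)) ^ d * h, ?_⟩
  have hm : Tendsto (fun n : ℕ => (⌊u * (n : ℝ) ^ d⌋₊ : ℝ) / ((n / L : ℕ) : ℝ) ^ d) atTop
      (𝓝 (u * (L : ℝ) ^ d)) := by
    have h1 := (tendsto_floor_mul_pow_div hd hu).mul ((hp.inv₀ (by positivity)).pow d)
    rw [one_div, inv_inv] at h1
    refine h1.congr' ?_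
    filter_upwards [eventually_gt_atTop 0] with n hn
    have hn' : (n : ℝ) ≠ 0 := by exact_mod_cast hn.ne'
    rw [inv_div, div_pow]
    field_simp
  -- Rounding costs less than 1 in the limit. The bound 2 leaves room for the finite-n ratio, which
  -- only tends to u L^d.
  have hk1 : |u * (L : ℝ) ^ d - k| < 2 := by
    have h1 := Nat.floor_le (by positivity : 0 ≤ u * (L : ℝ) ^ d)
    have h2 := Nat.lt_floor_add_one (u * (L : ℝ) ^ d)
    rw [abs_lt]
    constructor <;> linarith
  filter_upwards [eventually_ge_atTop L, eventually_gt_atTop 0,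
    ((hm.sub_const (k : ℝ)).abs).eventually_le_const hk1,
    (hb.sub_const ((1 / (L : ℝ)) ^ d * h)).abs.eventually_le_const (u := ε / 2)
      (by simpa using half_pos hε)] with n hnL hn0 hkn hbn
  have hn : (0 : ℝ) < n := by exact_mod_cast hn0
  have : NeZero (n / L) := ⟨(Nat.div_pos hnL hL0).ne'⟩
  have hmain := abs_meanLoss_uniform_sub_le hd (Nat.div_le_self n L)
    (t := τ / (n : ℝ) ^ d) (by positivity) ⌊u * (n : ℝ) ^ d⌋₊ k hkn
  have hN : (0 : ℝ) < (n : ℝ) ^ d := by positivity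
  have hτn : τ / (n : ℝ) ^ d * (n : ℝ) ^ d = τ := by field_simp
  have hun : (⌊u * (n : ℝ) ^ d⌋₊ : ℝ) / (n : ℝ) ^ d ≤ u := by
    rw [div_le_iff₀ hN]
    exact Nat.floor_le (by positivity)
  have hpL : ((n / L : ℕ) : ℝ) / n ≤ 1 / L := by
    rw [div_le_div_iff₀ hn hL', one_mul]
    exact_mod_cast Nat.div_mul_le_self n L
  rw [hτn] at hmain
  have h1 : |uniSeq d τ u n - (((n / L : ℕ) : ℝ) / n) ^ d *
      cellLoss d n (τ / (n : ℝ) ^ d) (n / L) k| ≤ ε / 2 := by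
    have e : uniSeq d τ u n - (((n / L : ℕ) : ℝ) / n) ^ d *
        cellLoss d n (τ / (n : ℝ) ^ d) (n / L) k =
        (meanLoss n (τ / (n : ℝ) ^ d) (pointLaw d fun _ => 1) ⌊u * (n : ℝ) ^ d⌋₊ -
          ((n / L : ℕ) : ℝ) ^ d * cellLoss d n (τ / (n : ℝ) ^ d) (n / L) k) / (n : ℝ) ^ d := by
      rw [uniSeq, div_pow]; field_simp
    rw [e, abs_div, abs_of_pos hN, div_le_iff₀ hN]
    refine hmain.trans ?_
    rw [mul_comm]
    refine mul_le_mul_of_nonneg_right (le_trans (mul_le_mul ?_ ?_ (Real.sqrt_nonneg _) hK0.le) hL)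
      hN.le
    · rw [hK]; gcongr
    · exact Real.sqrt_le_sqrt (Real.sqrt_le_sqrt hpL)
  calc |uniSeq d τ u n - (1 / (L : ℝ)) ^ d * h| ≤ ε / 2 + ε / 2 :=
        (abs_sub_le _ _ _).trans (add_le_add h1 hbn)
    _ = ε := add_halves ε

/-- The asymptotic loss per dimension of uniform points of density `u`. -/
def uniLimit (d : ℕ) (τ u : ℝ) : ℝ := limUnder atTop (uniSeq d τ u)

/-- The sequence eventually stays within any ε of some number, hence is Cauchy; the limit need not
be identified. -/
theorem tendsto_uniSeq (hd : 1 ≤ d) {τ u : ℝ} (hτ : 0 ≤ τ) (hu : 0 ≤ u) :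
    Tendsto (uniSeq d τ u) atTop (𝓝 (uniLimit d τ u)) := by
  have hc : CauchySeq (uniSeq d τ u) := by
    refine Metric.cauchySeq_iff.2 fun ε hε => ?_
    obtain ⟨b, hb⟩ := eventually_abs_uniSeq_sub_le hd hτ hu (by positivity : 0 < ε / 3)
    obtain ⟨N, hN⟩ := eventually_atTop.1 hb
    refine ⟨N, fun i hi j hj => ?_⟩
    have h1 := hN i hi
    have h2 := hN j hj
    rw [abs_sub_comm] at h2
    rw [Real.dist_eq]
    have := abs_sub_le (uniSeq d τ u i) b (uniSeq d τ u j)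
    linarith
  exact tendsto_nhds_limUnder (cauchySeq_tendsto_of_complete hc)

theorem uniLimit_zero (hd : 1 ≤ d) {τ : ℝ} (hτ : 0 ≤ τ) : uniLimit d τ 0 = 0 := by
  refine tendsto_nhds_unique (tendsto_uniSeq hd hτ le_rfl) (tendsto_const_nhds.congr fun n => ?_)
  simp [uniSeq, meanLoss_zero]

instance isProbabilityMeasure_uniform (d : ℕ) :
    IsProbabilityMeasure (pointLaw d fun _ => 1) :=
  (isDensity_one d).isProbabilityMeasure

/-- The loss per dimension of uniform points converges in the whole asymptotic regime. -/
theorem tendsto_meanLoss_uniform (hd : 1 ≤ d) {τ u : ℝ} (hτ : 0 ≤ τ) (hu : 0 ≤ u) {α : Type*}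
    {F : Filter α} {n m : α → ℕ} {t : α → ℝ} (hn : Tendsto n F atTop) (ht : ∀ᶠ a in F, 0 ≤ t a)
    (hm : Tendsto (fun a => (m a : ℝ) / (n a : ℝ) ^ d) F (𝓝 u))
    (hτt : Tendsto (fun a => t a * (n a : ℝ) ^ d) F (𝓝 τ)) :
    Tendsto (fun a => meanLoss (n a) (t a) (pointLaw d fun _ => 1) (m a) / (n a : ℝ) ^ d) F
      (𝓝 (uniLimit d τ u)) := by
  have h1 := (tendsto_uniSeq hd hτ hu).comp hn
  have h2 := (tendsto_floor_mul_pow_div hd hu).comp hn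
  have h0 : Tendsto (fun a => |t a * (n a : ℝ) ^ d - τ| * ((m a : ℝ) / (n a : ℝ) ^ d) +
      |(m a : ℝ) / (n a : ℝ) ^ d - (⌊u * (n a : ℝ) ^ d⌋₊ : ℝ) / (n a : ℝ) ^ d|) F (𝓝 0) := by
    have := ((hτt.sub_const τ).abs.mul hm).add (hm.sub h2).abs
    simpa using this
  have h3 : Tendsto (fun a => meanLoss (n a) (t a) (pointLaw d fun _ => 1) (m a) / (n a : ℝ) ^ d -
      uniSeq d τ u (n a)) F (𝓝 0) := by
    refine squeeze_zero_norm' ?_ h0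
    filter_upwards [ht, hn.eventually_gt_atTop 0] with a hta hna
    have hn' : (0 : ℝ) < n a := by exact_mod_cast hna
    have hN : (0 : ℝ) < (n a : ℝ) ^ d := by positivity
    have e1 := abs_meanLoss_sub_coeff_le (μ := pointLaw d fun _ => 1) (n a) hta
      (by positivity : 0 ≤ τ / (n a : ℝ) ^ d) (m a)
    have e2 := abs_meanLoss_sub_le (μ := pointLaw d fun _ => 1) (n a) (τ / (n a : ℝ) ^ d) (m a)
      ⌊u * (n a : ℝ) ^ d⌋₊
    rw [Real.norm_eq_abs, uniSeq, ← sub_div, abs_div, abs_of_pos hN, div_le_iff₀ hN]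
    refine (abs_sub_le _ _ _).trans ((add_le_add e1 e2).trans (le_of_eq ?_))
    have e3 : |t a * (n a : ℝ) ^ d - τ| = |t a - τ / (n a : ℝ) ^ d| * (n a : ℝ) ^ d := by
      rw [← abs_of_pos hN, ← abs_mul, abs_of_pos hN, sub_mul, div_mul_cancel₀ _ hN.ne']
    have e4 : |(m a : ℝ) / (n a : ℝ) ^ d - (⌊u * (n a : ℝ) ^ d⌋₊ : ℝ) / (n a : ℝ) ^ d| =
        |(m a : ℝ) - (⌊u * (n a : ℝ) ^ d⌋₊ : ℝ)| / (n a : ℝ) ^ d := by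
      rw [← sub_div, abs_div, abs_of_pos hN]
    rw [e3, e4]
    field_simp
  simpa using h3.add h1

/-- One point changes the loss by at most one, and this Lipschitz bound passes to the limit. -/
theorem abs_uniLimit_sub_le (hd : 1 ≤ d) {τ u v : ℝ} (hτ : 0 ≤ τ) (hu : 0 ≤ u) (hv : 0 ≤ v) :
    |uniLimit d τ u - uniLimit d τ v| ≤ |u - v| := by
  refine le_of_tendsto_of_tendsto ((tendsto_uniSeq hd hτ hu).sub (tendsto_uniSeq hd hτ hv)).abs
    ((tendsto_floor_mul_pow_div hd hu).sub (tendsto_floor_mul_pow_div hd hv)).abs ?_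
  refine Eventually.of_forall fun n => ?_
  simp only [uniSeq]
  rw [← sub_div, ← sub_div, abs_div, abs_div]
  exact div_le_div_of_nonneg_right (abs_meanLoss_sub_le _ _ _ _) (abs_nonneg _)

theorem abs_meanLoss_div_le {μ : Measure (Fin d → ℝ)} [IsProbabilityMeasure μ] (n : ℕ) (t : ℝ)
    (m : ℕ) : |meanLoss n t μ m / (n : ℝ) ^ d| ≤ 1 := by
  rw [abs_div, abs_of_nonneg (by positivity : (0 : ℝ) ≤ (n : ℝ) ^ d)]
  exact div_le_one_of_le₀ (abs_meanLoss_le n t m) (by positivity)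

theorem abs_uniLimit_le (hd : 1 ≤ d) {τ u : ℝ} (hτ : 0 ≤ τ) (hu : 0 ≤ u) :
    |uniLimit d τ u| ≤ 1 :=
  le_of_tendsto (tendsto_uniSeq hd hτ hu).abs
    (Eventually.of_forall fun _ => abs_meanLoss_div_le _ _ _)

end UniformLimit

/-! ### Comparison of densities in L¹ and cell averages -/

section GeneralDensity

variable {d : ℕ} {f g : (Fin d → ℝ) → ℝ}

/-- Both densities have mass one, so h may be replaced by h - a, which takes values in [0, 1]. -/
theorem abs_integral_pointLaw_sub_le (hf : IsDensity d f) (hg : IsDensity d g)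
    {h : (Fin d → ℝ) → ℝ} (hm : Measurable h) {a : ℝ} (ha : ∀ x, h x ∈ Icc a (a + 1)) :
    |∫ x, h x ∂(pointLaw d f) - ∫ x, h x ∂(pointLaw d g)| ≤ ∫ x in cube d, |f x - g x| := by
  have hfi := hf.integrableOn
  have hgi := hg.integrableOn
  have hbd : ∀ x, ‖h x‖ ≤ |a| + 1 := fun x => by
    rw [Real.norm_eq_abs, abs_le]
    constructor
    · linarith [(ha x).1, neg_abs_le a]
    · linarith [(ha x).2, le_abs_self a]
  have hfh : IntegrableOn (fun x => f x * h x) (cube d) :=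
    hfi.mul_bdd hm.aestronglyMeasurable (Eventually.of_forall hbd)
  have hgh : IntegrableOn (fun x => g x * h x) (cube d) :=
    hgi.mul_bdd hm.aestronglyMeasurable (Eventually.of_forall hbd)
  have hfg : IntegrableOn (fun x => f x * h x - g x * h x) (cube d) := hfh.sub hgh
  have hsub : IntegrableOn (fun x => f x - g x) (cube d) := hfi.sub hgi
  have e : ∫ x, h x ∂(pointLaw d f) - ∫ x, h x ∂(pointLaw d g) =
      ∫ x in cube d, (f x - g x) * (h x - a) := by
    have e1 : ∀ x, (f x - g x) * (h x - a) = (f x * h x - g x * h x) - a * (f x - g x) := by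
      intro x; ring
    simp only [e1]
    rw [integral_sub hfg (hsub.const_mul a), integral_sub hfh hgh,
      integral_const_mul, integral_sub hfi hgi, hf.integral_eq_one, hg.integral_eq_one,
      hf.integral_pointLaw, hg.integral_pointLaw, sub_self, mul_zero, sub_zero]
  rw [e]
  refine norm_integral_le_of_norm_le (f := fun x => (f x - g x) * (h x - a)) hsub.abs
    (Eventually.of_forall fun x => ?_)
  rw [norm_mul, Real.norm_eq_abs, Real.norm_eq_abs]
  refine mul_le_of_le_one_right (abs_nonneg _) ?_
  rw [abs_le]
  constructor <;> linarith [(ha x).1, (ha x).2]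

theorem abs_meanLoss_sub_density_le (hf : IsDensity d f) (hg : IsDensity d g) (n : ℕ) (t : ℝ)
    (m : ℕ) : |meanLoss n t (pointLaw d f) m - meanLoss n t (pointLaw d g) m| ≤
      m * ∫ x in cube d, |f x - g x| := by
  have := hf.isProbabilityMeasure
  have := hg.isProbabilityMeasure
  exact abs_iterAvg_sub_iterAvg_le (measurable_pointMat n t) measurable_coneLoss abs_coneLoss_le
    (coneLoss_add_pointMat n t) (fun h hm a ha => abs_integral_pointLaw_sub_le hf hg hm ha) m 0

/-- The averages of `g` over the cells. -/
def cellAvg (g : (Fin d → ℝ) → ℝ) (p : ℕ) (c : Fin d → Fin p) : ℝ :=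
  (p : ℝ) ^ d * ∫ z in cell p c, g z

theorem isDensity_cellAvg (hg : IsDensity d g) (p : ℕ) [NeZero p] :
    IsDensity d (stepFun p (cellAvg g p)) := by
  have hp : (p : ℝ) ≠ 0 := by exact_mod_cast NeZero.ne p
  refine isDensity_of_integral_eq_one (measurable_stepFun p _) (fun z _ => ?_)
    (integrableOn_stepFun p _) ?_
  · exact mul_nonneg (by positivity) (setIntegral_nonneg (measurableSet_cell p _) fun x hx =>
      hg.nonneg x (cell_subset_cube p _ hx))
  · rw [integral_stepFun, ← hg.integral_eq_one, integral_cube_eq_sum p hg.integrableOn]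
    refine Finset.sum_congr rfl fun c _ => ?_
    rw [cellAvg]; field_simp

theorem abs_cellAvg_sub_le {p : ℕ} [NeZero p] (hgi : IntegrableOn g (cube d))
    {c : Fin d → Fin p} {b ε : ℝ} (h : ∀ z ∈ cell p c, |g z - b| ≤ ε) :
    |cellAvg g p c - b| ≤ ε := by
  have hp : (0 : ℝ) < p := by exact_mod_cast Nat.pos_of_ne_zero (NeZero.ne p)
  have hgc := hgi.mono_set (cell_subset_cube p c)
  have e : cellAvg g p c - b = (p : ℝ) ^ d * ∫ z in cell p c, (g z - b) := by
    rw [integral_sub hgc (integrable_const _), setIntegral_const, measureReal_cell, cellAvg,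
      smul_eq_mul]
    field_simp
  have h2 := norm_setIntegral_le_of_norm_le_const (μ := volume) (s := cell p c)
    (f := fun z => g z - b) (C := ε) (by rw [volume_cell]; exact ENNReal.ofReal_lt_top) h
  rw [measureReal_cell, Real.norm_eq_abs] at h2
  rw [e, abs_mul, abs_of_pos (by positivity : (0 : ℝ) < (p : ℝ) ^ d)]
  calc (p : ℝ) ^ d * |∫ z in cell p c, (g z - b)| ≤ (p : ℝ) ^ d * (ε * (1 / (p : ℝ) ^ d)) := by
        gcongr
    _ = ε := by field_simp

theorem abs_sub_le_of_mem_cell {p : ℕ} {c : Fin d → Fin p} {x y : Fin d → ℝ} (hx : x ∈ cell p c)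
    (hy : y ∈ cell p c) : dist x y ≤ 1 / p := by
  refine (dist_pi_le_iff (by positivity)).2 fun j => ?_
  have h1 := mem_Ico.1 (hx j (mem_univ j))
  have h2 := mem_Ico.1 (hy j (mem_univ j))
  rw [add_div] at h1 h2
  rw [Real.dist_eq, abs_le]
  constructor <;> linarith [h1.1, h1.2, h2.1, h2.2]

theorem cube_subset_Icc : cube d ⊆ Icc (fun _ => -1 / 2) (fun _ => 1 / 2) := fun _ hz =>
  ⟨fun j => (hz j (mem_univ j)).1, fun j => (hz j (mem_univ j)).2.le⟩

/-- The cell averages of a continuous function converge uniformly. -/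
theorem eventually_abs_stepFun_cellAvg_sub_le (hg : Continuous g) {ε : ℝ} (hε : 0 < ε) :
    ∀ᶠ p : ℕ in atTop, ∀ [NeZero p], ∀ z ∈ cube d, |stepFun p (cellAvg g p) z - g z| ≤ ε := by
  have huc := isCompact_Icc.uniformContinuousOn_of_continuous
    (s := Icc (fun _ : Fin d => (-1 / 2 : ℝ)) (fun _ => 1 / 2)) hg.continuousOn
  obtain ⟨δ, hδ, h⟩ := Metric.uniformContinuousOn_iff.1 huc ε hε
  filter_upwards [(tendsto_one_div_atTop_nhds_zero_nat (𝕜 := ℝ)).eventually_lt_const hδ]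
    with p hp _ z hz
  have hzc : z ∈ cell p (cellOf p z) := (mem_cell_iff hz _).2 rfl
  refine abs_cellAvg_sub_le (hg.continuousOn.integrableOn_compact isCompact_Icc |>.mono_set
    cube_subset_Icc) fun y hy => ?_
  have := h y (cube_subset_Icc (cell_subset_cube p _ hy)) z (cube_subset_Icc hz)
    ((abs_sub_le_of_mem_cell hy hzc).trans_lt hp)
  exact this.le

/-- The Lipschitz bound is available for nonnegative arguments; truncation at 0 yields a function
continuous on the whole line, which settles measurability later. -/
theorem continuous_uniLimit_max (hd : 1 ≤ d) {τ : ℝ} (hτ : 0 ≤ τ) :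
    Continuous fun u => uniLimit d τ (max u 0) := by
  refine (LipschitzWith.of_dist_le_mul (K := 1) fun u v => ?_).continuous
  rw [NNReal.coe_one, one_mul, Real.dist_eq, Real.dist_eq]
  refine (abs_uniLimit_sub_le hd hτ (le_max_right _ _) (le_max_right _ _)).trans ?_
  exact abs_max_sub_max_le_abs u v 0

theorem integrableOn_uniLimit_comp (hd : 1 ≤ d) {τ υ : ℝ} (hτ : 0 ≤ τ) (hυ : 0 ≤ υ)
    (hg : IsDensity d g) : IntegrableOn (fun z => uniLimit d τ (υ * g z)) (cube d) := by
  have h1 : IntegrableOn (fun z => uniLimit d τ (max (υ * g z) 0)) (cube d) :=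
    .of_bound (by rw [volume_cube]; exact ENNReal.one_lt_top)
      ((continuous_uniLimit_max hd hτ).measurable.comp
        (hg.measurable.const_mul υ)).aestronglyMeasurable 1
      (Eventually.of_forall fun z => abs_uniLimit_le hd hτ (le_max_right _ _))
  refine h1.congr_fun (fun z hz => ?_) measurableSet_cube
  simp only [max_eq_left (mul_nonneg hυ (hg.nonneg z hz))]

/-- The finite-size loss for a continuous density is close to an average of losses of
uniform points. -/
theorem abs_meanLoss_div_sub_integral_le (hd : 1 ≤ d) (hg : IsDensity d g) {n p : ℕ} [NeZero p]
    (hpn : p ≤ n) {t : ℝ} (ht : 0 ≤ t) {B : ℝ} (hB : ∀ c, cellAvg g p c ≤ B) (m : ℕ) {ε : ℝ}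
    (hε : ∀ z ∈ cube d, |stepFun p (cellAvg g p) z - g z| ≤ ε) :
    |meanLoss n t (pointLaw d g) m / (n : ℝ) ^ d - ∫ z in cube d, stepFun p (fun c =>
      meanLoss n t (pointLaw d fun _ => 1) (p ^ d * ⌊m * cellAvg g p c / (p : ℝ) ^ d⌋₊) /
        (n : ℝ) ^ d) z| ≤ m / (n : ℝ) ^ d * ε +
      ((m / (n : ℝ) ^ d + d * (t * (n : ℝ) ^ d) ^ 2 * (m / (n : ℝ) ^ d) ^ 2 * B ^ 2 + 3) +
        (m / (n : ℝ) ^ d * B + d * (t * (n : ℝ) ^ d) ^ 2 * (m / (n : ℝ) ^ d * B) ^ 2 + 3)) *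
          √√((p : ℝ) / n) := by
  have hp : (0 : ℝ) < p := by exact_mod_cast Nat.pos_of_ne_zero (NeZero.ne p)
  have hn : (0 : ℝ) < n := hp.trans_le (by exact_mod_cast hpn)
  have hN : (0 : ℝ) < (n : ℝ) ^ d := by positivity
  have hP : (0 : ℝ) < (p : ℝ) ^ d := by positivity
  have hv : ∀ c, 0 ≤ cellAvg g p c := fun c => mul_nonneg (by positivity)
    (setIntegral_nonneg (measurableSet_cell p _) fun x hx =>
      hg.nonneg x (cell_subset_cube p _ hx))
  have hfl : ∀ c, (⌊m * cellAvg g p c / (p : ℝ) ^ d⌋₊ : ℝ) ≤ m * cellAvg g p c / (p : ℝ) ^ d :=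
    fun c => Nat.floor_le (by have := hv c; positivity)
  set k : (Fin d → Fin p) → ℕ := fun c => ⌊m * cellAvg g p c / (p : ℝ) ^ d⌋₊ with hk
  have hk2 : ∀ c, |m * (cellAvg g p c / (p : ℝ) ^ d) - k c| ≤ 2 := by
    intro c
    have h1 := hfl c
    have h2 := Nat.lt_floor_add_one (m * cellAvg g p c / (p : ℝ) ^ d)
    rw [← mul_div_assoc, abs_le]
    constructor <;> linarith
  set K1 := (m / (n : ℝ) ^ d + d * (t * (n : ℝ) ^ d) ^ 2 * (m / (n : ℝ) ^ d) ^ 2 * B ^ 2 + 3)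
    with hK1
  set K2 := (m / (n : ℝ) ^ d * B + d * (t * (n : ℝ) ^ d) ^ 2 * (m / (n : ℝ) ^ d * B) ^ 2 + 3)
    with hK2
  set ρ := √√((p : ℝ) / n) with hρ
  have hρ0 : 0 ≤ ρ := Real.sqrt_nonneg _
  have h1 : |meanLoss n t (pointLaw d g) m -
      meanLoss n t (pointLaw d (stepFun p (cellAvg g p))) m| ≤ m * ε := by
    refine (abs_meanLoss_sub_density_le hg (isDensity_cellAvg hg p) n t m).trans ?_
    refine mul_le_mul_of_nonneg_left ?_ (Nat.cast_nonneg m)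
    have h2 := setIntegral_mono_on (hg.integrableOn.sub (integrableOn_stepFun p (cellAvg g p))).abs
      (integrableOn_const (C := ε) (by rw [volume_cube]; exact ENNReal.one_ne_top))
      measurableSet_cube fun z hz => by
        change |g z - stepFun p (cellAvg g p) z| ≤ ε
        rw [abs_sub_comm]; exact hε z hz
    refine h2.trans (le_of_eq ?_)
    rw [setIntegral_const, Measure.real, volume_cube]
    simp
  have h2 := abs_meanLoss_stepFun_sub_le hd hpn ht hv hB (isDensity_cellAvg hg p) m k hk2
  have h3 : ∀ c, |cellLoss d n t p (k c) -
      meanLoss n t (pointLaw d fun _ => 1) (p ^ d * k c) / (p : ℝ) ^ d| ≤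
        (n : ℝ) ^ d * (K2 * ρ) / (p : ℝ) ^ d := by
    intro c
    -- Exactly p^d k uniform points correspond to k points per cell, so the loss of one cell is read
    -- off from a uniform configuration with no rounding error.
    have h4 := abs_meanLoss_uniform_sub_le hd hpn ht (p ^ d * k c) (k c) (by
      push_cast
      rw [mul_div_cancel_left₀ _ hP.ne', sub_self, abs_zero]
      norm_num)
    have e : cellLoss d n t p (k c) -
        meanLoss n t (pointLaw d fun _ => 1) (p ^ d * k c) / (p : ℝ) ^ d =
        -((meanLoss n t (pointLaw d fun _ => 1) (p ^ d * k c) -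
          (p : ℝ) ^ d * cellLoss d n t p (k c)) / (p : ℝ) ^ d) := by
      field_simp
      ring
    rw [e, abs_neg, abs_div, abs_of_pos hP]
    refine div_le_div_of_nonneg_right (h4.trans ?_) hP.le
    have h5 : ((p ^ d * k c : ℕ) : ℝ) / (n : ℝ) ^ d ≤ m / (n : ℝ) ^ d * B := by
      rw [div_mul_eq_mul_div]
      refine div_le_div_of_nonneg_right ?_ hN.le
      push_cast
      have h6 := hfl c
      rw [le_div_iff₀ hP, mul_comm] at h6
      exact h6.trans (mul_le_mul_of_nonneg_left (hB c) (Nat.cast_nonneg m))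
    rw [hK2]
    gcongr
  have h4 : |∑ c, cellLoss d n t p (k c) - (n : ℝ) ^ d * ∫ z in cube d, stepFun p (fun c =>
      meanLoss n t (pointLaw d fun _ => 1) (p ^ d * k c) / (n : ℝ) ^ d) z| ≤
        (n : ℝ) ^ d * (K2 * ρ) := by
    rw [integral_stepFun, Finset.mul_sum, ← Finset.sum_sub_distrib]
    refine (Finset.abs_sum_le_sum_abs _ _).trans ?_
    calc _ ≤ ∑ _c : Fin d → Fin p, (n : ℝ) ^ d * (K2 * ρ) / (p : ℝ) ^ d := by
          refine Finset.sum_le_sum fun c _ => le_of_eq_of_le ?_ (h3 c)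
          congr 2
          field_simp
      _ = (n : ℝ) ^ d * (K2 * ρ) := by
          simp
          field_simp
  have h5 := (abs_sub_le _ _ _).trans (add_le_add ((abs_sub_le _ _ _).trans (add_le_add h1 h2)) h4)
  have e : meanLoss n t (pointLaw d g) m / (n : ℝ) ^ d - ∫ z in cube d, stepFun p (fun c =>
      meanLoss n t (pointLaw d fun _ => 1) (p ^ d * k c) / (n : ℝ) ^ d) z =
      (meanLoss n t (pointLaw d g) m - (n : ℝ) ^ d * ∫ z in cube d, stepFun p (fun c =>
      meanLoss n t (pointLaw d fun _ => 1) (p ^ d * k c) / (n : ℝ) ^ d) z) / (n : ℝ) ^ d := by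
    rw [sub_div, mul_div_cancel_left₀ _ hN.ne']
  rw [e, abs_div, abs_of_pos hN, div_le_iff₀ hN]
  refine h5.trans (le_of_eq ?_)
  rw [← hK1]
  field_simp
  ring

end GeneralDensity

/-! ### The limit for continuous densities and for general ones -/

section DensityLimit

variable {d : ℕ} {f g : (Fin d → ℝ) → ℝ}

/-- The number of cells per axis will be ⌊√n⌋ + 1: it tends to infinity but is o(n), and the
successor keeps it nonzero for every n. -/
theorem tendsto_sqrt_succ_div :
    Tendsto (fun n : ℕ => ((Nat.sqrt n + 1 : ℕ) : ℝ) / n) atTop (𝓝 0) := by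
  have h1 : Tendsto (fun n : ℕ => 1 / √(n : ℝ) + 1 / (n : ℝ)) atTop (𝓝 0) := by
    have h2 : Tendsto (fun n : ℕ => 1 / √(n : ℝ)) atTop (𝓝 0) :=
      tendsto_const_nhds.div_atTop (Real.tendsto_sqrt_atTop.comp tendsto_natCast_atTop_atTop)
    simpa using h2.add (tendsto_one_div_atTop_nhds_zero_nat (𝕜 := ℝ))
  refine squeeze_zero (fun n => by positivity) (fun n => ?_) h1
  push_cast
  rw [add_div]
  have h3 : (Nat.sqrt n : ℝ) ≤ √(n : ℝ) := Real.nat_sqrt_le_real_sqrt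
  have h4 : √(n : ℝ) / n = 1 / √(n : ℝ) := Real.sqrt_div_self'
  rw [← h4]
  gcongr

theorem tendsto_sqrt_succ_atTop : Tendsto (fun n : ℕ => Nat.sqrt n + 1) atTop atTop := by
  refine tendsto_atTop.2 fun b => ?_
  filter_upwards [eventually_ge_atTop (b * b)] with n hn
  exact (Nat.le_sqrt.2 hn).trans (Nat.le_succ _)

variable {α : Type*} {F : Filter α} {n m : α → ℕ} {t : α → ℝ}

/-- The cells shrink, so the cell averages converge uniformly to g, while p / n tends to 0, so the
decoupling error vanishes. The remaining average of uniform losses converges pointwise and is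
bounded by one; dominated convergence along F uses that F is countably generated. -/
theorem tendsto_meanLoss_of_continuous [F.IsCountablyGenerated] (hd : 1 ≤ d)
    (hg : IsDensity d g) (hgc : Continuous g) {τ υ : ℝ} (hτ : 0 ≤ τ) (hυ : 0 ≤ υ)
    (hn : Tendsto n F atTop) (ht : ∀ᶠ a in F, 0 ≤ t a)
    (hm : Tendsto (fun a => (m a : ℝ) / (n a : ℝ) ^ d) F (𝓝 υ))
    (hτt : Tendsto (fun a => t a * (n a : ℝ) ^ d) F (𝓝 τ)) :
    Tendsto (fun a => meanLoss (n a) (t a) (pointLaw d g) (m a) / (n a : ℝ) ^ d) F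
      (𝓝 (∫ z in cube d, uniLimit d τ (υ * g z))) := by
  set p : α → ℕ := fun a => Nat.sqrt (n a) + 1 with hp
  have hpF : Tendsto p F atTop := tendsto_sqrt_succ_atTop.comp hn
  have hr : Tendsto (fun a => ((p a : ℕ) : ℝ) / n a) F (𝓝 0) := tendsto_sqrt_succ_div.comp hn
  obtain ⟨B, hB⟩ : ∃ B, ∀ z ∈ cube d, g z ≤ B := by
    obtain ⟨B, hB⟩ := (isCompact_Icc (a := fun _ : Fin d => (-1 / 2 : ℝ))
      (b := fun _ => 1 / 2)).bddAbove_image hgc.continuousOn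
    exact ⟨B, fun z hz => hB (mem_image_of_mem g (cube_subset_Icc hz))⟩
  have hB0 : 0 ≤ B := by
    have : (fun _ => -1 / 2 : Fin d → ℝ) ∈ cube d := fun _ _ => by norm_num
    exact (hg.nonneg _ this).trans (hB _ this)
  have hv0 : ∀ a c, 0 ≤ cellAvg g (p a) c := fun a c => mul_nonneg (by positivity)
    (setIntegral_nonneg (measurableSet_cell _ _) fun x hx =>
      hg.nonneg x (cell_subset_cube (p a) _ hx))
  have hvB : ∀ a c, cellAvg g (p a) c ≤ B := by
    intro a c
    have h1 : ∫ z in cell (p a) c, g z ≤ B * (1 / ((p a : ℕ) : ℝ) ^ d) := by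
      have h2 := setIntegral_mono_on (μ := volume)
        (hg.integrableOn.mono_set (cell_subset_cube (p a) c))
        (integrableOn_const (C := B) (by rw [volume_cell]; exact ENNReal.ofReal_ne_top))
        (measurableSet_cell (p a) c) fun z hz => hB z (cell_subset_cube (p a) c hz)
      rwa [setIntegral_const, measureReal_cell, smul_eq_mul, mul_comm] at h2
    rw [cellAvg]
    calc ((p a : ℕ) : ℝ) ^ d * ∫ z in cell (p a) c, g z
        ≤ ((p a : ℕ) : ℝ) ^ d * (B * (1 / ((p a : ℕ) : ℝ) ^ d)) := by gcongr
      _ = B := by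
        have : ((p a : ℕ) : ℝ) ^ d ≠ 0 := by positivity
        field_simp
  have hosc : ∀ ε > 0, ∀ᶠ a in F, ∀ z ∈ cube d, |stepFun (p a) (cellAvg g (p a)) z - g z| ≤ ε := by
    intro ε hε
    filter_upwards [hpF.eventually (eventually_abs_stepFun_cellAvg_sub_le hgc hε)] with a ha
    exact ha
  set I : α → (Fin d → ℝ) → ℝ := fun a => stepFun (p a) fun c =>
    meanLoss (n a) (t a) (pointLaw d fun _ => 1)
      (p a ^ d * ⌊m a * cellAvg g (p a) c / ((p a : ℕ) : ℝ) ^ d⌋₊) / (n a : ℝ) ^ d with hI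
  have hIlim : Tendsto (fun a => ∫ z in cube d, I a z) F
      (𝓝 (∫ z in cube d, uniLimit d τ (υ * g z))) := by
    refine tendsto_integral_filter_of_dominated_convergence (fun _ => 1)
      (Eventually.of_forall fun a => (measurable_stepFun _ _).aestronglyMeasurable)
      (Eventually.of_forall fun a => Eventually.of_forall fun z => abs_meanLoss_div_le _ _ _)
      (integrable_const _) ((ae_restrict_mem measurableSet_cube).mono fun z hz => ?_)
    refine tendsto_meanLoss_uniform (n := n)
      (m := fun a => p a ^ d * ⌊m a * cellAvg g (p a) (cellOf (p a) z) / ((p a : ℕ) : ℝ) ^ d⌋₊)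
      hd hτ (mul_nonneg hυ (hg.nonneg z hz)) hn ht ?_ hτt
    have hvz : Tendsto (fun a => cellAvg g (p a) (cellOf (p a) z)) F (𝓝 (g z)) := by
      refine Metric.tendsto_nhds.2 fun ε hε => ?_
      filter_upwards [hosc (ε / 2) (half_pos hε)] with a ha
      exact (ha z hz).trans_lt (half_lt_self hε)
    have hd0 : Tendsto (fun a => (((p a : ℕ) : ℝ) / n a) ^ d) F (𝓝 0) := by
      have := hr.pow d
      rwa [zero_pow (by omega)] at this
    -- Rounding the number of points in each of p^d cells changes the density of points by at most
    -- (p / n)^d, which tends to 0.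
    have hlow := (hm.mul hvz).sub hd0
    rw [sub_zero] at hlow
    refine tendsto_of_tendsto_of_tendsto_of_le_of_le' hlow (hm.mul hvz) ?_ ?_
    · filter_upwards [hn.eventually_gt_atTop 0] with a ha
      have hN : (0 : ℝ) < (n a : ℝ) ^ d := by positivity
      have hP : (0 : ℝ) < ((p a : ℕ) : ℝ) ^ d := by positivity
      have h1 := Nat.lt_floor_add_one
        (m a * cellAvg g (p a) (cellOf (p a) z) / ((p a : ℕ) : ℝ) ^ d)
      rw [div_lt_iff₀ hP] at h1
      rw [div_pow, div_mul_eq_mul_div, ← sub_div]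
      refine div_le_div_of_nonneg_right ?_ hN.le
      rw [Nat.cast_mul, Nat.cast_pow]
      linarith
    · filter_upwards [hn.eventually_gt_atTop 0] with a ha
      have hN : (0 : ℝ) < (n a : ℝ) ^ d := by positivity
      have hP : (0 : ℝ) < ((p a : ℕ) : ℝ) ^ d := by positivity
      have h1 := Nat.floor_le (div_nonneg (mul_nonneg (Nat.cast_nonneg (m a))
        (hv0 a (cellOf (p a) z))) hP.le)
      rw [le_div_iff₀ hP] at h1
      rw [div_mul_eq_mul_div]
      refine div_le_div_of_nonneg_right ?_ hN.le
      rw [Nat.cast_mul, Nat.cast_pow]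
      linarith
  have hρ : Tendsto (fun a => √√(((p a : ℕ) : ℝ) / n a)) F (𝓝 0) := by
    have := (Real.continuous_sqrt.tendsto _).comp ((Real.continuous_sqrt.tendsto _).comp hr)
    simp only [Real.sqrt_zero] at this
    exact this
  have herr : Tendsto (fun a => ((m a / (n a : ℝ) ^ d + d * (t a * (n a : ℝ) ^ d) ^ 2 *
      (m a / (n a : ℝ) ^ d) ^ 2 * B ^ 2 + 3) + (m a / (n a : ℝ) ^ d * B +
        d * (t a * (n a : ℝ) ^ d) ^ 2 * (m a / (n a : ℝ) ^ d * B) ^ 2 + 3)) *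
          √√(((p a : ℕ) : ℝ) / n a)) F (𝓝 0) := by
    have h1 := ((((hm.add (((hτt.pow 2).const_mul (d : ℝ)).mul (hm.pow 2) |>.mul_const
      (B ^ 2))).add_const 3).add (((hm.mul_const B).add (((hτt.pow 2).const_mul (d : ℝ)).mul
        ((hm.mul_const B).pow 2))).add_const 3))).mul hρ
    rw [mul_zero] at h1
    exact h1
  have hdiff : Tendsto (fun a => meanLoss (n a) (t a) (pointLaw d g) (m a) / (n a : ℝ) ^ d -
      ∫ z in cube d, I a z) F (𝓝 0) := by
    refine Metric.tendsto_nhds.2 fun ε hε => ?_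
    -- Eventually m / n^d ≤ υ + 1, so the oscillation of g within cells costs at most ε / 2.
    have hε' : 0 < ε / (2 * (υ + 1)) := by positivity
    have hpn : ∀ᶠ a in F, p a ≤ n a := by
      filter_upwards [hr.eventually_le_const one_pos, hn.eventually_gt_atTop 0] with a h1 h2
      have h3 : (0 : ℝ) < n a := by exact_mod_cast h2
      rw [div_le_one h3] at h1
      exact_mod_cast h1
    filter_upwards [hosc _ hε', hpn, ht, herr.eventually_lt_const (half_pos hε),
      hm.eventually_le_const (lt_add_one υ)] with a h1 h2 h3 h4 h5
    have h6 := abs_meanLoss_div_sub_integral_le hd hg h2 h3 (hvB a) (m a) h1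
    rw [Real.dist_eq, sub_zero]
    refine h6.trans_lt ?_
    have h7 : (m a : ℝ) / (n a : ℝ) ^ d * (ε / (2 * (υ + 1))) ≤ ε / 2 := by
      calc (m a : ℝ) / (n a : ℝ) ^ d * (ε / (2 * (υ + 1)))
          ≤ (υ + 1) * (ε / (2 * (υ + 1))) := mul_le_mul_of_nonneg_right h5 hε'.le
        _ = ε / 2 := by
          have : υ + 1 ≠ 0 := by positivity
          field_simp
    linarith
  simpa using hdiff.add hIlim

/-- Densities are approximated in `L¹` by continuous densities. -/
theorem exists_continuous_density (hf : IsDensity d f) {ε : ℝ} (hε : 0 < ε) :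
    ∃ g, IsDensity d g ∧ Continuous g ∧ ∫ z in cube d, |f z - g z| ≤ ε := by
  -- Approximating and normalizing cost δ each, hence 2 δ ≤ ε; δ < 1 keeps the mass J of the
  -- approximant positive.
  obtain ⟨δ, hδ, hδ1, hδε⟩ : ∃ δ : ℝ, 0 < δ ∧ δ < 1 ∧ 2 * δ ≤ ε :=
    ⟨min (ε / 2) (1 / 2), by positivity, (min_le_right _ _).trans_lt (by norm_num), by
      linarith [min_le_left (ε / 2) (1 / 2)]⟩
  have hfi := hf.integrableOn
  obtain ⟨g₀, -, hg₀, hg₀c, hg₀i⟩ :=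
    (hfi.integrable_indicator measurableSet_cube).exists_hasCompactSupport_integral_sub_le hδ
  -- Since f ≥ 0 on the cube, taking the positive part does not increase the distance to f.
  set g₁ : (Fin d → ℝ) → ℝ := fun z => max (g₀ z) 0 with hg₁
  have hg₁c : Continuous g₁ := hg₀c.max continuous_const
  have hg₁i : IntegrableOn g₁ (cube d) := hg₀i.integrableOn.pos_part
  have h1 : ∫ z in cube d, |f z - g₁ z| ≤ δ := by
    calc ∫ z in cube d, |f z - g₁ z|
        ≤ ∫ z in cube d, ‖(cube d).indicator f z - g₀ z‖ := by
          refine setIntegral_mono_on (hfi.sub hg₁i).abs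
            (((hfi.integrable_indicator measurableSet_cube).sub hg₀i).norm.integrableOn)
            measurableSet_cube fun z hz => ?_
          rw [indicator_of_mem hz, Real.norm_eq_abs]
          have h2 := abs_max_sub_max_le_abs (f z) (g₀ z) 0
          rwa [max_eq_left (hf.nonneg z hz)] at h2
      _ ≤ ∫ z, ‖(cube d).indicator f z - g₀ z‖ :=
          setIntegral_le_integral ((hfi.integrable_indicator measurableSet_cube).sub hg₀i).norm
            (Eventually.of_forall fun z => norm_nonneg _)
      _ ≤ δ := hg₀
  set J := ∫ z in cube d, g₁ z with hJ
  have hJ1 : |1 - J| ≤ δ := by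
    rw [← hf.integral_eq_one, hJ, ← integral_sub hfi hg₁i]
    exact (abs_integral_le_integral_abs).trans h1
  have hJ0 : 0 < J := by linarith [(abs_le.1 hJ1).2]
  refine ⟨fun z => J⁻¹ * g₁ z, isDensity_of_integral_eq_one (hg₁c.measurable.const_mul _)
    (fun z _ => mul_nonneg (inv_nonneg.2 hJ0.le) (le_max_right _ _)) (hg₁i.const_mul _) ?_,
    continuous_const.mul hg₁c, ?_⟩
  · rw [integral_const_mul, ← hJ, inv_mul_cancel₀ hJ0.ne']
  · have h2 : ∫ z in cube d, |g₁ z - J⁻¹ * g₁ z| ≤ δ := by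
      have e : ∀ z, |g₁ z - J⁻¹ * g₁ z| = |1 - J⁻¹| * g₁ z := by
        intro z
        have h0 : 0 ≤ g₁ z := le_max_right _ _
        rw [show g₁ z - J⁻¹ * g₁ z = (1 - J⁻¹) * g₁ z by ring, abs_mul, abs_of_nonneg h0]
      simp only [e]
      rw [integral_const_mul, ← hJ]
      nth_rw 2 [← abs_of_pos hJ0]
      rw [← abs_mul, sub_mul, one_mul, inv_mul_cancel₀ hJ0.ne', abs_sub_comm]
      exact hJ1
    have hi1 : IntegrableOn (fun z => |f z - g₁ z|) (cube d) := (hfi.sub hg₁i).abs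
    have hi2 : IntegrableOn (fun z => |g₁ z - J⁻¹ * g₁ z|) (cube d) :=
      (hg₁i.sub (hg₁i.const_mul J⁻¹)).abs
    calc ∫ z in cube d, |f z - J⁻¹ * g₁ z|
        ≤ ∫ z in cube d, (|f z - g₁ z| + |g₁ z - J⁻¹ * g₁ z|) :=
          integral_mono_of_nonneg (Eventually.of_forall fun z => abs_nonneg _) (hi1.add hi2)
            (Eventually.of_forall fun z => abs_sub_le _ _ _)
      _ ≤ ε := by rw [integral_add hi1 hi2]; linarith

/-- The loss per dimension of points of density `f` converges to the mean over the cube of the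
loss of uniform points of the local density. -/
theorem tendsto_meanLoss [F.IsCountablyGenerated] (hd : 1 ≤ d)
    (hf : IsDensity d f) {τ υ : ℝ} (hτ : 0 ≤ τ) (hυ : 0 ≤ υ)
    (hn : Tendsto n F atTop) (ht : ∀ᶠ a in F, 0 ≤ t a)
    (hm : Tendsto (fun a => (m a : ℝ) / (n a : ℝ) ^ d) F (𝓝 υ))
    (hτt : Tendsto (fun a => t a * (n a : ℝ) ^ d) F (𝓝 τ)) :
    Tendsto (fun a => meanLoss (n a) (t a) (pointLaw d f) (m a) / (n a : ℝ) ^ d) F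
      (𝓝 (∫ z in cube d, uniLimit d τ (υ * f z))) := by
  refine Metric.tendsto_nhds.2 fun ε hε => ?_
  -- Changing f to g costs ε / 4 at finite size and ε / 4 in the limit; convergence for g costs less
  -- than another ε / 4.
  have hε' : 0 < ε / (4 * (υ + 1)) := by positivity
  obtain ⟨g, hg, hgc, hfg⟩ := exists_continuous_density hf hε'
  have hlim := tendsto_meanLoss_of_continuous hd hg hgc hτ hυ hn ht hm hτt
  have hυ1 : υ + 1 ≠ 0 := by positivity
  have hδ : (υ + 1) * (ε / (4 * (υ + 1))) = ε / 4 := by field_simp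
  have h2 : |(∫ z in cube d, uniLimit d τ (υ * g z)) - ∫ z in cube d, uniLimit d τ (υ * f z)| ≤
      ε / 4 := by
    rw [← integral_sub (integrableOn_uniLimit_comp hd hτ hυ hg)
      (integrableOn_uniLimit_comp hd hτ hυ hf)]
    have hi : IntegrableOn (fun z => υ * |f z - g z|) (cube d) :=
      (hf.integrableOn.sub hg.integrableOn).abs.const_mul υ
    refine (norm_integral_le_of_norm_le hi
      (f := fun z => uniLimit d τ (υ * g z) - uniLimit d τ (υ * f z))
      ((ae_restrict_mem measurableSet_cube).mono fun z hz => ?_)).trans ?_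
    · refine (abs_uniLimit_sub_le hd hτ (mul_nonneg hυ (hg.nonneg z hz))
        (mul_nonneg hυ (hf.nonneg z hz))).trans (le_of_eq ?_)
      rw [← mul_sub, abs_mul, abs_of_nonneg hυ, abs_sub_comm]
    · rw [integral_const_mul, ← hδ]
      have h0 : 0 ≤ ∫ z in cube d, |f z - g z| := integral_nonneg fun z => abs_nonneg _
      nlinarith
  filter_upwards [Metric.tendsto_nhds.1 hlim (ε / 4) (by positivity),
    hm.eventually_le_const (lt_add_one υ), hn.eventually_gt_atTop 0] with a h3 h4 h5
  have hN : (0 : ℝ) < (n a : ℝ) ^ d := by positivity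
  have h6 : |meanLoss (n a) (t a) (pointLaw d f) (m a) / (n a : ℝ) ^ d -
      meanLoss (n a) (t a) (pointLaw d g) (m a) / (n a : ℝ) ^ d| ≤ ε / 4 := by
    rw [← sub_div, abs_div, abs_of_pos hN, ← hδ]
    calc _ ≤ (m a * ∫ x in cube d, |f x - g x|) / (n a : ℝ) ^ d :=
          div_le_div_of_nonneg_right (abs_meanLoss_sub_density_le hf hg _ _ _) hN.le
      _ = m a / (n a : ℝ) ^ d * ∫ x in cube d, |f x - g x| := by ring
      _ ≤ (υ + 1) * (ε / (4 * (υ + 1))) :=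
          mul_le_mul h4 hfg (integral_nonneg fun z => abs_nonneg _) (by positivity)
  rw [Real.dist_eq] at h3 ⊢
  have h7 := abs_sub_le (meanLoss (n a) (t a) (pointLaw d f) (m a) / (n a : ℝ) ^ d)
    (meanLoss (n a) (t a) (pointLaw d g) (m a) / (n a : ℝ) ^ d)
    (∫ z in cube d, uniLimit d τ (υ * f z))
  have h8 := abs_sub_le (meanLoss (n a) (t a) (pointLaw d g) (m a) / (n a : ℝ) ^ d)
    (∫ z in cube d, uniLimit d τ (υ * g z)) (∫ z in cube d, uniLimit d τ (υ * f z))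
  linarith

end DensityLimit

/-! ### Second-order theory of linear estimation -/

section LinearEstimation

variable {Ω : Type*} [MeasurableSpace Ω] {P : Measure Ω} {ι κ l : Type*}

theorem integrable_mul_conj {u w : Ω → ℂ} (hu : MemLp u 2 P) (hw : MemLp w 2 P) :
    Integrable (fun ω => u ω * conj (w ω)) P :=
  hu.integrable_mul hw.star

theorem memLp_mulVec [Fintype ι] (A : Matrix l ι ℂ) {u : Ω → ι → ℂ}
    (hu : ∀ i, MemLp (fun ω => u ω i) 2 P) (j : l) : MemLp (fun ω => (A *ᵥ u ω) j) 2 P := by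
  simp only [Matrix.mulVec, dotProduct]
  exact memLp_finsetSum _ fun i _ => (hu i).const_mul _

theorem conjTranspose_corr (u : Ω → ι → ℂ) (w : Ω → κ → ℂ) : (corr P u w)ᴴ = corr P w u := by
  ext i j
  simp only [corr, Matrix.conjTranspose_apply, Matrix.of_apply, RCLike.star_def, ← integral_conj,
    map_mul, Complex.conj_conj]
  simp only [mul_comm]

theorem corr_add_left {u v : Ω → ι → ℂ} {w : Ω → κ → ℂ}
    (hu : ∀ i, MemLp (fun ω => u ω i) 2 P) (hv : ∀ i, MemLp (fun ω => v ω i) 2 P)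
    (hw : ∀ i, MemLp (fun ω => w ω i) 2 P) :
    corr P (fun ω => u ω + v ω) w = corr P u w + corr P v w := by
  ext i j
  simp only [corr, Matrix.add_apply, Matrix.of_apply, Pi.add_apply, add_mul]
  exact integral_add (integrable_mul_conj (hu i) (hw j)) (integrable_mul_conj (hv i) (hw j))

theorem corr_add_right {u : Ω → ι → ℂ} {v w : Ω → κ → ℂ}
    (hu : ∀ i, MemLp (fun ω => u ω i) 2 P) (hv : ∀ i, MemLp (fun ω => v ω i) 2 P)
    (hw : ∀ i, MemLp (fun ω => w ω i) 2 P) :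
    corr P u (fun ω => v ω + w ω) = corr P u v + corr P u w := by
  rw [← conjTranspose_corr, corr_add_left hv hw hu, Matrix.conjTranspose_add, conjTranspose_corr,
    conjTranspose_corr]

theorem corr_mulVec_left [Fintype ι] (A : Matrix l ι ℂ) {u : Ω → ι → ℂ} {w : Ω → κ → ℂ}
    (hu : ∀ i, MemLp (fun ω => u ω i) 2 P) (hw : ∀ i, MemLp (fun ω => w ω i) 2 P) :
    corr P (fun ω => A *ᵥ u ω) w = A * corr P u w := by
  ext i j
  simp only [corr, Matrix.mul_apply, Matrix.of_apply, Matrix.mulVec, dotProduct, Finset.sum_mul]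
  rw [integral_finsetSum _ fun k _ => by
    simp only [mul_assoc]; exact (integrable_mul_conj (hu k) (hw j)).const_mul _]
  simp only [mul_assoc, integral_const_mul]

theorem corr_mulVec_right [Fintype κ] (A : Matrix l κ ℂ) {u : Ω → ι → ℂ} {w : Ω → κ → ℂ}
    (hu : ∀ i, MemLp (fun ω => u ω i) 2 P) (hw : ∀ i, MemLp (fun ω => w ω i) 2 P) :
    corr P u (fun ω => A *ᵥ w ω) = corr P u w * Aᴴ := by
  rw [← conjTranspose_corr, corr_mulVec_left A hw hu, Matrix.conjTranspose_mul,
    conjTranspose_corr]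

theorem integral_sum_norm_sq [Fintype ι] {u : Ω → ι → ℂ}
    (hu : ∀ i, MemLp (fun ω => u ω i) 2 P) :
    ∫ ω, ∑ i, ‖u ω i‖ ^ 2 ∂P = (Matrix.trace (corr P u u)).re := by
  rw [integral_finsetSum _ fun i _ => (hu i).integrable_norm_pow (by norm_num)]
  simp only [Matrix.trace, Matrix.diag_apply, corr, Matrix.of_apply, Complex.re_sum,
    Complex.mul_conj, Complex.normSq_eq_norm_sq, integral_complex_ofReal, Complex.ofReal_re]

/-- The error covariance of the linear estimate `E[u pᴴ] E[p pᴴ]⁻¹ p` of `u`. -/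
theorem corr_sub_linear_estimate [Fintype κ] [DecidableEq κ] {u : Ω → ι → ℂ} {p : Ω → κ → ℂ}
    (hu : ∀ i, MemLp (fun ω => u ω i) 2 P) (hp : ∀ i, MemLp (fun ω => p ω i) 2 P)
    (h : IsUnit (corr P p p).det) :
    corr P (fun ω => u ω - (corr P u p * (corr P p p)⁻¹) *ᵥ p ω)
      (fun ω => u ω - (corr P u p * (corr P p p)⁻¹) *ᵥ p ω) =
      corr P u u - corr P u p * (corr P p p)⁻¹ * (corr P u p)ᴴ := by
  set K := corr P u p * (corr P p p)⁻¹ with hK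
  have h1 := memLp_mulVec (-K) hp
  have h2 : ∀ ω, u ω - K *ᵥ p ω = u ω + (-K) *ᵥ p ω := fun ω => by
    rw [Matrix.neg_mulVec, sub_eq_add_neg]
  simp only [h2]
  have h3 : ∀ i, MemLp (fun ω => (u ω + (-K) *ᵥ p ω) i) 2 P := fun i => (hu i).add (h1 i)
  -- The orthogonality principle: the samples are uncorrelated with the estimation error, so only
  -- the correlation of the error with u remains.
  have h4 : corr P p (fun ω => u ω + (-K) *ᵥ p ω) = 0 := by
    rw [corr_add_right hp hu h1, corr_mulVec_right _ hp hp, hK, Matrix.conjTranspose_neg,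
      Matrix.conjTranspose_mul, Matrix.conjTranspose_nonsing_inv, conjTranspose_corr,
      conjTranspose_corr, Matrix.mul_neg, Matrix.mul_nonsing_inv_cancel_left _ _ h,
      add_neg_cancel]
  rw [corr_add_left hu h1 h3, corr_mulVec_left _ hp h3, h4, Matrix.mul_zero, add_zero,
    corr_add_right hu hu h1, corr_mulVec_right _ hu hp, hK, Matrix.conjTranspose_neg,
    Matrix.conjTranspose_mul, Matrix.conjTranspose_nonsing_inv, conjTranspose_corr, Matrix.mul_neg,
    ← sub_eq_add_neg, conjTranspose_corr, Matrix.mul_assoc]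

variable [Fintype ι] [DecidableEq ι] [Fintype κ] [DecidableEq κ] {σa σe : ℝ}
  {a : Ω → ι → ℂ} {e : Ω → κ → ℂ}

/-- The mean square error of the linear estimate of a white field from noisy samples. -/
theorem IsWhiteModel.integral_error (hw : IsWhiteModel P σa σe a e)
    (hσe : 0 < σe) (A : Matrix κ ι ℂ) {p : Ω → κ → ℂ}
    (hp : p = fun ω => A *ᵥ a ω + e ω) :
    ∫ ω, ∑ i, ‖(a ω - (corr P a p * (corr P p p)⁻¹) *ᵥ p ω) i‖ ^ 2 ∂P =
      σa ^ 2 * (Fintype.card ι - resLoss (((σa ^ 2 / σe ^ 2 : ℝ) : ℂ) • (Aᴴ * A))) := by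
  have hA := memLp_mulVec A hw.memLp_field
  have hpL : ∀ i, MemLp (fun ω => p ω i) 2 P := by
    rw [hp]; exact fun i => (hA i).add (hw.memLp_noise i)
  have hea : corr P e a = 0 := by
    rw [← conjTranspose_corr, hw.corr_field_noise, Matrix.conjTranspose_zero]
  have hap : corr P a p = ((σa ^ 2 : ℝ) : ℂ) • Aᴴ := by
    rw [hp, corr_add_right hw.memLp_field hA hw.memLp_noise,
      corr_mulVec_right _ hw.memLp_field hw.memLp_field, hw.corr_field, hw.corr_field_noise,
      add_zero, Matrix.smul_mul, Matrix.one_mul]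
  have hep : corr P e p = ((σe ^ 2 : ℝ) : ℂ) • 1 := by
    rw [hp, corr_add_right hw.memLp_noise hA hw.memLp_noise,
      corr_mulVec_right _ hw.memLp_noise hw.memLp_field, hw.corr_noise, hea, Matrix.zero_mul,
      zero_add]
  set γ := σa ^ 2 / σe ^ 2 with hγ
  have hγσ : σe ^ 2 * γ = σa ^ 2 := by rw [hγ]; field_simp
  have hγ0 : 0 ≤ γ := by positivity
  have hσ : ((σe ^ 2 : ℝ) : ℂ) ≠ 0 := by exact_mod_cast (pow_pos hσe 2).ne'
  have hpp : corr P p p = ((σe ^ 2 : ℝ) : ℂ) • (1 + (γ : ℂ) • (A * Aᴴ)) := by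
    have : corr P p p = corr P (fun ω => A *ᵥ a ω + e ω) p := by rw [← hp]
    rw [this, corr_add_left hA hw.memLp_noise hpL, corr_mulVec_left _ hw.memLp_field hpL, hap, hep,
      Matrix.mul_smul, smul_add, smul_smul, ← Complex.ofReal_mul, hγσ, add_comm]
  -- With the factor √γ the matrices 1 + γ A Aᴴ of the samples and 1 + γ Aᴴ A of the field become
  -- the two sides of Sylvester's identity.
  set W : Matrix ι κ ℂ := ((√γ : ℝ) : ℂ) • Aᴴ with hW
  have hWW : W * Wᴴ = (γ : ℂ) • (Aᴴ * A) ∧ Wᴴ * W = (γ : ℂ) • (A * Aᴴ) := by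
    rw [hW, Matrix.conjTranspose_smul, Matrix.conjTranspose_conjTranspose]
    simp only [Matrix.smul_mul, Matrix.mul_smul, smul_smul, RCLike.star_def, Complex.conj_ofReal,
      ← Complex.ofReal_mul, Real.mul_self_sqrt hγ0, and_self]
  clear_value W
  have hQ : IsUnit (1 + Wᴴ * W).det :=
    isUnit_one_add (Matrix.posSemidef_conjTranspose_mul_self W)
  rw [← hWW.2] at hpp
  rw [← hWW.1, resLoss_mul_conjTranspose]
  have hinv : (corr P p p)⁻¹ = ((σe ^ 2 : ℝ) : ℂ)⁻¹ • (1 + Wᴴ * W)⁻¹ := by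
    refine Matrix.inv_eq_right_inv ?_
    rw [hpp, Matrix.smul_mul, Matrix.mul_smul, Matrix.mul_nonsing_inv _ hQ, smul_smul,
      mul_inv_cancel₀ hσ, one_smul]
  have hdet : IsUnit (corr P p p).det := by
    rw [hpp, Matrix.det_smul]
    exact (IsUnit.mk0 _ (pow_ne_zero _ hσ)).mul hQ
  -- As γ A Aᴴ = Wᴴ W, cyclicity turns the left side into the trace of (1 + Wᴴ W)⁻¹ Wᴴ W, which is
  -- the loss on the sample side.
  have htr : Matrix.trace (Aᴴ * (1 + Wᴴ * W)⁻¹ * A) * (γ : ℂ) =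
      Fintype.card κ - Matrix.trace (1 + Wᴴ * W)⁻¹ := by
    have h1 : (1 + Wᴴ * W)⁻¹ * (Wᴴ * W) = 1 - (1 + Wᴴ * W)⁻¹ := by
      have := Matrix.nonsing_inv_mul _ hQ
      rw [Matrix.mul_add, Matrix.mul_one] at this
      exact eq_sub_of_add_eq' this
    rw [← Matrix.trace_one, ← Matrix.trace_sub, ← h1, Matrix.mul_assoc, Matrix.trace_mul_comm,
      Matrix.mul_assoc, mul_comm, hWW.2, Matrix.mul_smul, Matrix.trace_smul, smul_eq_mul]
  have herr : ∀ i, MemLp (fun ω => (a ω - (corr P a p * (corr P p p)⁻¹) *ᵥ p ω) i) 2 P :=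
    fun i => (hw.memLp_field i).sub (memLp_mulVec _ hpL i)
  rw [integral_sum_norm_sq herr, corr_sub_linear_estimate hw.memLp_field hpL hdet, hw.corr_field,
    hap, hinv, Matrix.conjTranspose_smul, Matrix.conjTranspose_conjTranspose, RCLike.star_def,
    Complex.conj_ofReal]
  simp only [Matrix.smul_mul, Matrix.mul_smul, smul_smul, Matrix.trace_sub, Matrix.trace_smul,
    Matrix.trace_one, smul_eq_mul]
  have hc : ((σe ^ 2 : ℝ) : ℂ)⁻¹ * ((σa ^ 2 : ℝ) : ℂ) = γ := by
    rw [hγ]; push_cast; ring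
  rw [hc, mul_assoc, mul_comm (γ : ℂ), htr, ← mul_sub, Complex.re_ofReal_mul, resLoss]
  simp

end LinearEstimation

/-! ### Passage to the transform, the level distribution and the mean square error -/

section Asymptotics

variable {d : ℕ} {f : (Fin d → ℝ) → ℝ}

theorem vandermonde_mul_conjTranspose (d n m : ℕ) (x : Fin m → Fin d → ℝ) :
    vandermonde d n m x * (vandermonde d n m x)ᴴ =
      (((m : ℝ)⁻¹ : ℝ) : ℂ) • (pointsMat n 1 x * (pointsMat n 1 x)ᴴ) := by
  have h1 : vandermonde d n m x = (((m : ℝ) ^ (-1 / 2 : ℝ) : ℝ) : ℂ) • pointsMat n 1 x := by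
    ext l q
    simp [vandermonde, pointsMat, pointCol]
  rw [h1, Matrix.conjTranspose_smul, Matrix.smul_mul, Matrix.mul_smul, smul_smul, RCLike.star_def,
    Complex.conj_ofReal, ← Complex.ofReal_mul, ← sq, ← Real.rpow_natCast,
    ← Real.rpow_mul (Nat.cast_nonneg m), ← Real.rpow_neg_one]
  norm_num

theorem smul_vandermonde_mul_conjTranspose {n m : ℕ} {s t : ℝ} (ht : 0 ≤ t)
    (hst : s * (m : ℝ)⁻¹ = t)
    (x : Fin m → Fin d → ℝ) :
    (s : ℂ) • (vandermonde d n m x * (vandermonde d n m x)ᴴ) =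
      pointsMat n t x * (pointsMat n t x)ᴴ := by
  rw [vandermonde_mul_conjTranspose, smul_smul, pointsMat_mul_conjTranspose n ht,
    ← Complex.ofReal_mul, hst]

theorem integral_one_sub_resLoss (hf : IsDensity d f) {n m : ℕ} (hn : 0 < n) (t : ℝ) :
    ∫ x, ((n : ℝ) ^ d - resLoss (pointsMat n t x * (pointsMat n t x)ᴴ)) / (n : ℝ) ^ d
      ∂(samplingLaw d m f) = 1 - meanLoss n t (pointLaw d f) m / (n : ℝ) ^ d := by
  have := hf.isProbabilityMeasure
  have hN : (n : ℝ) ^ d ≠ 0 := by positivity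
  rw [samplingLaw, integral_div, integral_sub (integrable_const _)
    (integrable_resLoss_pointsMat n t m), ← meanLoss_eq_integral, integral_const, sub_div]
  simp [hN]

theorem etaFinite_eq (hf : IsDensity d f) {γ : ℝ} (hγ : 0 ≤ γ) {n m : ℕ} (hn : 0 < n) :
    etaFinite d f γ n m =
      1 - meanLoss n (γ * (m : ℝ)⁻¹) (pointLaw d f) m / (n : ℝ) ^ d := by
  rw [← integral_one_sub_resLoss hf hn, etaFinite]
  have ht : 0 ≤ γ * (m : ℝ)⁻¹ := by positivity
  simp only [smul_vandermonde_mul_conjTranspose ht rfl, resLoss, Fintype.card_pi, Fintype.card_fin,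
    Finset.prod_const, Finset.card_univ, Nat.cast_pow, sub_sub_cancel]
  simp only [add_comm]

/-- The samples are A a + e with A = (n^d / m)^(-1/2) Vᴴ. The aspect ratio and the factor 1 / m in V
Vᴴ combine to the coefficient γ / n^d, with γ = σa² / σe². -/
theorem mseFinite_eq {Ω : Type*} [MeasurableSpace Ω] {P : Measure Ω} (hf : IsDensity d f)
    {σa σe : ℝ} (hσa : 0 < σa) (hσe : 0 < σe) {n m : ℕ} (hn : 0 < n) (hm : 0 < m)
    {a : Ω → (Fin d → Fin n) → ℂ} {e : Ω → Fin m → ℂ} (hw : IsWhiteModel P σa σe a e) :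
    mseFinite P σa d f n m a e =
      1 - meanLoss n (σa ^ 2 / σe ^ 2 / (n : ℝ) ^ d) (pointLaw d f) m / (n : ℝ) ^ d := by
  have hN : (0 : ℝ) < (n : ℝ) ^ d := by positivity
  have hm' : (0 : ℝ) < m := by exact_mod_cast hm
  have hβ : 0 < aspect d n m := div_pos hN hm'
  rw [← integral_one_sub_resLoss hf hn, mseFinite]
  congr 1
  ext x
  set r : ℝ := aspect d n m ^ (-1 / 2 : ℝ) with hr
  have hrr : r * r = (aspect d n m)⁻¹ := by
    rw [hr, ← Real.rpow_add hβ, ← Real.rpow_neg_one]; norm_num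
  have h1 := hw.integral_error hσe ((r : ℂ) • (vandermonde d n m x)ᴴ)
    (p := samples d n m a e x) (by ext1 ω; rw [samples, Matrix.smul_mulVec])
  have ht : 0 ≤ σa ^ 2 / σe ^ 2 / (n : ℝ) ^ d := by positivity
  simp only [Matrix.conjTranspose_smul, Matrix.conjTranspose_conjTranspose, Matrix.smul_mul,
    Matrix.mul_smul, smul_smul, RCLike.star_def, Complex.conj_ofReal, ← Complex.ofReal_mul,
    hrr] at h1
  rw [smul_vandermonde_mul_conjTranspose ht] at h1
  · simp only [Pi.sub_apply, Fintype.card_pi, Fintype.card_fin, Finset.prod_const,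
      Finset.card_univ, Nat.cast_pow] at h1
    simp only [lmmse]
    rw [h1, mul_div_mul_left _ _ (by positivity)]
  · rw [aspect]; field_simp

instance isCountablyGenerated_regime (d : ℕ) (β : ℝ) : (regime d β).IsCountablyGenerated := by
  unfold regime; infer_instance

theorem tendsto_fst_regime (d : ℕ) (β : ℝ) : Tendsto Prod.fst (regime d β) atTop :=
  tendsto_fst.mono_left inf_le_left

theorem tendsto_snd_regime (d : ℕ) (β : ℝ) : Tendsto Prod.snd (regime d β) atTop :=
  tendsto_snd.mono_left inf_le_left

theorem tendsto_aspect (d : ℕ) (β : ℝ) :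
    Tendsto (fun p : ℕ × ℕ => aspect d p.1 p.2) (regime d β) (𝓝 β) :=
  tendsto_comap.mono_left inf_le_right

theorem tendsto_div_pow_regime (d : ℕ) {β : ℝ} (hβ : 0 < β) :
    Tendsto (fun p : ℕ × ℕ => (p.2 : ℝ) / (p.1 : ℝ) ^ d) (regime d β) (𝓝 β⁻¹) := by
  simpa only [aspect, inv_div] using (tendsto_aspect d β).inv₀ hβ.ne'

/-- The coefficient of each point is γ / m and (γ / m) n^d → γ β, while m / n^d → 1 / β; these are
the two parameters of `uniLimit`. -/
theorem tendsto_etaFinite (hd : 1 ≤ d) (hf : IsDensity d f) {β γ : ℝ} (hβ : 0 < β) (hγ : 0 ≤ γ) :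
    Tendsto (fun p : ℕ × ℕ => etaFinite d f γ p.1 p.2) (regime d β)
      (𝓝 (1 - ∫ z in cube d, uniLimit d (γ * β) (β⁻¹ * f z))) := by
  have h := tendsto_meanLoss hd hf (t := fun p : ℕ × ℕ => γ * (p.2 : ℝ)⁻¹) (mul_nonneg hγ hβ.le)
    (inv_nonneg.2 hβ.le) (tendsto_fst_regime d β) (Eventually.of_forall fun p => by positivity)
    (tendsto_div_pow_regime d hβ)
    (((tendsto_aspect d β).const_mul γ).congr fun p => by rw [aspect]; ring)
  refine (h.const_sub 1).congr' ?_
  filter_upwards [(tendsto_fst_regime d β).eventually_gt_atTop 0] with p hp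
  exact (etaFinite_eq hf hγ hp).symm

theorem eta_eq (hd : 1 ≤ d) (hf : IsDensity d f) {β γ : ℝ} (hβ : 0 < β) (hγ : 0 ≤ γ) :
    eta d f β γ = 1 - ∫ z in cube d, uniLimit d (γ * β) (β⁻¹ * f z) := by
  have := regime_neBot d hd β hβ
  exact (tendsto_etaFinite hd hf hβ hγ).limUnder_eq

theorem tendsto_etaFinite_eta (hd : 1 ≤ d) (hf : IsDensity d f) {β γ : ℝ} (hβ : 0 < β)
    (hγ : 0 ≤ γ) :
    Tendsto (fun p : ℕ × ℕ => etaFinite d f γ p.1 p.2) (regime d β) (𝓝 (eta d f β γ)) := by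
  rw [eta_eq hd hf hβ hγ]
  exact tendsto_etaFinite hd hf hβ hγ

theorem etaU_eq (hd : 1 ≤ d) {β γ : ℝ} (hβ : 0 < β) (hγ : 0 ≤ γ) :
    etaU d β γ = 1 - uniLimit d (γ * β) β⁻¹ := by
  rw [etaU, eta_eq hd (isDensity_one d) hβ hγ]
  simp

/-- The product (γ y)(β / y) = γ β does not depend on y: local density y multiplies the number of
points and leaves the coefficient of each point unchanged. -/
theorem etaU_div_mul (hd : 1 ≤ d) {β γ y : ℝ} (hβ : 0 < β) (hγ : 0 ≤ γ) (hy : 0 < y) :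
    etaU d (β / y) (γ * y) = 1 - uniLimit d (γ * β) (β⁻¹ * y) := by
  rw [etaU_eq hd (div_pos hβ hy) (mul_nonneg hγ hy.le), inv_div, div_eq_mul_inv y]
  have h1 : γ * y * (β / y) = γ * β := by field_simp
  rw [h1, mul_comm y]

theorem IsDensity.measurableSet_posSet (hf : IsDensity d f) : MeasurableSet (posSet d f) :=
  measurableSet_cube.inter (measurableSet_lt measurable_const hf.measurable)

theorem posSet_subset_cube (d : ℕ) (f : (Fin d → ℝ) → ℝ) : posSet d f ⊆ cube d := fun _ h => h.1

theorem volume_posSet_ne_top (d : ℕ) (f : (Fin d → ℝ) → ℝ) : volume (posSet d f) ≠ ⊤ :=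
  ((measure_mono (posSet_subset_cube d f)).trans_lt
    (by rw [volume_cube]; exact ENNReal.one_lt_top)).ne

theorem IsDensity.volume_posSet_ne_zero (hf : IsDensity d f) : volume (posSet d f) ≠ 0 := by
  intro h
  have h1 : ∫ z in cube d, f z = 0 := by
    refine integral_eq_zero_of_ae ?_
    rw [Filter.EventuallyEq, ae_restrict_iff' measurableSet_cube]
    filter_upwards [measure_eq_zero_iff_ae_notMem.1 h] with z hz hzc
    exact le_antisymm (not_lt.1 fun h0 => hz ⟨hzc, h0⟩) (hf.nonneg z hzc)
  exact zero_ne_one (h1.symm.trans hf.integral_eq_one)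

theorem IsDensity.isProbabilityMeasure_levelLaw (hf : IsDensity d f) :
    IsProbabilityMeasure (levelLaw d f) :=
  ⟨by
    rw [levelLaw, Measure.smul_apply, Measure.map_apply hf.measurable MeasurableSet.univ,
      preimage_univ, Measure.restrict_apply_univ, smul_eq_mul,
      ENNReal.inv_mul_cancel hf.volume_posSet_ne_zero (volume_posSet_ne_top d f)]⟩

/-- On (0, ∞) the integrand agrees with 1 minus a bounded continuous function of y, and the level
distribution is a probability measure. -/
theorem integrableOn_etaU (hd : 1 ≤ d) (hf : IsDensity d f) {β γ : ℝ} (hβ : 0 < β) (hγ : 0 ≤ γ) :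
    IntegrableOn (fun y => etaU d (β / y) (γ * y)) (Ioi 0) (levelLaw d f) := by
  have := hf.isProbabilityMeasure_levelLaw
  have hτ := mul_nonneg hγ hβ.le
  have h1 : IntegrableOn (fun y : ℝ => uniLimit d (γ * β) (max (β⁻¹ * y) 0)) (Ioi 0)
      (levelLaw d f) :=
    (Integrable.of_bound ((continuous_uniLimit_max hd hτ).measurable.comp
      (measurable_id.const_mul β⁻¹)).aestronglyMeasurable 1
        (Eventually.of_forall fun y => abs_uniLimit_le hd hτ (le_max_right _ _))).integrableOn
  refine ((integrable_const (1 : ℝ)).sub h1).congr ?_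
  filter_upwards [ae_restrict_mem measurableSet_Ioi] with y hy
  have hy' : 0 < y := hy
  simp only [Pi.sub_apply, etaU_div_mul hd hβ hγ hy', max_eq_left (by positivity : 0 ≤ β⁻¹ * y)]

/-- The restriction to (0, ∞) is harmless because f > 0 on the set that is pushed forward; the
factor |𝒜| undoes the normalization. -/
theorem integral_levelLaw (hf : IsDensity d f) {h : ℝ → ℝ} (hh : Measurable h) :
    volume.real (posSet d f) * ∫ y in Ioi 0, h y ∂(levelLaw d f) =
      ∫ z in posSet d f, h (f z) := by
  have h1 : (levelLaw d f).restrict (Ioi 0) = levelLaw d f := by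
    refine Measure.restrict_eq_self_of_ae_mem ?_
    rw [levelLaw]
    refine Measure.ae_smul_measure ?_ _
    refine (ae_map_iff hf.measurable.aemeasurable measurableSet_Ioi).2 ?_
    exact (ae_restrict_mem hf.measurableSet_posSet).mono fun z hz => hz.2
  have hv : volume.real (posSet d f) ≠ 0 :=
    (ENNReal.toReal_pos hf.volume_posSet_ne_zero (volume_posSet_ne_top d f)).ne'
  rw [h1, levelLaw, integral_smul_measure, integral_map hf.measurable.aemeasurable
    hh.aestronglyMeasurable, ENNReal.toReal_inv, smul_eq_mul, ← mul_assoc]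
  exact (congrArg (· * _) (mul_inv_cancel₀ hv)).trans (one_mul _)

/-- Where f = 0 there is asymptotically no loss, so the complement of 𝒜 contributes its full measure
1 - |𝒜|; on 𝒜 the integrand depends on z only through f z. -/
theorem eta_eq_integral_etaU (hd : 1 ≤ d) (hf : IsDensity d f) {β γ : ℝ} (hβ : 0 < β)
    (hγ : 0 ≤ γ) :
    eta d f β γ = 1 - volume.real (posSet d f) + volume.real (posSet d f) *
      ∫ y in Ioi 0, etaU d (β / y) (γ * y) ∂(levelLaw d f) := by
  have hτ := mul_nonneg hγ hβ.le
  have hv : 0 < β⁻¹ := inv_pos.2 hβ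
  have e1 : ∫ y in Ioi 0, etaU d (β / y) (γ * y) ∂(levelLaw d f) =
      ∫ y in Ioi 0, (1 - uniLimit d (γ * β) (max (β⁻¹ * y) 0)) ∂(levelLaw d f) := by
    refine setIntegral_congr_fun measurableSet_Ioi fun y hy => ?_
    have hy' : 0 < y := hy
    simp only [etaU_div_mul hd hβ hγ hy', max_eq_left (by positivity : 0 ≤ β⁻¹ * y)]
  have e2 : ∫ z in posSet d f, (1 - uniLimit d (γ * β) (max (β⁻¹ * f z) 0)) =
      ∫ z in posSet d f, (1 - uniLimit d (γ * β) (β⁻¹ * f z)) := by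
    refine setIntegral_congr_fun hf.measurableSet_posSet fun z hz => ?_
    simp only [max_eq_left (mul_nonneg hv.le hz.2.le)]
  have e3 : ∫ z in cube d, uniLimit d (γ * β) (β⁻¹ * f z) =
      ∫ z in posSet d f, uniLimit d (γ * β) (β⁻¹ * f z) := by
    refine setIntegral_eq_of_subset_of_forall_sdiff_eq_zero measurableSet_cube
      (posSet_subset_cube d f) fun z hz => ?_
    have : f z = 0 := le_antisymm (not_lt.1 fun h0 => hz.2 ⟨hz.1, h0⟩) (hf.nonneg z hz.1)
    rw [this, mul_zero, uniLimit_zero hd hτ]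
  have hi : IntegrableOn (fun z => uniLimit d (γ * β) (β⁻¹ * f z)) (posSet d f) :=
    (integrableOn_uniLimit_comp hd hτ hv.le hf).mono_set (posSet_subset_cube d f)
  have hh : Measurable fun y : ℝ => 1 - uniLimit d (γ * β) (max (β⁻¹ * y) 0) :=
    measurable_const.sub
      ((continuous_uniLimit_max hd hτ).measurable.comp (measurable_id.const_mul β⁻¹))
  have hc : IntegrableOn (fun _ => (1 : ℝ)) (posSet d f) :=
    integrableOn_const (volume_posSet_ne_top d f)
  rw [e1, integral_levelLaw hf hh, e2,
    integral_sub hc hi, eta_eq hd hf hβ hγ, e3,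
    setIntegral_const, smul_eq_mul, mul_one]
  ring

theorem tendsto_mseFinite {Ω : Type*} [MeasurableSpace Ω] {P : Measure Ω} (hd : 1 ≤ d)
    (hf : IsDensity d f) {β : ℝ} (hβ : 0 < β) {σa σe : ℝ} (hσa : 0 < σa) (hσe : 0 < σe)
    {a : ∀ n _m : ℕ, Ω → (Fin d → Fin n) → ℂ} {e : ∀ _n m : ℕ, Ω → Fin m → ℂ}
    (hw : ∀ n m, IsWhiteModel P σa σe (a n m) (e n m)) :
    Tendsto (fun p : ℕ × ℕ => mseFinite P σa d f p.1 p.2 (a p.1 p.2) (e p.1 p.2))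
      (regime d β) (𝓝 (eta d f β (σa ^ 2 / σe ^ 2 / β))) := by
  set γ := σa ^ 2 / σe ^ 2
  have hγ : 0 ≤ γ := by positivity
  rw [eta_eq hd hf hβ (div_nonneg hγ hβ.le), div_mul_cancel₀ _ hβ.ne']
  have h := tendsto_meanLoss hd hf (t := fun p : ℕ × ℕ => γ / (p.1 : ℝ) ^ d) hγ
    (inv_nonneg.2 hβ.le) (tendsto_fst_regime d β) (Eventually.of_forall fun p => by positivity)
    (tendsto_div_pow_regime d hβ) (tendsto_const_nhds.congr' (by
      filter_upwards [(tendsto_fst_regime d β).eventually_gt_atTop 0] with p hp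
      have : (p.1 : ℝ) ^ d ≠ 0 := by positivity
      field_simp))
  refine (h.const_sub 1).congr' ?_
  filter_upwards [(tendsto_fst_regime d β).eventually_gt_atTop 0,
    (tendsto_snd_regime d β).eventually_gt_atTop 0] with p hp hp'
  exact (mseFinite_eq hf hσa hσe hp hp' (hw _ _)).symm

end Asymptotics

end VandermondeField

end

/-! ### The main theorem -/

theorem corollary2 (d : ℕ) (hd : 1 ≤ d) (f : (Fin d → ℝ) → ℝ) (hf : Measurable f)
    (hf_nonneg : ∀ z ∈ cube d, 0 ≤ f z)
    (hf_one : ∫⁻ z in cube d, ENNReal.ofReal (f z) = 1)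
    (β : ℝ) (hβ : 0 < β) :
    -- the asymptotic transform exists for uniformly distributed points
    (∀ b : ℝ, 0 < b → ∀ γ : ℝ, 0 ≤ γ →
      Tendsto (fun p : ℕ × ℕ => etaFinite d (fun _ => 1) γ p.1 p.2) (regime d b)
        (𝓝 (etaU d b γ))) ∧
    -- the asymptotic transform exists for points of density `f`, and its expression
    (∀ γ : ℝ, 0 ≤ γ →
      Tendsto (fun p : ℕ × ℕ => etaFinite d f γ p.1 p.2) (regime d β) (𝓝 (eta d f β γ)) ∧
      IntegrableOn (fun y => etaU d (β / y) (γ * y)) (Set.Ioi 0) (levelLaw d f) ∧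
      eta d f β γ = 1 - volume.real (posSet d f) + volume.real (posSet d f) *
        ∫ y in Set.Ioi 0, etaU d (β / y) (γ * y) ∂(levelLaw d f)) ∧
    -- the asymptotic mean square error of LMMSE field reconstruction
    (∀ (Ω : Type*) [MeasurableSpace Ω] (P : Measure Ω) [IsProbabilityMeasure P]
      (σa σe : ℝ), 0 < σa → 0 < σe →
      ∀ (a : ∀ n m : ℕ, Ω → (Fin d → Fin n) → ℂ) (e : ∀ n m : ℕ, Ω → Fin m → ℂ),
      (∀ n m, IsWhiteModel P σa σe (a n m) (e n m)) →
      ∀ γ : ℝ, γ = σa ^ 2 / σe ^ 2 →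
      Tendsto (fun p : ℕ × ℕ => mseFinite P σa d f p.1 p.2 (a p.1 p.2) (e p.1 p.2))
        (regime d β) (𝓝 (eta d f β (γ / β))) ∧
      IntegrableOn (fun y => etaU d (β / y) (γ / β * y)) (Set.Ioi 0) (levelLaw d f) ∧
      eta d f β (γ / β) = 1 - volume.real (posSet d f) + volume.real (posSet d f) *
        ∫ y in Set.Ioi 0, etaU d (β / y) (γ / β * y) ∂(levelLaw d f)) := by
  have h : IsDensity d f := ⟨hf, hf_nonneg, hf_one⟩
  refine ⟨fun b hb γ hγ => tendsto_etaFinite_eta hd (isDensity_one d) hb hγ,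
    fun γ hγ => ⟨tendsto_etaFinite_eta hd h hβ hγ, integrableOn_etaU hd h hβ hγ,
      eta_eq_integral_etaU hd h hβ hγ⟩, ?_⟩
  rintro Ω _ P _ σa σe hσa hσe a e hw γ rfl
  have hγ : 0 ≤ σa ^ 2 / σe ^ 2 / β := by positivity
  exact ⟨tendsto_mseFinite hd h hβ hσa hσe hw, integrableOn_etaU hd h hβ hγ,
    eta_eq_integral_etaU hd h hβ hγ⟩
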